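/- **Theorem 4.1.** Let $q\in\mathbb C$ with $0<|q|<1$, fix a value of $\log q$ and write $q^x=e^{x\log q}$, $[x]=\frac{q^x-q^{-x}}{q-q^{-1}}$. Let $r,k\in\mathbb R$ with $r>0$, $k<r$, $k\neq0,-2$, and put $p=q^{2r}$, $p^*=q^{2(r-k)}$ (so $|p|,|p^*|<1$). Let $a_{j,m}$ ($j=0,1,2$, $m\in\mathbb Z\setminus\{0\}$) and $P_j,Q_j$ be three bosons with zero modes, with the non-zero commutators $$[a_{0,m},a_{0,n}]=\tfrac{[2m][km]}{m}\tfrac{[rm]}{[(r-k)m]}\delta_{m+n,0},\quad [a_{1,m},a_{1,n}]=\tfrac{[2m][(k+2)m]}{m}\delta_{m+n,0},\quad [a_{2,m},a_{2,n}]=-\tfrac{[2m][km]}{m}\delta_{m+n,0},$$ $$[P_0,Q_0]=-i,\quad [P_1,Q_1]=2(k+2),\quad [P_2,Q_2]=-2k,$$ acting on the direct sum, over all $\alpha\in\mathbb C^3$, of the Fock spaces $\mathbb C[a_{j,-m}\,(m>0)]\,|\alpha\rangle$, where $a_{j,m}|\alpha\rangle=0$ for $m>0$ and $P_j|\alpha\rangle=\alpha_j|\alpha\rangle$.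 Put $a'_{0,m}=\frac{[(r-k)m]}{[rm]}a_{0,m}$ and $$\phi_0(A;B,C|z;D)=\tfrac{A}{BC}\sqrt{\tfrac{2kr}{r-k}}\,(iQ_0+P_0\log z)+\sum_{m\ne0}\tfrac{[Am]}{[Bm][Cm]}a_{0,m}z^{-m}q^{D|m|},$$ $$\phi'_0(A;B,C|z;D)=\tfrac{A}{BC}\sqrt{\tfrac{2k(r-k)}{r}}\,(iQ_0+P_0\log z)+\sum_{m\ne0}\tfrac{[Am]}{[Bm][Cm]}a'_{0,m}z^{-m}q^{D|m|},$$ $$\phi_j(A;B,C|z;D)=-\tfrac{A}{BC}(Q_j+P_j\log z)+\sum_{m\ne0}\tfrac{[Am]}{[Bm][Cm]}a_{j,m}z^{-m}q^{D|m|}\quad(j=1,2),$$ $$\phi_j^{(\pm)}(A;B|z;C)=\tfrac{P_j}{2}\log q+(q-q^{-1})\sum_{m>0}\tfrac{[Am]}{[Bm]}a_{j,\pm m}z^{\mp m}q^{Cm}\quad(j=1,2),$$ with principal square roots, $\phi_j(C|z;D)=\phi_j(1;1,C|z;D)$, $\phi_j(C|z)=\phi_j(C|z;0)$, and likewise for $\phi_0'$.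 Let $:\ :$ denote normal ordering (from left to right: $a_{j,-m}$, $a_{j,m}$ with $m>0$, $Q_j$, $P_j$). Define $$\Psi^{\pm}(z)=\frac{\mp1}{q-q^{-1}}:e^{\pm\phi_2(k|z;\pm\frac k2)}\Bigl(e^{-\phi_2^{(+)}(1;2|z;\mp\frac{k+2}2)\pm\phi_1^{(+)}(1;2|z;\mp\frac k2)}-e^{\phi_2^{(-)}(1;2|z;\mp\frac{k+2}2)\mp\phi_1^{(-)}(1;2|z;\mp\frac k2)}\Bigr):,$$ $$k(z)=:e^{-\phi_0(1;2,r|z)}:,\qquad E(z)=\Psi^-(z):e^{-\phi_0(k|z)}:,\qquad F(z)=\Psi^+(z):e^{\phi_0'(k|z)}:.$$ Let $(z;s)_\infty=\prod_{n\ge0}(1-zs^n)$, $(z;s,t)_\infty=\prod_{n,m\ge0}(1-zs^nt^m)$, $\Theta_s(z)=(z;s)_\infty(s/z;s)_\infty(s;s)_\infty$, $$\xi(z;p,q)=\frac{(q^2z;p,q^4)_\infty(pq^2z;p,q^4)_\infty}{(q^4z;p,q^4)_\infty(pz;p,q^4)_\infty},\qquad\delta(z)=\sum_{n\in\mathbb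 Z}z^n .$$ Then these currents satisfy the defining relations of the elliptic algebra $U_{q,p}(\widehat{sl}_2)$ at level $c=k$: $$k(z)k(w)=\Bigl(\frac zw\Bigr)^{\frac{k}{2r(r-k)}}\frac{\xi(w/z;p,q)}{\xi(w/z;p^*,q)}\frac{\xi(z/w;p^*,q)}{\xi(z/w;p,q)}k(w)k(z),$$ $$k(z)E(w)=\Bigl(\frac zw\Bigr)^{\frac1{r-k}}\frac{\Theta_{p^*}(q^{-1}q^{r-k}w/z)}{\Theta_{p^*}(q\,q^{r-k}w/z)}E(w)k(z),\qquad k(z)F(w)=\Bigl(\frac zw\Bigr)^{-\frac1r}\frac{\Theta_{p}(q\,q^{r}w/z)}{\Theta_{p}(q^{-1}q^{r}w/z)}F(w)k(z),$$ $$E(z)E(w)=q^2\Bigl(\frac zw\Bigr)^{\frac2{r-k}}\frac{\Theta_{p^*}(q^{-2}w/z)}{\Theta_{p^*}(q^2w/z)}E(w)E(z),\qquad F(z)F(w)=q^{-2}\Bigl(\frac zw\Bigr)^{-\frac2r}\frac{\Theta_{p}(q^{2}w/z)}{\Theta_{p}(q^{-2}w/z)}F(w)F(z),$$ $$[E(z),F(w)]=\frac1{q-q^{-1}}\Bigl\{\delta(q^{-k}z/w)H^+(q^{-\frac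 k2}z)-\delta(q^{k}z/w)H^-(q^{-\frac k2}w)\Bigr\},$$ where, with $x=q^{\pm(r-\frac k2)+1}z$ and $y=q^{\pm(r-\frac k2)-1}z$, $$H^\pm(z)=x^{-\frac{k}{2r(r-k)}}\lim_{y'\to y}\frac{\xi(y'/x;p^*,q)}{\xi(y'/x;p,q)}\,k(x)k(y').$$ Here the currents are regarded as functions of $\log z$. A product of two currents $A(z)B(w)$ is defined through its matrix elements in the monomial bases of the Fock spaces, which converge absolutely (as sums over intermediate basis vectors) for $|z|>\rho|w|$, with $\rho$ independent of the matrix element, and continue to meromorphic functions of $(\log z,\log w)\in\mathbb C^2$; the first five relations and the formula for $H^\pm$ are understood for these continuations. The last relation is an identity of formal series: on each $|\alpha\rangle$ sector both sides are series in monomials $z^aw^b$, with $a$ and $b$ in fixed cosets of $\mathbb Z$ in $\mathbb C$ given by the zero modes of $E$ and $F$, and the rule $w^b\delta(\lambda z/w)=(\lambda z)^b\delta(\lambda z/w)$ is applied for complex $b$ as well. -/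

import Mathlib

noncomputable section

namespace EllipticSl2

open Filter Topology

/-! Throughout, `lq` is a chosen logarithm of `q` and a current is a function of the logarithm
`ζ = log z` of its argument: the currents contain complex powers of `z`, so they live on the
universal covering of the punctured plane. -/

/-! ### Special functions -/

/-- `q ^ x = exp (x log q)`. -/
def qpow (lq x : ℂ) : ℂ := Complex.exp (x * lq)

/-- `[x] = (q ^ x - q ^ (-x)) / (q - q ^ (-1))`. -/
def qnum (lq x : ℂ) : ℂ := (qpow lq x - qpow lq (-x)) / (qpow lq 1 - qpow lq (-1))

/-- `(z; s)_∞`. -/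
def poch (s z : ℂ) : ℂ := ∏' n : ℕ, (1 - z * s ^ n)

/-- `(z; s, t)_∞`. -/
def poch₂ (s t z : ℂ) : ℂ := ∏' n : ℕ × ℕ, (1 - z * s ^ n.1 * t ^ n.2)

/-- `Θ_s(z) = (z; s)_∞ (s / z; s)_∞ (s; s)_∞`. -/
def theta (s z : ℂ) : ℂ := poch s z * poch s (s / z) * poch s s

/-- The numerator of `ξ(z; p, q)`. -/
def xiNum (p q z : ℂ) : ℂ := poch₂ p (q ^ 4) (q ^ 2 * z) * poch₂ p (q ^ 4) (p * q ^ 2 * z)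

/-- The denominator of `ξ(z; p, q)`. -/
def xiDen (p q z : ℂ) : ℂ := poch₂ p (q ^ 4) (q ^ 4 * z) * poch₂ p (q ^ 4) (p * z)

/-- `ξ(z; p, q)`. -/
def xi (p q z : ℂ) : ℂ := xiNum p q z / xiDen p q z

/-! ### Operators, products of currents and the defining relations -/

/-- An operator from a space with basis `ι` to its completion (all formal, possibly infinite,
combinations of basis vectors), given by its matrix elements `⟨i| A |j⟩`. -/
abbrev Op (ι : Type) := Matrix ι ι ℂ

/-- The product of two operators: sum over intermediate basis vectors. -/
def opMul {ι : Type} (A B : Op ι) : Op ι := fun i j => ∑' l, A i l * B l j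

/-- A meromorphic function on `ℂ × ℂ`, as a quotient of two entire functions. -/
structure MeroFun where
  num : ℂ × ℂ → ℂ
  den : ℂ × ℂ → ℂ
  num_entire : Differentiable ℂ num
  den_entire : Differentiable ℂ den
  den_ne_zero : ∃ x, den x ≠ 0

/-- The matrix element `⟨i| A(z) B(w) |j⟩` converges absolutely for `|z| > e ^ R |w|`, and `f` is
its meromorphic continuation, in the variables `(ζ, ω) = (log z, log w)`. -/
def IsContinuation {ι : Type} (A B : ℂ → Op ι) (R : ℝ) (i j : ι) (f : MeroFun) : Prop :=
  ∀ ζ ω : ℂ, R < (ζ - ω).re →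
    ∃ s : ℂ, HasSum (fun l => A ζ i l * B ω l j) s ∧ s * f.den (ζ, ω) = f.num (ζ, ω)

/-- The relation `A(z) B(w) = (N(z, w) / D(z, w)) B(w) A(z)`, for entire `N` and `D`, in the sense
of meromorphic continuation of matrix elements: the left side converges for `|z| ≫ |w|`, the right
side for `|w| ≫ |z|`. -/
def Exchange {ι : Type} (A B : ℂ → Op ι) (N D : ℂ → ℂ → ℂ) : Prop :=
  ∃ R : ℝ, ∀ i j : ι, ∃ f g : MeroFun,
    IsContinuation A B R i j f ∧ IsContinuation B A R i j g ∧
    ∀ ζ ω : ℂ, D ζ ω * (f.num (ζ, ω) * g.den (ω, ζ)) = N ζ ω * (g.num (ω, ζ) * f.den (ζ, ω))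

/-- `H(z) = H^±(z) = κ(z) k(x) k(y)` with `x = q ^ (±(r - c/2) + 1) z`,
`y = q ^ (±(r - c/2) - 1) z` and
`κ(z) = x ^ (-c / (2 r (r - c))) (ξ(y/x; p*, q) / ξ(y/x; p, q))` at `y/x = q ^ (-2)`, where
`ε = ±1`. Both `ξ(·; p, q)` and `ξ(·; p*, q)` vanish at `q ^ (-2)`, so the value of the meromorphic
function is a limit `y' → y`. -/
def IsH {ι : Type} (lq : ℂ) (r c : ℝ) (K : ℂ → Op ι) (ε : ℝ) (H : ℂ → Op ι) : Prop :=
  let q := qpow lq 1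
  let p := qpow lq (2 * r)
  let ps := qpow lq (2 * (r - c))
  ∃ R : ℝ, ∀ i j : ι, ∃ f : MeroFun, IsContinuation K K R i j f ∧
    ∀ ζ : ℂ,
      let x := ζ + (ε * (r - c / 2) + 1) * lq
      let y := ζ + (ε * (r - c / 2) - 1) * lq
      (∀ᶠ y' in 𝓝[≠] y, f.den (x, y') ≠ 0) ∧
      Tendsto (fun y' => Complex.exp (-(c / (2 * r * (r - c))) * x) *
          (xi ps q (Complex.exp (y' - x)) / xi p q (Complex.exp (y' - x))) *
          (f.num (x, y') / f.den (x, y')))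
        (𝓝[≠] y) (𝓝 (H ζ i j))

/-- `A(z) = ∑ₐ M a z ^ a`, with complex exponents `a`; each matrix element is a finite sum. -/
def IsModeExpansion {ι : Type} (A : ℂ → Op ι) (M : ℂ → Op ι) : Prop :=
  ∀ i j : ι, (Function.support fun a => M a i j).Finite ∧
    ∀ ζ : ℂ, A ζ i j = ∑ᶠ a : ℂ, M a i j * Complex.exp (a * ζ)

/-- `z ^ (-a) A(z) |j⟩` is single-valued in `z`. -/
def SingleValued {ι : Type} (A : ℂ → Op ι) (a : ℂ) (j : ι) : Prop :=
  ∀ (i : ι) (ζ : ℂ), Complex.exp (-a * (ζ + 2 * Real.pi * Complex.I)) *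
    A (ζ + 2 * Real.pi * Complex.I) i j = Complex.exp (-a * ζ) * A ζ i j

/-- `[E(z), F(w)] = (q - q⁻¹)⁻¹ (δ(q ^ (-c) z/w) H⁺(q ^ (-c/2) z) - δ(q ^ c z/w) H⁻(q ^ (-c/2) w))`
as an identity of formal series in `z` and `w`: the coefficients of `z ^ a w ^ b` agree, for all
exponents `a`, `b` that occur in `E(z)`, `F(w)` on `|j⟩` up to integers. If these are not integers,
then `δ(x) = ∑ x ^ n` is, as usual, expanded in the powers that make the monomials on both sides
match, i.e. `w ^ b δ(q ^ (-c) z/w) = (q ^ (-c) z) ^ b δ(q ^ (-c) z/w)` also for complex `b`. So the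
coefficient of `z ^ a w ^ b` in the first term on the right is `q ^ (c b)` times that of
`z ^ (a + b)` in `H⁺(q ^ (-c/2) z)`, and in the second one it is `q ^ (c a)` times that of
`w ^ (a + b)` in `H⁻(q ^ (-c/2) w)`. -/
def CommutatorRelation {ι : Type} (lq : ℂ) (c : ℝ) (E F Hp Hm : ℂ → Op ι) : Prop :=
  ∃ e f hp hm : ℂ → Op ι, IsModeExpansion E e ∧ IsModeExpansion F f ∧
    IsModeExpansion Hp hp ∧ IsModeExpansion Hm hm ∧
    ∀ (i j : ι) (a b : ℂ), SingleValued E a j → SingleValued F b j →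
      ∃ s t : ℂ, HasSum (fun l => e a i l * f b l j) s ∧ HasSum (fun l => f b i l * e a l j) t ∧
        s - t = 1 / (qpow lq 1 - qpow lq (-1)) *
          (qpow lq (c * b) * (qpow lq (-(c / 2) * (a + b)) * hp (a + b) i j) -
           qpow lq (c * a) * (qpow lq (-(c / 2) * (a + b)) * hm (a + b) i j))

/-- The defining relations of the elliptic algebra `U_{q,p}(sl₂^)`, with `p = q ^ (2 r)` and
`p* = p q ^ (-2 c)`, for currents `K`, `E`, `F`, where the central element acts as the scalar
`c`. -/
structure SatisfiesRelations {ι : Type} (lq : ℂ) (r c : ℝ) (K E F : ℂ → Op ι) : Prop where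
  kk : Exchange K K
    (fun ζ ω =>
      let q := qpow lq 1
      let p := qpow lq (2 * r)
      let ps := qpow lq (2 * (r - c))
      Complex.exp (c / (2 * r * (r - c)) * (ζ - ω)) *
        (xiNum p q (Complex.exp (ω - ζ)) * xiDen ps q (Complex.exp (ω - ζ))) *
        (xiNum ps q (Complex.exp (ζ - ω)) * xiDen p q (Complex.exp (ζ - ω))))
    (fun ζ ω =>
      let q := qpow lq 1
      let p := qpow lq (2 * r)
      let ps := qpow lq (2 * (r - c))
      (xiDen p q (Complex.exp (ω - ζ)) * xiNum ps q (Complex.exp (ω - ζ))) *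
        (xiDen ps q (Complex.exp (ζ - ω)) * xiNum p q (Complex.exp (ζ - ω))))
  kE : Exchange K E
    (fun ζ ω => Complex.exp (1 / (r - c) * (ζ - ω)) *
      theta (qpow lq (2 * (r - c))) (qpow lq (-1) * qpow lq (r - c) * Complex.exp (ω - ζ)))
    (fun ζ ω =>
      theta (qpow lq (2 * (r - c))) (qpow lq 1 * qpow lq (r - c) * Complex.exp (ω - ζ)))
  kF : Exchange K F
    (fun ζ ω => Complex.exp (-(1 / r) * (ζ - ω)) *
      theta (qpow lq (2 * r)) (qpow lq 1 * qpow lq r * Complex.exp (ω - ζ)))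
    (fun ζ ω => theta (qpow lq (2 * r)) (qpow lq (-1) * qpow lq r * Complex.exp (ω - ζ)))
  EE : Exchange E E
    (fun ζ ω => qpow lq 2 * Complex.exp (2 / (r - c) * (ζ - ω)) *
      theta (qpow lq (2 * (r - c))) (qpow lq (-2) * Complex.exp (ω - ζ)))
    (fun ζ ω => theta (qpow lq (2 * (r - c))) (qpow lq 2 * Complex.exp (ω - ζ)))
  FF : Exchange F F
    (fun ζ ω => qpow lq (-2) * Complex.exp (-(2 / r) * (ζ - ω)) *
      theta (qpow lq (2 * r)) (qpow lq 2 * Complex.exp (ω - ζ)))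
    (fun ζ ω => theta (qpow lq (2 * r)) (qpow lq (-2) * Complex.exp (ω - ζ)))
  EF : ∃ Hp Hm : ℂ → Op ι, IsH lq r c K 1 Hp ∧ IsH lq r c K (-1) Hm ∧
    CommutatorRelation lq c E F Hp Hm

/-! ### Three bosons with zero modes on their Fock spaces -/

/-- `(j, m)` labels the pair of oscillators `a_{j,m}`, `a_{j,-m}`, `m > 0`. -/
abbrev Osc := Fin 3 × ℕ+

/-- `[a_{j,m}, a_{j,-m}]`. -/
def commCoeff (lq : ℂ) (r k : ℝ) (x : Osc) : ℂ :=
  let m : ℂ := ((x.2 : ℕ) : ℂ)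
  ![qnum lq (2 * m) * qnum lq (k * m) / m * (qnum lq (r * m) / qnum lq ((r - k) * m)),
    qnum lq (2 * m) * qnum lq ((k + 2) * m) / m,
    -(qnum lq (2 * m) * qnum lq (k * m) / m)] x.1

/-- `a_{j,-m}` (`m > 0`) on the oscillator Fock space `ℂ[a_{j,-m}]`. -/
def creation (x : Osc) : Module.End ℂ (MvPolynomial Osc ℂ) :=
  LinearMap.mulLeft ℂ (MvPolynomial.X x)

/-- `a_{j,m}` (`m > 0`) on the oscillator Fock space `ℂ[a_{j,-m}]`. -/
def annihilation (lq : ℂ) (r k : ℝ) (x : Osc) : Module.End ℂ (MvPolynomial Osc ℂ) :=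
  commCoeff lq r k x • (MvPolynomial.pderiv (R := ℂ) x).toLinearMap

theorem annihilation_creation (lq : ℂ) (r k : ℝ) (x y : Osc) :
    annihilation lq r k x * creation y - creation y * annihilation lq r k x =
      if x = y then commCoeff lq r k x • 1 else 0 := by
  refine LinearMap.ext fun v => ?_
  by_cases h : x = y
  · subst h
    simp [annihilation, creation, Derivation.leibniz]
  · simp [annihilation, creation, Derivation.leibniz, MvPolynomial.pderiv_X_of_ne (Ne.symm h), h]

/-- `[P_j, Q_j]`. -/
def zeroComm (k : ℝ) : Fin 3 → ℂ := ![-Complex.I, 2 * (k + 2), -2 * k]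

/-- The basis of the Fock space: `(α, ν)` is the vector `∏ a_{j,-m} ^ ν(j,m) |α⟩`, where `|α⟩` is
annihilated by all `a_{j,m}`, `m > 0`, and `P_j |α⟩ = α_j |α⟩`. -/
abbrev State := (Fin 3 → ℂ) × (Osc →₀ ℕ)

/-- The expression `∑ⱼ (x_j Q_j + y_j P_j) + ∑ⱼ ∑_{m ≠ 0} c_{j,m} a_{j,m}`, given by its
coefficients `(x, y, c)` (the value of `c` at `m = 0` plays no role). -/
abbrev LinForm := (Fin 3 → ℂ) × (Fin 3 → ℂ) × (Fin 3 → ℤ → ℂ)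

/-- The part `∑ c_{j,-m} a_{j,-m}` (`m > 0`) of a linear form, as an element of the completed Fock
space `ℂ⟦a_{j,-m}⟧`, on which it acts by multiplication. -/
def creationPart (X : LinForm) : MvPowerSeries Osc ℂ := fun ν =>
  if ν.degree = 1 then ν.sum fun x n => (n : ℂ) * X.2.2 x.1 (-(x.2 : ℤ)) else 0

/-- The part `∑ c_{j,m} a_{j,m}` (`m > 0`) of a linear form; a finite sum on each vector. -/
def annihilationPart (lq : ℂ) (r k : ℝ) (X : LinForm) (v : MvPolynomial Osc ℂ) :
    MvPolynomial Osc ℂ :=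
  ∑ᶠ x : Osc, X.2.2 x.1 (x.2 : ℤ) • annihilation lq r k x v

/-- `exp (∑ c_{j,m} a_{j,m})` (`m > 0`); the exponential series is finite on each vector. -/
def annihilationExp (lq : ℂ) (r k : ℝ) (X : LinForm) (v : MvPolynomial Osc ℂ) :
    MvPolynomial Osc ℂ :=
  ∑ᶠ n : ℕ, ((n.factorial : ℂ)⁻¹) • (annihilationPart lq r k X)^[n] v

/-- The normal ordered exponential `:exp X:`, i.e. the product, from left to right, of the
exponentials of the parts of `X` in the `a_{j,-m}`, in the `a_{j,m}` (`m > 0`), in the `Q_j` and in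
the `P_j`. Here `exp (x Q_j)` adds `x [P_j, Q_j]` to the eigenvalue of `P_j`. -/
def nexp (lq : ℂ) (r k : ℝ) (X : LinForm) : Op State :=
  open Classical in fun s t =>
    if s.1 = t.1 + X.1 * zeroComm k then
      Complex.exp (∑ j, X.2.1 j * t.1 j) *
        MvPowerSeries.coeff s.2 ((PowerSeries.exp ℂ).subst (creationPart X) *
          (annihilationExp lq r k X (MvPolynomial.monomial t.2 1) : MvPowerSeries Osc ℂ))
    else 0

/-! ### The boson fields -/

/-- `φ_0(A; B, C | z; D)`, `ζ = log z`. -/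
def phi0 (lq : ℂ) (r k A B C : ℝ) (ζ : ℂ) (D : ℝ) : LinForm :=
  let s : ℂ := A / (B * C) * ((2 * k * r / (r - k) : ℝ) : ℂ) ^ (1 / 2 : ℂ)
  (Pi.single 0 (s * Complex.I), Pi.single 0 (s * ζ),
    Pi.single 0 fun m : ℤ => qnum lq (A * m) / (qnum lq (B * m) * qnum lq (C * m)) *
      Complex.exp (-m * ζ) * qpow lq (D * |m|))

/-- `φ'_0(A; B, C | z; D)`, with `a'_{0,m} = ([(r - k) m] / [r m]) a_{0,m}`. -/
def phi0' (lq : ℂ) (r k A B C : ℝ) (ζ : ℂ) (D : ℝ) : LinForm :=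
  let s : ℂ := A / (B * C) * ((2 * k * (r - k) / r : ℝ) : ℂ) ^ (1 / 2 : ℂ)
  (Pi.single 0 (s * Complex.I), Pi.single 0 (s * ζ),
    Pi.single 0 fun m : ℤ => qnum lq (A * m) / (qnum lq (B * m) * qnum lq (C * m)) *
      (qnum lq ((r - k) * m) / qnum lq (r * m)) * Complex.exp (-m * ζ) * qpow lq (D * |m|))

/-- `φ_j(A; B, C | z; D)`, for `j = 1, 2`. -/
def phi (lq : ℂ) (j : Fin 3) (A B C : ℝ) (ζ : ℂ) (D : ℝ) : LinForm :=
  let s : ℂ := -(A / (B * C))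
  (Pi.single j s, Pi.single j (s * ζ),
    Pi.single j fun m : ℤ => qnum lq (A * m) / (qnum lq (B * m) * qnum lq (C * m)) *
      Complex.exp (-m * ζ) * qpow lq (D * |m|))

/-- `φ_j^{(+)}(A; B | z; C)`, for `j = 1, 2`. -/
def phiPlus (lq : ℂ) (j : Fin 3) (A B : ℝ) (ζ : ℂ) (C : ℝ) : LinForm :=
  (0, Pi.single j (lq / 2),
    Pi.single j fun m : ℤ => if 0 < m then (qpow lq 1 - qpow lq (-1)) *
      (qnum lq (A * m) / qnum lq (B * m)) * Complex.exp (-m * ζ) * qpow lq (C * |m|) else 0)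

/-- `φ_j^{(-)}(A; B | z; C)`, for `j = 1, 2`. -/
def phiMinus (lq : ℂ) (j : Fin 3) (A B : ℝ) (ζ : ℂ) (C : ℝ) : LinForm :=
  (0, Pi.single j (lq / 2),
    Pi.single j fun m : ℤ => if m < 0 then (qpow lq 1 - qpow lq (-1)) *
      (qnum lq (A * m) / qnum lq (B * m)) * Complex.exp (-m * ζ) * qpow lq (C * |m|) else 0)

/-! ### The currents -/

/-- The `q`-deformed `ℤ_k` parafermion currents `Ψ^±(z)`, `ε = ±1`. -/
def parafermion (lq : ℂ) (r k ε : ℝ) (ζ : ℂ) : Op State :=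
  (-ε / (qpow lq 1 - qpow lq (-1)) : ℂ) •
    (nexp lq r k (ε • phi lq 2 1 1 k ζ (ε * (k / 2)) +
        (-phiPlus lq 2 1 2 ζ (-ε * ((k + 2) / 2)) + ε • phiPlus lq 1 1 2 ζ (-ε * (k / 2)))) -
      nexp lq r k (ε • phi lq 2 1 1 k ζ (ε * (k / 2)) +
        (phiMinus lq 2 1 2 ζ (-ε * ((k + 2) / 2)) - ε • phiMinus lq 1 1 2 ζ (-ε * (k / 2)))))

/-- `k(z) = :exp (-φ_0(1; 2, r | z)):`. -/
def currentK (lq : ℂ) (r k : ℝ) (ζ : ℂ) : Op State := nexp lq r k (-phi0 lq r k 1 2 r ζ 0)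

/-- `E(z) = Ψ^-(z) :exp (-φ_0(k | z)):`. -/
def currentE (lq : ℂ) (r k : ℝ) (ζ : ℂ) : Op State :=
  opMul (parafermion lq r k (-1) ζ) (nexp lq r k (-phi0 lq r k 1 1 k ζ 0))

/-- `F(z) = Ψ^+(z) :exp (φ'_0(k | z)):`. -/
def currentF (lq : ℂ) (r k : ℝ) (ζ : ℂ) : Op State :=
  opMul (parafermion lq r k 1 ζ) (nexp lq r k (phi0' lq r k 1 1 k ζ 0))

end EllipticSl2

end

noncomputable section

namespace EllipticSl2

open Filter Topology

/-! ### Sums over multi-indices -/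

/-! Each current is a finite linear combination of vertex operators: Gaussian operators whose
oscillator coefficients are multiples of `z ^ (±m)`. By Baker-Campbell-Hausdorff
(`hasSum_gaussOp_mul`) the product of two of them is a scalar, the contraction, times the normal
ordered product `op₂`. The latter is entire in the logarithms of the arguments and symmetric in the
two factors, so every exchange relation reduces to an identity between contractions.

A contraction is a power of `z` and a constant, from the zero modes, times `exp (∑ Γ_m u ^ m)` with
`u = w / z`. The `Γ_m` are rational in `q ^ m`, `q ^ (k m / 2)` and `q ^ (r m)`; comparing them with
`-log (1 - x) = ∑ x ^ m / m` identifies the exponential with a ratio of infinite products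
(`exp_neg_tsum_eq_tprod`, `expSeriesEq_K_K`, `expSeriesEq_E_E`, ...). Since `E` and `F` have two
terms each, one more fact is needed: for all choices of terms the contractions share one power of
`z` and one denominator, and the remaining factors satisfy the same functional equation
(`theta_exchange`).

Between `E` and `F` the infinite products cancel. What remains is `1` for unlike terms and, up to a
constant, `(1 - α u) / (1 - β u)` for like terms. Both orders of the product give the same rational
function, expanded at `u = 0` and at `u = ∞`, so the commutator is a delta function at the pole
times the normal ordered product there (`Vertex.hasSum_commutator`). At that point the bosons `a_1`
and `a_2` drop out and the rest is the normal ordered product of two copies of `k`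
(`op₂_true_eq_currentH`, `op₂_false_eq_currentH`). This is `H^±`, because the prefactor in the
definition of `H^±` is the inverse of the contraction of `k` with `k` (`isH_currentH`).

To pass from functions to formal modes, matrix elements are graded by the level of the oscillators:
normal ordered ones are a monomial times a polynomial in `u`, and the sum over intermediate states
of a fixed level is a Taylor coefficient in `u` (`hasSum_fiber`). -/

theorem hasSum_of_eq {β : Type*} {f g : β → ℂ} {a b : ℂ} (h : HasSum f a) (hf : ∀ n, g n = f n)
    (ha : a = b) : HasSum g b := ha ▸ h.congr_fun hf

theorem sum_finsupp_prod {σ R : Type*} [CommSemiring R] (s : Finset σ) (t : Finset ℕ)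
    (g : σ → ℕ → R) :
    ∑ ν ∈ s.finsupp (fun _ => t), ∏ i ∈ s, g i (ν i) = ∏ i ∈ s, ∑ n ∈ t, g i n := by
  classical
  rw [Finset.prod_sum, Finset.finsupp, Finset.sum_map]
  refine Finset.sum_congr rfl fun p _ => ?_
  rw [← Finset.prod_attach]
  refine Finset.prod_congr rfl fun i _ => ?_
  simp [Finsupp.indicator_of_mem i.2]

open Classical in
-- A sum over occupation numbers of all modes factorises into one sum per mode. On boxes (finitely
-- many modes, bounded occupation) this is distributivity. The bound `C` on products of absolute
-- sums makes the family absolutely summable, and then its sum may be computed along boxes. The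
-- factor is `1` for an unoccupied mode outside `S`, so enlarging the finite product changes
-- nothing.
theorem hasSum_finsupp_prod {σ : Type*} (g : σ → ℕ → ℂ) (S : Finset σ)
    (hg0 : ∀ i ∉ S, g i 0 = 1) (hg : ∀ i, Summable fun n => ‖g i n‖) (C : ℝ)
    (hC : ∀ s : Finset σ, S ⊆ s → ∏ i ∈ s, ∑' n, ‖g i n‖ ≤ C) (L : ℂ)
    (hL : Tendsto (fun s : Finset σ => ∏ i ∈ s, ∑' n, g i n) atTop (𝓝 L)) :
    HasSum (fun ν : σ →₀ ℕ => ∏ i ∈ S ∪ ν.support, g i (ν i)) L := by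
  set G : (σ →₀ ℕ) → ℂ := fun ν => ∏ i ∈ S ∪ ν.support, g i (ν i) with hG
  have hGs : ∀ (s : Finset σ) (ν : σ →₀ ℕ), S ⊆ s → ν.support ⊆ s → G ν = ∏ i ∈ s, g i (ν i) := by
    intro s ν h1 h2
    refine Finset.prod_subset (Finset.union_subset h1 h2) fun i _ hi => ?_
    rw [Finset.notMem_union, Finsupp.notMem_support_iff] at hi
    rw [hi.2, hg0 i hi.1]
  let box : Finset σ × ℕ → Finset (σ →₀ ℕ) :=
    fun p => (S ∪ p.1).finsupp fun _ => Finset.range (p.2 + 1)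
  have hmem : ∀ (p : Finset σ × ℕ) (ν : σ →₀ ℕ),
      ν ∈ box p ↔ ν.support ⊆ S ∪ p.1 ∧ ∀ i ∈ S ∪ p.1, ν i ≤ p.2 := by
    intro p ν; simp [box, Finset.mem_finsupp_iff]
  have hmono : Monotone box := by
    intro p p' hp ν hν
    rw [hmem] at hν ⊢
    refine ⟨hν.1.trans (Finset.union_subset_union_right hp.1), fun i _ => ?_⟩
    by_cases h : i ∈ S ∪ p.1
    · exact (hν.2 i h).trans hp.2
    · rw [Finsupp.notMem_support_iff.1 fun h' => h (hν.1 h')]; exact Nat.zero_le _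
  have hcof : ∀ ν : σ →₀ ℕ, ∃ p, ν ∈ box p := fun ν => by
    refine ⟨(ν.support, ν.support.sup ν), (hmem _ _).2 ⟨Finset.subset_union_right, fun i _ => ?_⟩⟩
    by_cases h : i ∈ ν.support
    · exact Finset.le_sup (f := ν) h
    · rw [Finsupp.notMem_support_iff.1 h]; exact Nat.zero_le _
  have hbox : Tendsto box atTop atTop := tendsto_atTop_finset_of_monotone hmono hcof
  have hsum : ∀ p, ∑ ν ∈ box p, G ν = ∏ i ∈ S ∪ p.1, ∑ n ∈ Finset.range (p.2 + 1), g i n := by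
    intro p
    rw [← sum_finsupp_prod]
    exact Finset.sum_congr rfl fun ν hν =>
      hGs _ _ Finset.subset_union_left ((hmem _ _).1 hν).1
  have hsummable : Summable G := by
    refine Summable.of_norm (summable_of_sum_le (c := C) (fun _ => norm_nonneg _) fun u => ?_)
    obtain ⟨p, hp⟩ := (hbox.eventually_ge_atTop u).exists
    calc ∑ ν ∈ u, ‖G ν‖ ≤ ∑ ν ∈ box p, ‖G ν‖ :=
          Finset.sum_le_sum_of_subset_of_nonneg hp fun _ _ _ => norm_nonneg _
      _ = ∑ ν ∈ box p, ∏ i ∈ S ∪ p.1, ‖g i (ν i)‖ := Finset.sum_congr rfl fun ν hν => by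
          rw [hGs _ _ Finset.subset_union_left ((hmem _ _).1 hν).1, norm_prod]
      _ = ∏ i ∈ S ∪ p.1, ∑ n ∈ Finset.range (p.2 + 1), ‖g i n‖ :=
          sum_finsupp_prod _ _ fun i n => ‖g i n‖
      _ ≤ ∏ i ∈ S ∪ p.1, ∑' n, ‖g i n‖ := Finset.prod_le_prod
          (fun i _ => Finset.sum_nonneg fun _ _ => norm_nonneg _)
          fun i _ => (hg i).sum_le_tsum _ fun _ _ => norm_nonneg _
      _ ≤ C := hC _ Finset.subset_union_left
  obtain ⟨T, hT⟩ := hsummable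
  have hlim : Tendsto (fun p : Finset σ × ℕ =>
      ∏ i ∈ S ∪ p.1, ∑ n ∈ Finset.range (p.2 + 1), g i n) (atTop ×ˢ atTop) (𝓝 T) := by
    rw [prod_atTop_atTop_eq]
    exact (hT.comp hbox).congr hsum
  -- The joint limit over boxes is replaced by an iterated one: the occupation bound goes to
  -- infinity first, and closed balls survive that limit.
  have hlim2 : Tendsto (fun s : Finset σ => ∏ i ∈ S ∪ s, ∑' n, g i n) atTop (𝓝 T) := by
    rw [Metric.nhds_basis_closedBall.tendsto_right_iff] at hlim ⊢
    intro ε hε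
    refine (hlim ε hε).curry.mono fun s hs => ?_
    refine Metric.isClosed_closedBall.mem_of_tendsto ?_ hs
    exact tendsto_finsetProd _ fun i _ =>
      ((Summable.of_norm (hg i)).hasSum.tendsto_sum_nat).comp (tendsto_add_atTop_nat 1)
  have hS : Tendsto (fun s : Finset σ => S ∪ s) atTop atTop :=
    tendsto_atTop_mono (fun s => Finset.subset_union_right) tendsto_id
  rwa [← tendsto_nhds_unique hlim2 (hL.comp hS)]

/-! ### Matrix elements of Gaussian operators -/

/-- The coefficient of `X ^ a` in `exp (x X) (X + y) ^ b`. -/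
def gaussCoeff (x y : ℂ) : ℕ → ℕ → ℂ
  | a, 0 => x ^ a / (a.factorial : ℂ)
  | 0, b + 1 => y * gaussCoeff x y 0 b
  | a + 1, b + 1 => gaussCoeff x y a b + y * gaussCoeff x y (a + 1) b

theorem gaussCoeff_zero_right (x y : ℂ) (a : ℕ) :
    gaussCoeff x y a 0 = x ^ a / (a.factorial : ℂ) := by
  cases a <;> simp [gaussCoeff]

theorem gaussCoeff_zero_succ (x y : ℂ) (b : ℕ) :
    gaussCoeff x y 0 (b + 1) = y * gaussCoeff x y 0 b := by simp [gaussCoeff]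

theorem gaussCoeff_succ_succ (x y : ℂ) (a b : ℕ) :
    gaussCoeff x y (a + 1) (b + 1) = gaussCoeff x y a b + y * gaussCoeff x y (a + 1) b := by
  simp [gaussCoeff]

@[simp]
theorem gaussCoeff_zero_zero (x y : ℂ) : gaussCoeff x y 0 0 = 1 := by simp [gaussCoeff]

theorem gaussCoeff_zero_left (x y : ℂ) (b : ℕ) : gaussCoeff x y 0 b = y ^ b := by
  induction b with
  | zero => simp
  | succ b ih => rw [gaussCoeff_zero_succ, ih, pow_succ']

theorem gaussCoeff_zero_left_of_lt (y : ℂ) (a b : ℕ) (h : b < a) : gaussCoeff 0 y a b = 0 := by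
  induction b generalizing a with
  | zero => rw [gaussCoeff_zero_right, zero_pow h.ne', zero_div]
  | succ b ih =>
    obtain ⟨a, rfl⟩ : ∃ c, a = c + 1 := ⟨a - 1, by omega⟩
    rw [gaussCoeff_succ_succ, ih _ (by omega), ih _ (by omega)]; simp

theorem gaussCoeff_zero_right_arg (x : ℂ) (b c : ℕ) :
    gaussCoeff x 0 (b + c) b = x ^ c / (c.factorial : ℂ) := by
  induction b with
  | zero => rw [Nat.zero_add, gaussCoeff_zero_right]
  | succ b ih => rw [Nat.add_right_comm, gaussCoeff_succ_succ, ih]; simp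

theorem gaussCoeff_scale (x y t : ℂ) (ht : t ≠ 0) (a b : ℕ) :
    gaussCoeff (x * t) (y * t⁻¹) a b = t ^ ((a : ℤ) - b) * gaussCoeff x y a b := by
  induction b generalizing a with
  | zero => simp only [gaussCoeff_zero_right]; simp [mul_pow]; ring
  | succ b ih =>
    cases a with
    | zero =>
      rw [gaussCoeff_zero_succ, gaussCoeff_zero_succ, ih,
        show ((0 : ℕ) : ℤ) - ((b + 1 : ℕ) : ℤ) = ((0 : ℕ) : ℤ) - b - 1 by push_cast; ring,
        zpow_sub_one₀ ht]
      ring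
    | succ a =>
      rw [gaussCoeff_succ_succ, gaussCoeff_succ_succ, ih, ih,
        show ((a + 1 : ℕ) : ℤ) - ((b + 1 : ℕ) : ℤ) = (a : ℤ) - b by push_cast; ring,
        show ((a + 1 : ℕ) : ℤ) - (b : ℤ) = (a : ℤ) - b + 1 by push_cast; ring, zpow_add_one₀ ht]
      field_simp

theorem norm_gaussCoeff_le (x y : ℂ) (a b : ℕ) :
    ‖gaussCoeff x y a b‖ ≤ Real.exp ‖x‖ * (1 + ‖y‖) ^ b := by
  induction b generalizing a with
  | zero =>
    rw [gaussCoeff_zero_right, norm_div, norm_pow, Complex.norm_natCast, pow_zero, mul_one]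
    exact Real.pow_div_factorial_le_exp _ (norm_nonneg _) _
  | succ b ih =>
    cases a with
    | zero =>
      rw [gaussCoeff_zero_succ, norm_mul, pow_succ]
      nlinarith [ih 0, norm_nonneg y, norm_nonneg (gaussCoeff x y 0 b)]
    | succ a =>
      rw [gaussCoeff_succ_succ]
      refine (norm_add_le _ _).trans ?_
      rw [norm_mul, pow_succ]
      nlinarith [ih a, ih (a + 1), norm_nonneg y, norm_nonneg (gaussCoeff x y (a + 1) b)]

/-- In the left index the coefficients decay faster than any geometric sequence, while by
`norm_gaussCoeff_le` they grow at most geometrically in the right one. Hence products for a single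
mode converge absolutely without any smallness assumption. -/
theorem summable_gaussCoeff_mul_pow (x y : ℂ) (b : ℕ) (K : ℝ) :
    Summable fun n => ‖gaussCoeff x y n b‖ * K ^ n := by
  induction b with
  | zero =>
    refine (Real.summable_pow_div_factorial (‖x‖ * K)).congr fun n => ?_
    rw [gaussCoeff_zero_right, norm_div, norm_pow, Complex.norm_natCast, mul_pow]; ring
  | succ b ih =>
    rw [← summable_nat_add_iff 1] at ih ⊢
    have h0 : Summable fun n => ‖gaussCoeff x y n b‖ * K ^ n := by
      rwa [← summable_nat_add_iff 1]
    have h := ((h0.norm.mul_left |K|).add (ih.norm.mul_left ‖y‖))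
    refine Summable.of_norm_bounded h fun n => ?_
    rw [gaussCoeff_succ_succ, norm_mul, norm_norm, norm_pow, Real.norm_eq_abs, pow_succ]
    simp only [norm_mul, norm_pow, Real.norm_eq_abs, abs_norm]
    calc ‖gaussCoeff x y n b + y * gaussCoeff x y (n + 1) b‖ * (|K| ^ n * |K|)
        ≤ (‖gaussCoeff x y n b‖ + ‖y‖ * ‖gaussCoeff x y (n + 1) b‖) * (|K| ^ n * |K|) := by
          gcongr
          exact (norm_add_le _ _).trans (by rw [norm_mul])
      _ = _ := by ring

theorem summable_norm_gaussCoeff_mul (x₁ y₁ x₂ y₂ : ℂ) (a b : ℕ) :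
    Summable fun n => ‖gaussCoeff x₁ y₁ a n * gaussCoeff x₂ y₂ n b‖ := by
  refine Summable.of_nonneg_of_le (fun _ => norm_nonneg _) (fun n => ?_)
    ((summable_gaussCoeff_mul_pow x₂ y₂ b (1 + ‖y₁‖)).mul_left (Real.exp ‖x₁‖))
  rw [norm_mul]
  calc _ ≤ (Real.exp ‖x₁‖ * (1 + ‖y₁‖) ^ n) * ‖gaussCoeff x₂ y₂ n b‖ :=
        mul_le_mul_of_nonneg_right (norm_gaussCoeff_le _ _ _ _) (norm_nonneg _)
    _ = _ := by ring

/-- Coefficients of `X ^ a` in the derivative of `exp (x X) (X + y) ^ (n + 1)`. It complements the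
defining recursion, which lowers both indices, by one that can be solved for the left index. -/
theorem gaussCoeff_derivative (x y : ℂ) (a n : ℕ) :
    (a + 1 : ℂ) * gaussCoeff x y (a + 1) (n + 1) =
      x * gaussCoeff x y a (n + 1) + (n + 1 : ℂ) * gaussCoeff x y a n := by
  have hfac : ∀ c : ℕ, (c + 1 : ℂ) * (x ^ (c + 1) / ((c + 1).factorial : ℂ)) =
      x * (x ^ c / (c.factorial : ℂ)) := fun c => by
    have h1 : (c.factorial : ℂ) ≠ 0 := by exact_mod_cast c.factorial_ne_zero
    have h2 : (c + 1 : ℂ) ≠ 0 := by exact_mod_cast c.succ_ne_zero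
    rw [Nat.factorial_succ, pow_succ]; push_cast; field_simp
  induction n generalizing a with
  | zero =>
    cases a with
    | zero => simp [gaussCoeff]; ring
    | succ a =>
      simp only [gaussCoeff_succ_succ, gaussCoeff_zero_right]
      have h1 := hfac a
      have h2 := hfac (a + 1)
      push_cast at *
      linear_combination h1 + y * h2
  | succ n ih =>
    cases a with
    | zero =>
      have h1 := ih 0
      simp only [gaussCoeff_succ_succ, gaussCoeff_zero_succ] at *
      push_cast at *
      linear_combination y * h1
    | succ a =>
      have h1 := ih (a + 1)
      have h2 := ih a
      have e1 := gaussCoeff_succ_succ x y (a + 1) (n + 1)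
      have e2 := gaussCoeff_succ_succ x y a (n + 1)
      have e3 := gaussCoeff_succ_succ x y a n
      push_cast at *
      rw [e1, e2]
      linear_combination y * h1 + h2 - (n + 1) * e3

theorem hasSum_gaussCoeff_mul_pow (x₁ y₁ x₂ : ℂ) (a : ℕ) :
    HasSum (fun n => gaussCoeff x₁ y₁ a n * (x₂ ^ n / (n.factorial : ℂ)))
      (Complex.exp (y₁ * x₂) * ((x₁ + x₂) ^ a / (a.factorial : ℂ))) := by
  induction a with
  | zero =>
    have h := NormedSpace.expSeries_div_hasSum_exp (𝔸 := ℂ) (y₁ * x₂)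
    rw [← Complex.exp_eq_exp_ℂ] at h
    simpa [gaussCoeff_zero_left, mul_pow, mul_div_assoc] using h
  | succ a ih =>
    have hsum : Summable fun n => gaussCoeff x₁ y₁ (a + 1) n * (x₂ ^ n / (n.factorial : ℂ)) := by
      refine Summable.of_norm ((summable_norm_gaussCoeff_mul x₁ y₁ x₂ 0 (a + 1) 0).congr ?_)
      intro n; rw [gaussCoeff_zero_right]
    have ha : (a + 1 : ℂ) ≠ 0 := by exact_mod_cast a.succ_ne_zero
    have key : HasSum (fun n => (a + 1 : ℂ) *
        (gaussCoeff x₁ y₁ (a + 1) n * (x₂ ^ n / (n.factorial : ℂ))))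
        ((x₁ + x₂) * (Complex.exp (y₁ * x₂) * ((x₁ + x₂) ^ a / (a.factorial : ℂ)))) := by
      -- The truncated `n - 1` at `n = 0` is harmless because of the factor `n`; for the other terms
      -- this is the induction hypothesis shifted by one.
      have h2 : HasSum (fun n : ℕ => (n : ℂ) * gaussCoeff x₁ y₁ a (n - 1) *
          (x₂ ^ n / (n.factorial : ℂ)))
          (x₂ * (Complex.exp (y₁ * x₂) * ((x₁ + x₂) ^ a / (a.factorial : ℂ)))) := by
        rw [← hasSum_nat_add_iff' 1]
        simp only [Finset.range_one, Finset.sum_singleton, Nat.cast_zero, zero_mul, sub_zero]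
        refine (ih.mul_left x₂).congr_fun ?_
        intro n
        have h1 : (n.factorial : ℂ) ≠ 0 := by exact_mod_cast n.factorial_ne_zero
        have h2 : (n + 1 : ℂ) ≠ 0 := by exact_mod_cast n.succ_ne_zero
        rw [Nat.factorial_succ, Nat.add_sub_cancel, pow_succ]; push_cast; field_simp
      rw [add_mul]
      refine ((ih.mul_left x₁).add h2).congr_fun fun n => ?_
      cases n with
      | zero =>
        have h1 : (a.factorial : ℂ) ≠ 0 := by exact_mod_cast a.factorial_ne_zero
        rw [gaussCoeff_zero_right, gaussCoeff_zero_right, Nat.factorial_succ]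
        push_cast; field_simp; ring
      | succ n =>
        have := gaussCoeff_derivative x₁ y₁ a n
        push_cast
        rw [← mul_assoc, this]; ring
    refine hasSum_of_eq (key.mul_left (a + 1 : ℂ)⁻¹) (fun n => by field_simp) ?_
    have h1 : (a.factorial : ℂ) ≠ 0 := by exact_mod_cast a.factorial_ne_zero
    rw [Nat.factorial_succ, pow_succ]; push_cast; field_simp

/-- Baker-Campbell-Hausdorff for one oscillator: moving `exp (y₁ ∂)` to the right past `exp (x₂ X)`
costs `exp (y₁ x₂)`. The case `b = 0` is the exponential series in disguise; raising `b` multiplies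
by `X + y₂`, which `exp (y₁ ∂)` turns into `X + y₁ + y₂`. -/
theorem hasSum_gaussCoeff_mul (x₁ y₁ x₂ y₂ : ℂ) (a b : ℕ) :
    HasSum (fun n => gaussCoeff x₁ y₁ a n * gaussCoeff x₂ y₂ n b)
      (Complex.exp (y₁ * x₂) * gaussCoeff (x₁ + x₂) (y₁ + y₂) a b) := by
  induction b generalizing a with
  | zero => simpa only [gaussCoeff_zero_right] using hasSum_gaussCoeff_mul_pow x₁ y₁ x₂ a
  | succ b ih =>
    have step : ∀ A : ℂ, HasSum (fun n => gaussCoeff x₁ y₁ a (n + 1) * gaussCoeff x₂ y₂ n b) A →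
        HasSum (fun n => gaussCoeff x₁ y₁ a n * gaussCoeff x₂ y₂ n (b + 1))
          (A + y₂ * (Complex.exp (y₁ * x₂) * gaussCoeff (x₁ + x₂) (y₁ + y₂) a b)) := by
      intro A hA
      have h0 := (hasSum_nat_add_iff' 1).2 (ih a)
      rw [← hasSum_nat_add_iff' 1]
      refine hasSum_of_eq (hA.add (h0.mul_left y₂)) (fun n => ?_) ?_
      · rw [gaussCoeff_succ_succ]; ring
      · simp [gaussCoeff_zero_succ]; ring
    cases a with
    | zero =>
      refine hasSum_of_eq (step _ (((ih 0).mul_left y₁).congr_fun fun n => ?_)) (fun _ => rfl) ?_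
      · rw [gaussCoeff_zero_succ]; ring
      · rw [gaussCoeff_zero_succ]; ring
    | succ a =>
      refine hasSum_of_eq (step _ (((ih a).add ((ih (a + 1)).mul_left y₁)).congr_fun fun n => ?_))
        (fun _ => rfl) ?_
      · rw [gaussCoeff_succ_succ]; ring
      · rw [gaussCoeff_succ_succ]; ring

open Classical in
/-- The coefficient of `X ^ μ` in `exp (∑ x_i X_i) ∏ (X_i + y_i) ^ (ν i)`. -/
def gaussMatrix {σ : Type*} (x y : σ → ℂ) (μ ν : σ →₀ ℕ) : ℂ :=
  ∏ i ∈ μ.support ∪ ν.support, gaussCoeff (x i) (y i) (μ i) (ν i)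

open Classical in
theorem gaussMatrix_eq_prod {σ : Type*} (x y : σ → ℂ) (μ ν : σ →₀ ℕ) (s : Finset σ)
    (hμ : μ.support ⊆ s) (hν : ν.support ⊆ s) :
    gaussMatrix x y μ ν = ∏ i ∈ s, gaussCoeff (x i) (y i) (μ i) (ν i) := by
  refine Finset.prod_subset (Finset.union_subset hμ hν) fun i _ hi => ?_
  rw [Finset.notMem_union, Finsupp.notMem_support_iff, Finsupp.notMem_support_iff] at hi
  rw [hi.1, hi.2, gaussCoeff_zero_zero]

theorem tsum_norm_gaussCoeff_zero (y₁ x₂ x₁ y₂ : ℂ) :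
    ∑' n, ‖gaussCoeff x₁ y₁ 0 n * gaussCoeff x₂ y₂ n 0‖ = Real.exp ‖y₁ * x₂‖ := by
  have h := NormedSpace.expSeries_div_hasSum_exp (𝔸 := ℝ) ‖y₁ * x₂‖
  rw [← Real.exp_eq_exp_ℝ] at h
  rw [← h.tsum_eq]
  refine tsum_congr fun n => ?_
  rw [gaussCoeff_zero_left, gaussCoeff_zero_right]
  simp [mul_pow, mul_div_assoc]

/-- A mode that is empty in both outer states contributes exactly `exp (y₁ x₂)`, and its absolute
sum is `exp ‖y₁ x₂‖`. So absolute summability of the contraction exponents controls the product over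
infinitely many modes, and the finitely many occupied modes only add a constant factor to the bound.
-/
theorem hasSum_gaussMatrix_mul {σ : Type*} (x₁ y₁ x₂ y₂ : σ → ℂ)
    (h : Summable fun i => ‖y₁ i * x₂ i‖) (μ κ : σ →₀ ℕ) :
    HasSum (fun ν => gaussMatrix x₁ y₁ μ ν * gaussMatrix x₂ y₂ ν κ)
      (Complex.exp (∑' i, y₁ i * x₂ i) * gaussMatrix (x₁ + x₂) (y₁ + y₂) μ κ) := by
  classical
  set S := μ.support ∪ κ.support with hS
  have hS0 : ∀ i ∉ S, μ i = 0 ∧ κ i = 0 := fun i hi => by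
    rwa [hS, Finset.notMem_union, Finsupp.notMem_support_iff, Finsupp.notMem_support_iff] at hi
  let g : σ → ℕ → ℂ := fun i n =>
    gaussCoeff (x₁ i) (y₁ i) (μ i) n * gaussCoeff (x₂ i) (y₂ i) n (κ i)
  have hg : ∀ i, Summable fun n => ‖g i n‖ := fun i => summable_norm_gaussCoeff_mul _ _ _ _ _ _
  refine hasSum_of_eq (hasSum_finsupp_prod g S (fun i hi => ?_) hg
    ((∏ i ∈ S, ∑' n, ‖g i n‖) * Real.exp (∑' i, ‖y₁ i * x₂ i‖)) (fun s hs => ?_)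
    (Complex.exp (∑' i, y₁ i * x₂ i) * gaussMatrix (x₁ + x₂) (y₁ + y₂) μ κ) ?_) (fun ν => ?_) rfl
  · simp [g, hS0 i hi]
  · rw [← Finset.prod_sdiff hs, mul_comm]
    refine mul_le_mul_of_nonneg_left ?_
      (Finset.prod_nonneg fun i _ => tsum_nonneg fun _ => norm_nonneg _)
    calc ∏ i ∈ s \ S, ∑' n, ‖g i n‖ = ∏ i ∈ s \ S, Real.exp ‖y₁ i * x₂ i‖ := by
          refine Finset.prod_congr rfl fun i hi => ?_
          obtain ⟨h1, h2⟩ := hS0 i (Finset.mem_sdiff.1 hi).2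
          simp only [g, h1, h2]
          exact tsum_norm_gaussCoeff_zero _ _ _ _
      _ = Real.exp (∑ i ∈ s \ S, ‖y₁ i * x₂ i‖) := (Real.exp_sum _ _).symm
      _ ≤ _ := Real.exp_le_exp.2 (h.sum_le_tsum _ fun _ _ => norm_nonneg _)
  · have h1 : ∀ s : Finset σ, S ⊆ s → ∏ i ∈ s, ∑' n, g i n =
        Complex.exp (∑ i ∈ s, y₁ i * x₂ i) * gaussMatrix (x₁ + x₂) (y₁ + y₂) μ κ := by
      intro s hs
      rw [gaussMatrix_eq_prod _ _ _ _ s (Finset.subset_union_left.trans hs)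
        (Finset.subset_union_right.trans hs), Complex.exp_sum, ← Finset.prod_mul_distrib]
      exact Finset.prod_congr rfl fun i _ => (hasSum_gaussCoeff_mul _ _ _ _ _ _).tsum_eq
    refine Tendsto.congr' ((eventually_ge_atTop S).mono fun s hs => (h1 s hs).symm) ?_
    exact ((Complex.continuous_exp.tendsto _).comp (Summable.of_norm h).hasSum).mul_const _
  · rw [gaussMatrix_eq_prod x₁ y₁ μ ν (S ∪ ν.support)
      (Finset.subset_union_left.trans Finset.subset_union_left) Finset.subset_union_right,
      gaussMatrix_eq_prod x₂ y₂ ν κ (S ∪ ν.support) Finset.subset_union_right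
      (Finset.subset_union_right.trans Finset.subset_union_left), ← Finset.prod_mul_distrib]

/-- The matrix form of `exp (∑ y_j ∂_j) X_i = (X_i + y_i) exp (∑ y_j ∂_j)`. Together with the value
at `ν = 0` it determines the matrix, which is how it is matched with `nexp`. -/
theorem gaussMatrix_add_single {σ : Type*} [DecidableEq σ] (x y : σ → ℂ) (μ ν : σ →₀ ℕ) (i : σ) :
    gaussMatrix x y μ (ν + Finsupp.single i 1) =
      (if i ∈ μ.support then gaussMatrix x y (μ - Finsupp.single i 1) ν else 0) +
        y i * gaussMatrix x y μ ν := by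
  set s := insert i (μ.support ∪ ν.support) with hs
  have hμ : μ.support ⊆ s := Finset.subset_union_left.trans (Finset.subset_insert _ _)
  have hν : ν.support ⊆ s := Finset.subset_union_right.trans (Finset.subset_insert _ _)
  have hi : i ∈ s := Finset.mem_insert_self _ _
  have hν' : (ν + Finsupp.single i 1).support ⊆ s := fun j hj => by
    by_cases hji : j = i
    · rwa [hji]
    · apply hν
      rw [Finsupp.mem_support_iff] at hj ⊢
      simpa [Finsupp.single_apply, Ne.symm hji] using hj
  have hμ' : (μ - Finsupp.single i 1).support ⊆ s := fun j hj => by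
    apply hμ
    rw [Finsupp.mem_support_iff] at hj ⊢
    intro h0
    apply hj
    simp [h0]
  rw [gaussMatrix_eq_prod x y μ _ s hμ hν', gaussMatrix_eq_prod x y μ ν s hμ hν,
    gaussMatrix_eq_prod x y _ ν s hμ' hν, ← Finset.mul_prod_erase s _ hi,
    ← Finset.mul_prod_erase s _ hi, ← Finset.mul_prod_erase s _ hi]
  have e1 : ∏ j ∈ s.erase i, gaussCoeff (x j) (y j) (μ j) ((ν + Finsupp.single i 1 : σ →₀ ℕ) j) =
      ∏ j ∈ s.erase i, gaussCoeff (x j) (y j) (μ j) (ν j) :=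
    Finset.prod_congr rfl fun j hj => by
      simp [(Finset.ne_of_mem_erase hj).symm]
  have e2 : ∏ j ∈ s.erase i, gaussCoeff (x j) (y j) ((μ - Finsupp.single i 1 : σ →₀ ℕ) j) (ν j) =
      ∏ j ∈ s.erase i, gaussCoeff (x j) (y j) (μ j) (ν j) :=
    Finset.prod_congr rfl fun j hj => by
      simp [(Finset.ne_of_mem_erase hj).symm]
  rw [e1, e2]
  simp only [Finsupp.add_apply, Finsupp.single_eq_same, Finsupp.tsub_apply, Finsupp.mem_support_iff]
  rcases Nat.eq_zero_or_pos (μ i) with h0 | h0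
  · rw [if_neg (by simp [h0]), h0, gaussCoeff_zero_succ]; ring
  · obtain ⟨a, ha⟩ : ∃ a, μ i = a + 1 := ⟨μ i - 1, by omega⟩
    rw [if_pos h0.ne', ha, gaussCoeff_succ_succ, Nat.add_sub_cancel]; ring

/-! ### Normal ordered exponentials as Gaussian operators -/

theorem sub_single_add_single {σ : Type*} {ν : σ →₀ ℕ} {i : σ} (hi : i ∈ ν.support) :
    ν - Finsupp.single i 1 + Finsupp.single i 1 = ν := by
  classical
  refine tsub_add_cancel_of_le (Finsupp.single_le_iff.2 ?_)
  exact Nat.one_le_iff_ne_zero.2 (Finsupp.mem_support_iff.1 hi)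

theorem finsupp_induction_add_single {σ : Type*} {p : (σ →₀ ℕ) → Prop} (h0 : p 0)
    (hadd : ∀ ν i, p ν → p (ν + Finsupp.single i 1)) (ν : σ →₀ ℕ) : p ν := by
  obtain ⟨n, hn⟩ : ∃ n, ν.degree = n := ⟨_, rfl⟩
  induction n generalizing ν with
  | zero => rwa [(Finsupp.degree_eq_zero_iff ν).1 hn]
  | succ n ih =>
    obtain ⟨i, hi⟩ : ν.support.Nonempty := by
      rw [Finsupp.support_nonempty_iff]; rintro rfl; simp at hn
    rw [← sub_single_add_single hi]
    refine hadd _ _ (ih _ ?_)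
    have h := congrArg Finsupp.degree (sub_single_add_single hi)
    rw [map_add, Finsupp.degree_single] at h
    omega

/-- The coefficients of the creation operators in `X`. -/
def creationCoeff (X : LinForm) (i : Osc) : ℂ := X.2.2 i.1 (-(i.2 : ℤ))

/-- The coefficients of the annihilation operators in `X`, times their commutators with the
creation operators. -/
def annihilationCoeff (lq : ℂ) (r k : ℝ) (X : LinForm) (i : Osc) : ℂ :=
  X.2.2 i.1 (i.2 : ℤ) * commCoeff lq r k i

theorem coeff_creationPart_single (X : LinForm) (i : Osc) :
    MvPowerSeries.coeff (Finsupp.single i 1) (creationPart X) = creationCoeff X i := by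
  change creationPart X _ = _
  simp [creationPart, creationCoeff]

theorem coeff_creationPart_of_ne (X : LinForm) (ν : Osc →₀ ℕ) (h : ν.degree ≠ 1) :
    MvPowerSeries.coeff ν (creationPart X) = 0 := by
  change creationPart X _ = _
  simp [creationPart, h]

theorem exists_single_of_degree_eq_one {σ : Type*} (ν : σ →₀ ℕ) (h : ν.degree = 1) :
    ∃ i, ν = Finsupp.single i 1 := by
  obtain ⟨i, hi⟩ : ν.support.Nonempty := by
    rw [Finsupp.support_nonempty_iff]; rintro rfl; simp at h
  refine ⟨i, ?_⟩
  have h1 := congrArg Finsupp.degree (sub_single_add_single hi)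
  rw [map_add, Finsupp.degree_single, h, Nat.add_eq_right, Finsupp.degree_eq_zero_iff] at h1
  rw [← sub_single_add_single hi, h1, zero_add]

theorem coeff_creationPart_mul (X : LinForm) (F : MvPowerSeries Osc ℂ) (ν : Osc →₀ ℕ) :
    MvPowerSeries.coeff ν (creationPart X * F) =
      ∑ i ∈ ν.support, creationCoeff X i * MvPowerSeries.coeff (ν - Finsupp.single i 1) F := by
  classical
  rw [MvPowerSeries.coeff_mul]
  symm
  refine Finset.sum_of_injOn (fun i => (Finsupp.single i 1, ν - Finsupp.single i 1)) ?_ ?_ ?_ ?_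
  · intro i _ j _ h
    exact Finsupp.single_left_injective one_ne_zero (Prod.ext_iff.1 h).1
  · intro i hi
    rw [Finset.mem_coe, Finset.HasAntidiagonal.mem_antidiagonal, add_comm, sub_single_add_single hi]
  · intro p hp hp'
    rw [coeff_creationPart_of_ne, zero_mul]
    intro hd
    obtain ⟨i, hi⟩ := exists_single_of_degree_eq_one _ hd
    rw [Finset.HasAntidiagonal.mem_antidiagonal] at hp
    refine hp' ⟨i, ?_, ?_⟩
    · rw [Finset.mem_coe, Finsupp.mem_support_iff, ← hp, hi]; simp
    · exact Prod.ext hi.symm (by simp only [← hp, ← hi, add_tsub_cancel_left])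
  · intro i _
    rw [coeff_creationPart_single]

/-- Euler's identity for the coefficients `∏ x_i ^ (ν i) / (ν i)!`: the `i`-th summand is `ν i`
times the coefficient at `ν`. -/
theorem sum_mul_gaussMatrix_sub_single {σ : Type*} (x y : σ → ℂ) (ν : σ →₀ ℕ) :
    ∑ i ∈ ν.support, x i * gaussMatrix x y (ν - Finsupp.single i 1) 0 =
      (ν.degree : ℂ) * gaussMatrix x y ν 0 := by
  classical
  have key : ∀ i ∈ ν.support, x i * gaussMatrix x y (ν - Finsupp.single i 1) 0 =
      (ν i : ℂ) * gaussMatrix x y ν 0 := by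
    intro i hi
    have hs : (ν - Finsupp.single i 1 : σ →₀ ℕ).support ⊆ ν.support := fun j hj => by
      rw [Finsupp.mem_support_iff] at hj ⊢
      intro h0
      apply hj
      simp [h0]
    rw [gaussMatrix_eq_prod x y _ 0 ν.support hs (by simp),
      gaussMatrix_eq_prod x y ν 0 ν.support le_rfl (by simp),
      ← Finset.mul_prod_erase _ _ hi, ← Finset.mul_prod_erase _ _ hi]
    have e : ∏ j ∈ ν.support.erase i, gaussCoeff (x j) (y j)
          ((ν - Finsupp.single i 1 : σ →₀ ℕ) j) ((0 : σ →₀ ℕ) j) =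
        ∏ j ∈ ν.support.erase i, gaussCoeff (x j) (y j) (ν j) ((0 : σ →₀ ℕ) j) :=
      Finset.prod_congr rfl fun j hj => by simp [(Finset.ne_of_mem_erase hj).symm]
    rw [e]
    obtain ⟨a, ha⟩ : ∃ a, ν i = a + 1 :=
      ⟨ν i - 1, by have := Finsupp.mem_support_iff.1 hi; omega⟩
    simp only [Finsupp.tsub_apply, Finsupp.single_eq_same, ha, Nat.add_sub_cancel,
      Finsupp.coe_zero, Pi.zero_apply, gaussCoeff_zero_right]
    have h1 : (a.factorial : ℂ) ≠ 0 := by exact_mod_cast a.factorial_ne_zero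
    have h2 : (a + 1 : ℂ) ≠ 0 := by exact_mod_cast a.succ_ne_zero
    rw [Nat.factorial_succ, pow_succ]; push_cast; field_simp
  rw [Finset.sum_congr rfl key, ← Finset.sum_mul, ← Nat.cast_sum]
  rfl

/-- The multinomial theorem. The parameter `y` is free because a Gaussian matrix element with empty
right state does not involve it. -/
theorem coeff_creationPart_pow (X : LinForm) (y : Osc → ℂ) (d : ℕ) (ν : Osc →₀ ℕ) :
    MvPowerSeries.coeff ν (creationPart X ^ d) =
      if ν.degree = d then (d.factorial : ℂ) * gaussMatrix (creationCoeff X) y ν 0 else 0 := by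
  classical
  induction d generalizing ν with
  | zero =>
    rw [pow_zero, MvPowerSeries.coeff_one]
    simp only [Finsupp.degree_eq_zero_iff]
    split_ifs with h
    · simp [h, gaussMatrix]
    · rfl
  | succ d ih =>
    have hdeg : ∀ i ∈ ν.support, (ν - Finsupp.single i 1).degree + 1 = ν.degree := fun i hi => by
      have h1 := congrArg Finsupp.degree (sub_single_add_single hi)
      rwa [map_add, Finsupp.degree_single] at h1
    rw [pow_succ', coeff_creationPart_mul]
    by_cases h : ν.degree = d + 1
    · rw [if_pos h, Nat.factorial_succ]
      have : ∀ i ∈ ν.support, creationCoeff X i *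
          MvPowerSeries.coeff (ν - Finsupp.single i 1) (creationPart X ^ d) =
          (d.factorial : ℂ) * (creationCoeff X i *
            gaussMatrix (creationCoeff X) y (ν - Finsupp.single i 1) 0) := fun i hi => by
        rw [ih, if_pos (by have := hdeg i hi; omega)]; ring
      rw [Finset.sum_congr rfl this, ← Finset.mul_sum, sum_mul_gaussMatrix_sub_single, h]
      push_cast; ring
    · rw [if_neg h]
      refine Finset.sum_eq_zero fun i hi => ?_
      rw [ih, if_neg (by have := hdeg i hi; omega), mul_zero]

theorem coeff_exp_subst_creationPart (X : LinForm) (y : Osc → ℂ) (ν : Osc →₀ ℕ) :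
    MvPowerSeries.coeff ν ((PowerSeries.exp ℂ).subst (creationPart X)) =
      gaussMatrix (creationCoeff X) y ν 0 := by
  have hs : PowerSeries.HasSubst (creationPart X) := by
    refine PowerSeries.HasSubst.of_constantCoeff_zero ?_
    rw [← MvPowerSeries.coeff_zero_eq_constantCoeff_apply]
    exact coeff_creationPart_of_ne X 0 (by simp)
  rw [PowerSeries.coeff_subst hs, finsum_eq_single _ ν.degree]
  · rw [coeff_creationPart_pow X y, if_pos rfl, PowerSeries.coeff_exp]
    have h1 : (ν.degree.factorial : ℂ) ≠ 0 := by exact_mod_cast Nat.factorial_ne_zero _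
    simp [h1]
  · intro d hd
    rw [coeff_creationPart_pow X y, if_neg hd.symm, smul_zero]

/-- On a given polynomial only the derivatives in its own variables survive, so the infinite sum is
a derivation; the Leibniz rule then gives all commutators with creation operators. -/
theorem annihilationPart_eq_mkDerivation (lq : ℂ) (r k : ℝ) (X : LinForm)
    (v : MvPolynomial Osc ℂ) :
    annihilationPart lq r k X v =
      MvPolynomial.mkDerivation ℂ
        (fun i => MvPolynomial.C (annihilationCoeff lq r k X i)) v := by
  classical
  have coe_sum : ∀ (s : Finset Osc)
      (D : Osc → Derivation ℂ (MvPolynomial Osc ℂ) (MvPolynomial Osc ℂ)) (w : MvPolynomial Osc ℂ),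
      (∑ i ∈ s, D i) w = ∑ i ∈ s, D i w := fun s D w => by
    induction s using Finset.induction_on with
    | empty => simp
    | insert a s ha ih => rw [Finset.sum_insert ha, Finset.sum_insert ha, Derivation.add_apply, ih]
  have hterm : ∀ i : Osc, X.2.2 i.1 (i.2 : ℤ) • annihilation lq r k i v =
      annihilationCoeff lq r k X i • MvPolynomial.pderiv i v := fun i => by
    simp [annihilation, annihilationCoeff, smul_smul]
  rw [annihilationPart, finsum_congr hterm, finsum_eq_sum_of_support_subset (s := v.vars)]
  · have h := MvPolynomial.derivation_eq_of_forall_mem_vars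
      (D₁ := ∑ i ∈ v.vars, annihilationCoeff lq r k X i • MvPolynomial.pderiv (R := ℂ) i)
      (D₂ := MvPolynomial.mkDerivation ℂ
        (fun i => MvPolynomial.C (annihilationCoeff lq r k X i))) (f := v) (fun j hj => by
        rw [MvPolynomial.mkDerivation_X, coe_sum,
          Finset.sum_eq_single j]
        · simp [MvPolynomial.smul_eq_C_mul]
        · intro i _ hij
          simp [MvPolynomial.pderiv_X_of_ne hij.symm]
        · exact fun h => (h hj).elim)
    rw [← h, coe_sum]
    rfl
  · intro i hi
    by_contra h
    exact hi (by simp [MvPolynomial.pderiv_eq_zero_of_notMem_vars h])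

theorem annihilationPart_X_mul (lq : ℂ) (r k : ℝ) (X : LinForm) (i : Osc)
    (v : MvPolynomial Osc ℂ) :
    annihilationPart lq r k X (MvPolynomial.X i * v) =
      MvPolynomial.X i * annihilationPart lq r k X v + annihilationCoeff lq r k X i • v := by
  simp only [annihilationPart_eq_mkDerivation, Derivation.leibniz, MvPolynomial.mkDerivation_X]
  rw [MvPolynomial.smul_eq_C_mul, smul_eq_mul, smul_eq_mul, mul_comm v]

/-- If `[D, X]` is a scalar `c`, then `[D ^ (n + 1), X] = (n + 1) c D ^ n`. -/
theorem annihilationPart_iterate_X_mul (lq : ℂ) (r k : ℝ) (X : LinForm) (i : Osc)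
    (v : MvPolynomial Osc ℂ) (n : ℕ) :
    (annihilationPart lq r k X)^[n + 1] (MvPolynomial.X i * v) =
      MvPolynomial.X i * (annihilationPart lq r k X)^[n + 1] v +
        ((n + 1 : ℂ) * annihilationCoeff lq r k X i) • (annihilationPart lq r k X)^[n] v := by
  have hlin : ∀ (c : ℂ) (u w : MvPolynomial Osc ℂ), annihilationPart lq r k X (u + c • w) =
      annihilationPart lq r k X u + c • annihilationPart lq r k X w := fun c u w => by
    simp only [annihilationPart_eq_mkDerivation, map_add, Derivation.map_smul]
  induction n with
  | zero => simp [annihilationPart_X_mul]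
  | succ n ih =>
    rw [Function.iterate_succ_apply', ih, hlin, annihilationPart_X_mul,
      ← Function.iterate_succ_apply' (annihilationPart lq r k X),
      ← Function.iterate_succ_apply' (annihilationPart lq r k X), add_assoc, ← add_smul]
    push_cast
    congr 2
    ring

theorem annihilationPart_iterate_eq_zero (lq : ℂ) (r k : ℝ) (X : LinForm) (ν : Osc →₀ ℕ) :
    ∃ N, ∀ n, N ≤ n → (annihilationPart lq r k X)^[n] (MvPolynomial.monomial ν 1) = 0 := by
  induction ν using finsupp_induction_add_single with
  | h0 =>
    have h0 : annihilationPart lq r k X 0 = 0 := by simp [annihilationPart_eq_mkDerivation]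
    refine ⟨1, fun n hn => ?_⟩
    obtain ⟨m, rfl⟩ : ∃ m, n = m + 1 := ⟨n - 1, by omega⟩
    rw [Function.iterate_succ_apply]
    have h1 : annihilationPart lq r k X (MvPolynomial.monomial 0 1) = 0 := by
      rw [annihilationPart_eq_mkDerivation]
      exact (MvPolynomial.mkDerivation ℂ _).map_one_eq_zero
    rw [h1, Function.iterate_fixed h0]
  | hadd ν i ih =>
    obtain ⟨N, hN⟩ := ih
    refine ⟨N + 1, fun n hn => ?_⟩
    obtain ⟨m, rfl⟩ : ∃ m, n = m + 1 := ⟨n - 1, by omega⟩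
    rw [add_comm ν, MvPolynomial.monomial_single_add, pow_one, annihilationPart_iterate_X_mul,
      hN _ (by omega), hN _ (by omega), mul_zero, smul_zero, add_zero]

theorem annihilationExp_eq_sum (lq : ℂ) (r k : ℝ) (X : LinForm) (v : MvPolynomial Osc ℂ) (N : ℕ)
    (hN : ∀ n, N ≤ n → (annihilationPart lq r k X)^[n] v = 0) :
    annihilationExp lq r k X v = ∑ n ∈ Finset.range N,
      ((n.factorial : ℂ)⁻¹) • (annihilationPart lq r k X)^[n] v := by
  refine finsum_eq_sum_of_support_subset _ fun n hn => ?_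
  rw [Finset.coe_range, Set.mem_Iio]
  by_contra h
  exact hn (by simp [hN n (not_lt.1 h)])

theorem annihilationExp_monomial_add_single (lq : ℂ) (r k : ℝ) (X : LinForm) (i : Osc)
    (ν : Osc →₀ ℕ) :
    annihilationExp lq r k X (MvPolynomial.monomial (ν + Finsupp.single i 1) 1) =
      MvPolynomial.X i * annihilationExp lq r k X (MvPolynomial.monomial ν 1) +
        annihilationCoeff lq r k X i • annihilationExp lq r k X (MvPolynomial.monomial ν 1) := by
  obtain ⟨N, hN⟩ := annihilationPart_iterate_eq_zero lq r k X ν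
  rw [add_comm ν, MvPolynomial.monomial_single_add, pow_one]
  set v : MvPolynomial Osc ℂ := MvPolynomial.monomial ν 1
  -- Multiplication by `X i` raises the order of nilpotency by at most one, hence `N + 1`. The term
  -- `n = 0` is split off since the commutator formula is about `n + 1`.
  rw [annihilationExp_eq_sum lq r k X (MvPolynomial.X i * v) (N + 1) (fun n hn => by
    obtain ⟨m, rfl⟩ : ∃ m, n = m + 1 := ⟨n - 1, by omega⟩
    rw [annihilationPart_iterate_X_mul, hN _ (by omega), hN _ (by omega), mul_zero, smul_zero,
      add_zero]), Finset.sum_range_succ']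
  rw [Finset.sum_congr rfl fun n _ => by rw [annihilationPart_iterate_X_mul, smul_add],
    Finset.sum_add_distrib, add_right_comm]
  congr 1
  · rw [annihilationExp_eq_sum lq r k X v (N + 1) fun n hn => hN n (by omega),
      Finset.sum_range_succ', mul_add, Finset.mul_sum]
    simp
  · rw [annihilationExp_eq_sum lq r k X v N hN, Finset.smul_sum]
    refine Finset.sum_congr rfl fun n _ => ?_
    rw [smul_smul, smul_smul]
    congr 1
    have h1 : (n.factorial : ℂ) ≠ 0 := by exact_mod_cast n.factorial_ne_zero
    have h2 : (n + 1 : ℂ) ≠ 0 := by exact_mod_cast n.succ_ne_zero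
    rw [Nat.factorial_succ]; push_cast; field_simp

theorem annihilationExp_one (lq : ℂ) (r k : ℝ) (X : LinForm) : annihilationExp lq r k X 1 = 1 := by
  have h0 : annihilationPart lq r k X 0 = 0 := by simp [annihilationPart_eq_mkDerivation]
  have h1 : annihilationPart lq r k X 1 = 0 := by simp [annihilationPart_eq_mkDerivation]
  rw [annihilationExp_eq_sum lq r k X 1 1 fun n hn => ?_]
  · simp
  · obtain ⟨m, rfl⟩ : ∃ m, n = m + 1 := ⟨n - 1, by omega⟩
    rw [Function.iterate_succ_apply, h1, Function.iterate_fixed h0]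

theorem coeff_mul_X {σ : Type*} [DecidableEq σ] (F : MvPowerSeries σ ℂ) (μ : σ →₀ ℕ) (i : σ) :
    MvPowerSeries.coeff μ (F * MvPowerSeries.X i) =
      if i ∈ μ.support then MvPowerSeries.coeff (μ - Finsupp.single i 1) F else 0 := by
  rw [MvPowerSeries.X, MvPowerSeries.coeff_mul_monomial, mul_one]
  refine if_congr ?_ rfl rfl
  rw [Finsupp.single_le_iff, Finsupp.mem_support_iff, Nat.one_le_iff_ne_zero]

/-- Both sides obey the same recursion when a quantum is added to `ν`, and on the vacuum both are
the coefficients of the exponential of the creation part. -/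
theorem coeff_exp_mul_annihilationExp (lq : ℂ) (r k : ℝ) (X : LinForm) (μ ν : Osc →₀ ℕ) :
    MvPowerSeries.coeff μ ((PowerSeries.exp ℂ).subst (creationPart X) *
      (annihilationExp lq r k X (MvPolynomial.monomial ν 1) : MvPowerSeries Osc ℂ)) =
      gaussMatrix (creationCoeff X) (annihilationCoeff lq r k X) μ ν := by
  classical
  induction ν using finsupp_induction_add_single generalizing μ with
  | h0 =>
    have h1 : (MvPolynomial.monomial 0 1 : MvPolynomial Osc ℂ) = 1 := rfl
    rw [h1, annihilationExp_one, MvPolynomial.coe_one, mul_one, coeff_exp_subst_creationPart]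
  | hadd ν i ih =>
    rw [annihilationExp_monomial_add_single, MvPolynomial.coe_add, MvPolynomial.coe_mul,
      MvPolynomial.coe_X, MvPolynomial.coe_smul, mul_add, map_add, mul_smul_comm, map_smul, ih,
      mul_left_comm, mul_comm (MvPowerSeries.X i), coeff_mul_X, gaussMatrix_add_single, ih,
      smul_eq_mul]

open Classical in
/-- The operator `exp (∑ x_i a_i†) exp (∑ y_i ∂_i) exp (Q) exp (P)`, where `Q` and `P` are the given
linear combinations of the zero modes and `∂_i` is the derivative with respect to `a_i†`. -/
def gaussOp (k : ℝ) (Q P : Fin 3 → ℂ) (x y : Osc → ℂ) : Op State := fun s t =>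
  if s.1 = t.1 + Q * zeroComm k then
    Complex.exp (∑ j, P j * t.1 j) * gaussMatrix x y s.2 t.2
  else 0

theorem nexp_eq_gaussOp (lq : ℂ) (r k : ℝ) (X : LinForm) :
    nexp lq r k X = gaussOp k X.1 X.2.1 (creationCoeff X) (annihilationCoeff lq r k X) := by
  funext s t
  simp only [nexp, gaussOp, coeff_exp_mul_annihilationExp]

/-- Only one eigenvalue of the `P_j` is possible in the intermediate state, so the sum runs over
oscillator states alone. The shift of that eigenvalue by `Q₂`, seen by `exp P₁`, is the zero-mode
contraction. -/
theorem hasSum_gaussOp_mul (k : ℝ) (Q₁ P₁ Q₂ P₂ : Fin 3 → ℂ) (x₁ y₁ x₂ y₂ : Osc → ℂ)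
    (h : Summable fun i => ‖y₁ i * x₂ i‖) (s t : State) :
    HasSum (fun l => gaussOp k Q₁ P₁ x₁ y₁ s l * gaussOp k Q₂ P₂ x₂ y₂ l t)
      (Complex.exp (∑ j, P₁ j * (Q₂ j * zeroComm k j)) * Complex.exp (∑' i, y₁ i * x₂ i) *
        gaussOp k (Q₁ + Q₂) (P₁ + P₂) (x₁ + x₂) (y₁ + y₂) s t) := by
  classical
  have hinj : Function.Injective fun ν : Osc →₀ ℕ => ((t.1 + Q₂ * zeroComm k, ν) : State) :=
    fun _ _ h => (Prod.ext_iff.1 h).2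
  rw [← hinj.hasSum_iff]
  · by_cases hs : s.1 = t.1 + (Q₁ + Q₂) * zeroComm k
    · have hs' : s.1 = t.1 + Q₂ * zeroComm k + Q₁ * zeroComm k := by rw [hs]; ring
      refine hasSum_of_eq ((hasSum_gaussMatrix_mul x₁ y₁ x₂ y₂ h s.2 t.2).mul_left
        (Complex.exp (∑ j, P₁ j * (t.1 + Q₂ * zeroComm k) j) * Complex.exp (∑ j, P₂ j * t.1 j)))
        (fun ν => ?_) ?_
      · simp only [gaussOp, Function.comp_apply, if_pos hs', if_true]; ring
      · simp only [gaussOp, if_pos hs]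
        have : ∀ a b c d e f : ℂ, a = c + d → Complex.exp a * Complex.exp b * (e * f) =
            Complex.exp c * e * (Complex.exp (d + b) * f) := by
          intro a b c d e f h; rw [h, Complex.exp_add, Complex.exp_add]; ring
        rw [this _ _ (∑ j, P₁ j * (Q₂ j * zeroComm k j)) (∑ j, P₁ j * t.1 j)]
        · rw [← Finset.sum_add_distrib]
          simp only [Pi.add_apply, add_mul]
        · rw [← Finset.sum_add_distrib]
          refine Finset.sum_congr rfl fun j _ => ?_
          simp only [Pi.add_apply, Pi.mul_apply]; ring
    · have hs' : ¬ s.1 = t.1 + Q₂ * zeroComm k + Q₁ * zeroComm k := by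
        intro h; apply hs; rw [h]; ring
      refine hasSum_of_eq hasSum_zero (fun ν => ?_) ?_
      · simp only [gaussOp, Function.comp_apply, if_neg hs', zero_mul]
      · simp only [gaussOp, if_neg hs, mul_zero]
  · intro l hl
    have : ¬ l.1 = t.1 + Q₂ * zeroComm k := fun h => hl ⟨l.2, Prod.ext h.symm rfl⟩
    simp only [gaussOp, if_neg this, mul_zero]

/-! ### Infinite products -/

theorem differentiable_tprod_one_sub {ι : Type*} (t : ι → ℂ) (ht : Summable fun i => ‖t i‖) :
    Differentiable ℂ fun z => ∏' i, (1 - z * t i) := by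
  intro z
  have h : HasProdLocallyUniformlyOn (fun i (x : ℂ) => 1 + -(x * t i))
      (fun x => ∏' i, (1 + -(x * t i))) (Metric.ball 0 (‖z‖ + 1)) := by
    refine Summable.hasProdLocallyUniformlyOn_one_add Metric.isOpen_ball
      (ht.mul_left (‖z‖ + 1)) (Eventually.of_forall fun i x hx => ?_) fun i => by fun_prop
    rw [norm_neg, norm_mul]
    exact mul_le_mul_of_nonneg_right (mem_ball_zero_iff.1 hx).le (norm_nonneg _)
  have hd := h.differentiableOn (Eventually.of_forall fun s => by
    simpa only [Finset.prod_fn] using (show DifferentiableOn ℂ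
      (fun x : ℂ => ∏ i ∈ s, (1 + -(x * t i))) _ by fun_prop)) Metric.isOpen_ball
  simp only [← sub_eq_add_neg] at hd
  exact hd.differentiableAt (Metric.isOpen_ball.mem_nhds (by simp))

/-- Sum the Taylor series of `-log (1 - u t_i)` over `i` and exchange the two sums. For `‖u‖ ∑ ‖t_i‖
< 1/2` the double family is absolutely summable and no factor vanishes. -/
theorem exp_neg_tsum_eq_tprod {ι : Type*} (t : ι → ℂ) (ht : Summable fun i => ‖t i‖) :
    ∀ᶠ u in 𝓝 (0 : ℂ), Summable (fun m : ℕ+ => (∑' i, t i ^ (m : ℕ)) / (m : ℕ) * u ^ (m : ℕ)) ∧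
      Complex.exp (-∑' m : ℕ+, (∑' i, t i ^ (m : ℕ)) / (m : ℕ) * u ^ (m : ℕ)) =
        ∏' i, (1 - u * t i) := by
  set B := ∑' i, ‖t i‖ with hB
  have hB0 : 0 ≤ B := tsum_nonneg fun _ => norm_nonneg _
  have hev : ∀ᶠ u in 𝓝 (0 : ℂ), ‖u‖ * B < 1 / 2 := by
    have : Tendsto (fun u : ℂ => ‖u‖ * B) (𝓝 0) (𝓝 (‖(0 : ℂ)‖ * B)) :=
      (continuous_norm.mul continuous_const).tendsto _
    rw [norm_zero, zero_mul] at this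
    exact this.eventually_lt_const (by norm_num)
  filter_upwards [hev] with u hu
  have hsmall : ∀ i, ‖u * t i‖ ≤ 1 / 2 := fun i => by
    rw [norm_mul]
    exact (mul_le_mul_of_nonneg_left (ht.le_tsum i fun _ _ => norm_nonneg _)
      (norm_nonneg u)).trans hu.le
  let F : ι × ℕ+ → ℂ := fun p => (u * t p.1) ^ (p.2 : ℕ) / (p.2 : ℕ)
  have hF : Summable F := by
    have hgeo : Summable fun m : ℕ+ => ((1 / 2 : ℝ)) ^ ((m : ℕ) - 1) := by
      have h0 : Summable fun n : ℕ => (1 / 2 : ℝ) ^ (n - 1) := by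
        rw [← summable_nat_add_iff 1]
        simpa using summable_geometric_of_lt_one (r := (1 / 2 : ℝ)) (by norm_num) (by norm_num)
      exact h0.comp_injective PNat.coe_injective
    have hprod := ((ht.mul_left ‖u‖).mul_of_nonneg hgeo
      (fun i => by positivity) (fun i => by positivity))
    refine Summable.of_norm_bounded hprod fun p => ?_
    have hm : 1 ≤ ((p.2 : ℕ) : ℝ) := by exact_mod_cast p.2.pos
    rw [norm_div, norm_pow, Complex.norm_natCast]
    refine (div_le_self (by positivity) hm).trans ?_
    obtain ⟨n, hn⟩ : ∃ n, (p.2 : ℕ) = n + 1 := ⟨p.2 - 1, by have := p.2.pos; omega⟩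
    rw [hn, Nat.add_sub_cancel, pow_succ', ← norm_mul]
    exact mul_le_mul_of_nonneg_left (pow_le_pow_left₀ (norm_nonneg _) (hsmall _) _)
      (norm_nonneg _)
  have hm : ∀ m : ℕ+, ∑' i, F (i, m) = (∑' i, t i ^ (m : ℕ)) / (m : ℕ) * u ^ (m : ℕ) := fun m => by
    rw [← tsum_div_const, ← tsum_mul_right]
    exact tsum_congr fun i => by simp only [F]; rw [mul_pow]; ring
  have hi : ∀ i, HasSum (fun m : ℕ+ => F (i, m)) (-Complex.log (1 - u * t i)) := fun i => by
    have h := Complex.hasSum_taylorSeries_neg_log (z := u * t i)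
      ((hsmall i).trans_lt (by norm_num))
    rw [← PNat.coe_injective.hasSum_iff (f := fun n : ℕ => (u * t i) ^ n / (n : ℂ))] at h
    · exact h
    · intro n hn
      have : n = 0 := by
        by_contra h0
        exact hn ⟨⟨n, Nat.pos_of_ne_zero h0⟩, rfl⟩
      simp [this]
  have hne : ∀ i, 1 - u * t i ≠ 0 := fun i h0 => by
    have := hsmall i
    rw [← sub_eq_zero.1 h0, norm_one] at this
    norm_num at this
  have hlog : HasSum (fun i => Complex.log (1 - u * t i)) (-∑' p, F p) := by
    have := (hF.hasSum.prod_fiberwise hi).neg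
    simpa using this
  have hswap : HasSum (fun m : ℕ+ => (∑' i, t i ^ (m : ℕ)) / (m : ℕ) * u ^ (m : ℕ))
      (∑' p, F p) := by
    have h1 : HasSum (fun p : ℕ+ × ι => F p.swap) (∑' p, F p) :=
      (Equiv.prodComm ℕ+ ι).hasSum_iff.2 hF.hasSum
    refine (h1.prod_fiberwise fun m => ?_)
    rw [← hm]
    exact (hF.prod_symm.prod_factor m).hasSum
  refine ⟨hswap.summable, ?_⟩
  rw [hswap.tsum_eq]
  exact (Complex.hasProd_of_hasSum_log hne hlog).tprod_eq.symm

/-- Near `u = 0`, `exp (∑ Γ_m u ^ m) = N u / D u`. -/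
def ExpSeriesEq (Γ : ℕ+ → ℂ) (N D : ℂ → ℂ) : Prop :=
  ∀ᶠ u in 𝓝 (0 : ℂ), Summable (fun m : ℕ+ => Γ m * u ^ (m : ℕ)) ∧
    Complex.exp (∑' m : ℕ+, Γ m * u ^ (m : ℕ)) * D u = N u

theorem ExpSeriesEq.neg {Γ : ℕ+ → ℂ} {N D : ℂ → ℂ} (h : ExpSeriesEq Γ N D) :
    ExpSeriesEq (fun m => -Γ m) D N := by
  filter_upwards [h] with u hu
  have e : (fun m : ℕ+ => -Γ m * u ^ (m : ℕ)) = fun m : ℕ+ => -(Γ m * u ^ (m : ℕ)) := by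
    funext m; ring
  rw [e]
  refine ⟨hu.1.neg, ?_⟩
  rw [tsum_neg, ← hu.2, ← mul_assoc, ← Complex.exp_add, neg_add_cancel, Complex.exp_zero, one_mul]

theorem ExpSeriesEq.add {Γ Γ' : ℕ+ → ℂ} {N D N' D' : ℂ → ℂ} (h : ExpSeriesEq Γ N D)
    (h' : ExpSeriesEq Γ' N' D') :
    ExpSeriesEq (fun m => Γ m + Γ' m) (fun u => N u * N' u) (fun u => D u * D' u) := by
  filter_upwards [h, h'] with u hu hu'
  simp only [add_mul]
  refine ⟨hu.1.add hu'.1, ?_⟩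
  rw [hu.1.tsum_add hu'.1, Complex.exp_add, ← hu.2, ← hu'.2]; ring

theorem ExpSeriesEq.congr {Γ Γ' : ℕ+ → ℂ} {N D N' D' : ℂ → ℂ} (h : ExpSeriesEq Γ N D)
    (hΓ : ∀ m, Γ' m = Γ m) (hN : ∀ u, N' u = N u) (hD : ∀ u, D' u = D u) :
    ExpSeriesEq Γ' N' D' := by
  rw [funext hΓ, funext hN, funext hD]; exact h

/-- Contractions are recognised by their coefficients: `-a ^ m T_m / m`, with `T_m` the power sums
of the `t_i`, belongs to `∏ (1 - a u t_i)`. For `q`-Pochhammer symbols the power sums are geometric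
series. -/
theorem expSeriesEq_tprod {ι : Type*} (t : ι → ℂ) (ht : Summable fun i => ‖t i‖) (a : ℂ)
    (T : ℕ+ → ℂ) (hT : ∀ m : ℕ+, HasSum (fun i => t i ^ (m : ℕ)) (T m)) :
    ExpSeriesEq (fun m => -(a ^ (m : ℕ) * T m / (m : ℕ))) (fun u => ∏' i, (1 - a * u * t i))
      fun _ => 1 := by
  have h := exp_neg_tsum_eq_tprod t ht
  have ha : Tendsto (fun u : ℂ => a * u) (𝓝 0) (𝓝 0) := by
    simpa using (continuous_const.mul continuous_id).tendsto (0 : ℂ) (f := fun u : ℂ => a * u)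
  filter_upwards [ha.eventually h] with u hu
  have e : (fun m : ℕ+ => -(a ^ (m : ℕ) * T m / (m : ℕ)) * u ^ (m : ℕ)) =
      fun m : ℕ+ => -((∑' i, t i ^ (m : ℕ)) / (m : ℕ) * (a * u) ^ (m : ℕ)) := by
    funext m; rw [(hT m).tsum_eq, mul_pow]; ring
  rw [e, tsum_neg, mul_one]
  exact ⟨hu.1.neg, hu.2⟩

theorem norm_pow_pnat_lt_one {s : ℂ} (hs : ‖s‖ < 1) (m : ℕ+) : ‖s ^ (m : ℕ)‖ < 1 := by
  rw [norm_pow]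
  exact pow_lt_one₀ (norm_nonneg _) hs m.ne_zero

theorem expSeriesEq_one_sub (a : ℂ) :
    ExpSeriesEq (fun m => -(a ^ (m : ℕ) / (m : ℕ))) (fun u => 1 - a * u) fun _ => 1 := by
  refine (expSeriesEq_tprod (fun _ : Unit => 1) (Summable.of_finite) a (fun _ => 1)
    fun m => by simp).congr ?_ ?_ fun _ => rfl
  · intro m; rw [mul_one]
  · intro u; simp

theorem summable_norm_pow {s : ℂ} (hs : ‖s‖ < 1) : Summable fun n : ℕ => ‖s ^ n‖ := by
  simpa only [norm_pow] using summable_geometric_of_lt_one (norm_nonneg _) hs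

theorem expSeriesEq_poch {s : ℂ} (hs : ‖s‖ < 1) (a : ℂ) :
    ExpSeriesEq (fun m => -(a ^ (m : ℕ) * (1 - s ^ (m : ℕ))⁻¹ / (m : ℕ)))
      (fun u => poch s (a * u)) fun _ => 1 := by
  refine expSeriesEq_tprod (fun n => s ^ n) (summable_norm_pow hs) a _ fun m => ?_
  refine (hasSum_geometric_of_norm_lt_one (norm_pow_pnat_lt_one hs m)).congr_fun fun n => ?_
  rw [← pow_mul, ← pow_mul, mul_comm]

theorem summable_norm_pow_mul_pow {s t : ℂ} (hs : ‖s‖ < 1) (ht : ‖t‖ < 1) :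
    Summable fun n : ℕ × ℕ => ‖s ^ n.1 * t ^ n.2‖ := by
  simpa only [norm_mul] using (summable_norm_pow hs).mul_of_nonneg (summable_norm_pow ht)
    (fun _ => norm_nonneg _) fun _ => norm_nonneg _

theorem expSeriesEq_poch₂ {s t : ℂ} (hs : ‖s‖ < 1) (ht : ‖t‖ < 1) (a : ℂ) :
    ExpSeriesEq
      (fun m => -(a ^ (m : ℕ) * ((1 - s ^ (m : ℕ))⁻¹ * (1 - t ^ (m : ℕ))⁻¹) / (m : ℕ)))
      (fun u => poch₂ s t (a * u)) fun _ => 1 := by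
  refine (expSeriesEq_tprod (fun n : ℕ × ℕ => s ^ n.1 * t ^ n.2) (summable_norm_pow_mul_pow hs ht)
    a (fun m => (1 - s ^ (m : ℕ))⁻¹ * (1 - t ^ (m : ℕ))⁻¹) fun m => ?_).congr (fun _ => rfl)
    (fun u => ?_) fun _ => rfl
  · have h1 := norm_pow_pnat_lt_one hs m
    have h2 := norm_pow_pnat_lt_one ht m
    have h := (hasSum_geometric_of_norm_lt_one h1).mul (hasSum_geometric_of_norm_lt_one h2)
      (summable_mul_of_summable_norm (summable_norm_pow h1) (summable_norm_pow h2))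
    refine h.congr_fun fun n => ?_
    rw [mul_pow, ← pow_mul, ← pow_mul, ← pow_mul, ← pow_mul, mul_comm n.1, mul_comm n.2]
  · simp only [poch₂, mul_assoc]

theorem differentiable_poch {s : ℂ} (hs : ‖s‖ < 1) : Differentiable ℂ (poch s) :=
  differentiable_tprod_one_sub _ (summable_norm_pow hs)

theorem differentiable_poch₂ {s t : ℂ} (hs : ‖s‖ < 1) (ht : ‖t‖ < 1) :
    Differentiable ℂ (poch₂ s t) := by
  have h := differentiable_tprod_one_sub _ (summable_norm_pow_mul_pow hs ht)
  have e : poch₂ s t = fun z => ∏' n : ℕ × ℕ, (1 - z * (s ^ n.1 * t ^ n.2)) := by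
    funext z; simp only [poch₂, mul_assoc]
  rwa [e]

@[simp]
theorem poch_zero (s : ℂ) : poch s 0 = 1 := by simp [poch]

@[simp]
theorem poch₂_zero (s t : ℂ) : poch₂ s t 0 = 1 := by simp [poch₂]

theorem multipliable_one_sub_mul_pow {s : ℂ} (hs : ‖s‖ < 1) (z : ℂ) :
    Multipliable fun n : ℕ => 1 - z * s ^ n := by
  have hsum : Summable fun n : ℕ => -(z * s ^ n) :=
    ((summable_geometric_of_norm_lt_one hs).mul_left z).neg
  exact (Complex.multipliable_one_add_of_summable hsum).congr fun n => (sub_eq_add_neg _ _).symm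

theorem poch_eq_mul {s : ℂ} (hs : ‖s‖ < 1) (z : ℂ) : poch s z = (1 - z) * poch s (s * z) := by
  have e : ∀ n : ℕ, 1 - s * z * s ^ n = 1 - z * s ^ (n + 1) := fun n => by ring
  have hm : Multipliable fun n : ℕ => 1 - z * s ^ (n + 1) :=
    (multipliable_one_sub_mul_pow hs (s * z)).congr e
  have h : ∏' n : ℕ, (1 - z * s ^ n) = (1 - z * s ^ 0) * ∏' n : ℕ, (1 - z * s ^ (n + 1)) :=
    tprod_eq_zero_mul' (f := fun n : ℕ => 1 - z * s ^ n) hm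
  rw [poch, poch, h, tprod_congr e, pow_zero, mul_one]

/-! ### Geometrically bounded sequences -/

/-- `‖Γ m‖ ≤ C ρ ^ m` for some `C` and `ρ`. -/
def GeomBounded (Γ : ℕ+ → ℂ) : Prop :=
  ∃ C ρ : ℝ, 0 ≤ C ∧ 0 ≤ ρ ∧ ∀ m : ℕ+, ‖Γ m‖ ≤ C * ρ ^ (m : ℕ)

theorem GeomBounded.mul {Γ Γ' : ℕ+ → ℂ} (h : GeomBounded Γ) (h' : GeomBounded Γ') :
    GeomBounded fun m => Γ m * Γ' m := by
  obtain ⟨C, ρ, hC, hρ, h⟩ := h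
  obtain ⟨C', ρ', hC', hρ', h'⟩ := h'
  refine ⟨C * C', ρ * ρ', by positivity, by positivity, fun m => ?_⟩
  rw [norm_mul, mul_pow]
  calc _ ≤ (C * ρ ^ (m : ℕ)) * (C' * ρ' ^ (m : ℕ)) := by
        gcongr
        exacts [h m, h' m]
    _ = _ := by ring

theorem GeomBounded.sub {Γ Γ' : ℕ+ → ℂ} (h : GeomBounded Γ) (h' : GeomBounded Γ') :
    GeomBounded fun m => Γ m - Γ' m := by
  obtain ⟨C, ρ, hC, hρ, h⟩ := h
  obtain ⟨C', ρ', hC', hρ', h'⟩ := h'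
  refine ⟨C + C', max ρ ρ', by positivity, by positivity, fun m => ?_⟩
  refine (norm_sub_le _ _).trans ?_
  rw [add_mul]
  refine add_le_add ((h m).trans ?_) ((h' m).trans ?_)
  · gcongr; exact le_max_left _ _
  · gcongr; exact le_max_right _ _

theorem geomBounded_const (c : ℂ) : GeomBounded fun _ => c :=
  ⟨‖c‖, 1, norm_nonneg _, zero_le_one, fun m => by simp⟩

theorem GeomBounded.neg {Γ : ℕ+ → ℂ} (h : GeomBounded Γ) : GeomBounded fun m => -Γ m := by
  simpa using (geomBounded_const 0).sub h

theorem GeomBounded.add {Γ Γ' : ℕ+ → ℂ} (h : GeomBounded Γ) (h' : GeomBounded Γ') :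
    GeomBounded fun m => Γ m + Γ' m := by
  simpa using h.sub h'.neg

/-- The ratio `ρ` in the bound is arbitrary, so the condition just says that the power series has
positive radius of convergence; this is all that contractions need. -/
theorem GeomBounded.eventually_summable {Γ : ℕ+ → ℂ} (h : GeomBounded Γ) :
    ∀ᶠ u in 𝓝 (0 : ℂ), Summable fun m : ℕ+ => ‖Γ m * u ^ (m : ℕ)‖ := by
  obtain ⟨C, ρ, hC, hρ, h⟩ := h
  have hev : ∀ᶠ u in 𝓝 (0 : ℂ), ρ * ‖u‖ < 1 := by
    have : Tendsto (fun u : ℂ => ρ * ‖u‖) (𝓝 0) (𝓝 (ρ * ‖(0 : ℂ)‖)) :=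
      (continuous_const.mul continuous_norm).tendsto _
    rw [norm_zero, mul_zero] at this
    exact this.eventually_lt_const one_pos
  filter_upwards [hev] with u hu
  have hg : Summable fun m : ℕ+ => C * (ρ * ‖u‖) ^ (m : ℕ) :=
    ((summable_geometric_of_lt_one (by positivity) hu).comp_injective PNat.coe_injective).mul_left C
  refine Summable.of_nonneg_of_le (fun _ => norm_nonneg _) (fun m => ?_) hg
  rw [norm_mul, norm_pow, mul_pow, ← mul_assoc]
  exact mul_le_mul_of_nonneg_right (h m) (by positivity)

theorem geomBounded_pow (a : ℂ) : GeomBounded fun m => a ^ (m : ℕ) :=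
  ⟨1, ‖a‖, zero_le_one, norm_nonneg _, fun m => by rw [norm_pow, one_mul]⟩

theorem geomBounded_inv_natCast : GeomBounded fun m : ℕ+ => ((m : ℕ) : ℂ)⁻¹ := by
  refine ⟨1, 1, zero_le_one, zero_le_one, fun m => ?_⟩
  rw [norm_inv, Complex.norm_natCast, one_pow, one_mul]
  exact inv_le_one_of_one_le₀ (by exact_mod_cast m.pos)

/-- If `‖a‖ ≠ 1`, `a ≠ 0` then `(a ^ m - a ^ (-m))⁻¹` is geometrically bounded. -/
theorem geomBounded_inv_sub_inv {a : ℂ} (ha : ‖a‖ < 1) (ha0 : a ≠ 0) :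
    GeomBounded fun m : ℕ+ => (a ^ (m : ℕ) - (a ^ (m : ℕ))⁻¹)⁻¹ := by
  refine ⟨(1 - ‖a‖ ^ 2)⁻¹, ‖a‖, ?_, norm_nonneg _, fun m => ?_⟩
  · rw [inv_nonneg, sub_nonneg]; exact pow_le_one₀ (norm_nonneg _) ha.le
  have h1 : 0 < 1 - ‖a‖ ^ 2 := by
    rw [sub_pos]; exact pow_lt_one₀ (norm_nonneg _) ha two_ne_zero
  have hp : a ^ (m : ℕ) ≠ 0 := pow_ne_zero _ ha0
  have e : (a ^ (m : ℕ) - (a ^ (m : ℕ))⁻¹)⁻¹ = -(a ^ (m : ℕ) * (1 - (a ^ (m : ℕ)) ^ 2)⁻¹) := by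
    have e1 : a ^ (m : ℕ) - (a ^ (m : ℕ))⁻¹ = -((a ^ (m : ℕ))⁻¹ * (1 - (a ^ (m : ℕ)) ^ 2)) := by
      field_simp; ring
    rw [e1, inv_neg, mul_inv, inv_inv]
  rw [congrArg norm e, norm_neg, norm_mul, norm_pow, norm_inv, mul_comm]
  refine mul_le_mul_of_nonneg_right (inv_anti₀ h1 ?_) (by positivity)
  have h2 : ‖(a ^ (m : ℕ)) ^ 2‖ ≤ ‖a‖ ^ 2 := by
    rw [norm_pow, norm_pow]
    exact pow_le_pow_left₀ (by positivity)
      (pow_le_of_le_one (norm_nonneg _) ha.le m.ne_zero) 2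
  have h3 := norm_sub_norm_le (1 : ℂ) ((a ^ (m : ℕ)) ^ 2)
  rw [norm_one] at h3
  linarith

/-! ### Vertex operators -/

/-- The data of the vertex operator `:exp (∑ (Q_j Q̂_j + (s_j ζ + t_j) P̂_j) + ∑ …):`, where the
coefficient of `a_{j,-m}` is `x_{j,m} z ^ m`, and that of `a_{j,m}`, multiplied with
`[a_{j,m}, a_{j,-m}]`, is `y_{j,m} z ^ (-m)`. -/
structure Vertex where
  Q : Fin 3 → ℂ
  s : Fin 3 → ℂ
  t : Fin 3 → ℂ
  x : Osc → ℂ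
  y : Osc → ℂ

namespace Vertex

/-- The vertex operator. -/
def op (k : ℝ) (V : Vertex) (ζ : ℂ) : Op State :=
  gaussOp k V.Q (fun j => V.s j * ζ + V.t j) (fun i => V.x i * Complex.exp ((i.2 : ℕ) * ζ))
    fun i => V.y i * Complex.exp (-((i.2 : ℕ) * ζ))

/-- The normal ordered product of two vertex operators. -/
def op₂ (k : ℝ) (V W : Vertex) (ζ ω : ℂ) : Op State :=
  gaussOp k (V.Q + W.Q) ((fun j => V.s j * ζ + V.t j) + fun j => W.s j * ω + W.t j)
    ((fun i => V.x i * Complex.exp ((i.2 : ℕ) * ζ)) + fun i => W.x i * Complex.exp ((i.2 : ℕ) * ω))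
    ((fun i => V.y i * Complex.exp (-((i.2 : ℕ) * ζ))) +
      fun i => W.y i * Complex.exp (-((i.2 : ℕ) * ω)))

theorem op₂_comm (k : ℝ) (V W : Vertex) (ζ ω : ℂ) : V.op₂ k W ζ ω = W.op₂ k V ω ζ := by
  simp only [op₂, add_comm]

/-- The coefficient of `(w / z) ^ m` in the contraction of `V(z) W(w)`. -/
def contr (V W : Vertex) (m : ℕ+) : ℂ := ∑ j, V.y (j, m) * W.x (j, m)

/-- The power of `z` in the contraction of the zero modes of `V(z) W(w)`. -/
def zeroPow (k : ℝ) (V W : Vertex) : ℂ := ∑ j, V.s j * (W.Q j * zeroComm k j)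

/-- The logarithm of the constant in the contraction of the zero modes of `V(z) W(w)`. -/
def zeroConst (k : ℝ) (V W : Vertex) : ℂ := ∑ j, V.t j * (W.Q j * zeroComm k j)

/-- The coefficients of the oscillators are geometrically bounded. -/
def Bounded (V : Vertex) : Prop :=
  ∀ j, (GeomBounded fun m => V.x (j, m)) ∧ GeomBounded fun m => V.y (j, m)

/-- The factors `z ^ (-m)` and `w ^ m` combine to `u ^ m`, so the contraction depends on `u = w / z`
only. One neighbourhood of `u = 0` therefore serves all matrix elements, which is the uniformity of
the domain of convergence. -/
theorem hasSum_op_mul (k : ℝ) {V W : Vertex} (hV : V.Bounded) (hW : W.Bounded) {N D : ℂ → ℂ}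
    (h : ExpSeriesEq (contr V W) N D) :
    ∀ᶠ u in 𝓝 (0 : ℂ), ∃ c : ℂ, c * D u = N u ∧ ∀ ζ ω : ℂ, Complex.exp (ω - ζ) = u →
      ∀ i j, HasSum (fun l => V.op k ζ i l * W.op k ω l j)
        (Complex.exp (zeroPow k V W * ζ + zeroConst k V W) * c * V.op₂ k W ζ ω i j) := by
  have hs : ∀ᶠ u in 𝓝 (0 : ℂ), ∀ j : Fin 3,
      Summable fun m : ℕ+ => ‖V.y (j, m) * W.x (j, m) * u ^ (m : ℕ)‖ :=
    eventually_all.2 fun j => ((hV j).2.mul (hW j).1).eventually_summable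
  filter_upwards [h, hs] with u hu hsu
  refine ⟨_, hu.2, fun ζ ω hzw i j => ?_⟩
  have hterm : ∀ p : Osc, V.y p * Complex.exp (-((p.2 : ℕ) * ζ)) *
      (W.x p * Complex.exp ((p.2 : ℕ) * ω)) = V.y p * W.x p * u ^ (p.2 : ℕ) := fun p => by
    rw [← hzw, ← Complex.exp_nat_mul, mul_sub, sub_eq_add_neg, Complex.exp_add]; ring
  have hsum : Summable fun p : Osc => ‖V.y p * W.x p * u ^ (p.2 : ℕ)‖ :=
    (summable_prod_of_nonneg fun _ => norm_nonneg _).2 ⟨hsu, Summable.of_finite⟩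
  have htsum : ∑' p : Osc, V.y p * W.x p * u ^ (p.2 : ℕ) =
      ∑' m : ℕ+, contr V W m * u ^ (m : ℕ) := by
    rw [(Summable.of_norm hsum).tsum_prod, tsum_fintype,
      ← Summable.tsum_finsetSum fun j _ => Summable.of_norm (hsu j)]
    exact tsum_congr fun m => by rw [contr, Finset.sum_mul]
  have key := hasSum_gaussOp_mul k V.Q (fun j => V.s j * ζ + V.t j) W.Q
    (fun j => W.s j * ω + W.t j) (fun i => V.x i * Complex.exp ((i.2 : ℕ) * ζ))
    (fun i => V.y i * Complex.exp (-((i.2 : ℕ) * ζ)))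
    (fun i => W.x i * Complex.exp ((i.2 : ℕ) * ω))
    (fun i => W.y i * Complex.exp (-((i.2 : ℕ) * ω))) (by simpa only [hterm] using hsum) i j
  simp only [hterm, htsum] at key
  refine hasSum_of_eq key (fun _ => rfl) ?_
  rw [op₂]
  congr 3
  rw [zeroPow, zeroConst, Finset.sum_mul, ← Finset.sum_add_distrib]
  exact Finset.sum_congr rfl fun j _ => by ring

end Vertex

/-! ### Continuation of products and the reduction of exchange relations to scalars -/

theorem differentiable_gaussCoeff {E : Type*} [NormedAddCommGroup E] [NormedSpace ℂ E]
    {x y : E → ℂ} (hx : Differentiable ℂ x) (hy : Differentiable ℂ y) (a b : ℕ) :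
    Differentiable ℂ fun z => gaussCoeff (x z) (y z) a b := by
  induction b generalizing a with
  | zero => simp only [gaussCoeff_zero_right]; fun_prop
  | succ b ih =>
    cases a with
    | zero => simp only [gaussCoeff_zero_succ]; exact hy.mul (ih 0)
    | succ a => simp only [gaussCoeff_succ_succ]; exact (ih a).add (hy.mul (ih (a + 1)))

theorem differentiable_prod_of_forall {E ι : Type*} [NormedAddCommGroup E] [NormedSpace ℂ E]
    (s : Finset ι) {f : ι → E → ℂ} (hf : ∀ i, Differentiable ℂ (f i)) :
    Differentiable ℂ fun z => ∏ i ∈ s, f i z := by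
  classical
  induction s using Finset.induction_on with
  | empty => simp
  | insert i s hi ih => simp only [Finset.prod_insert hi]; exact (hf i).mul ih

theorem differentiable_gaussOp {E : Type*} [NormedAddCommGroup E] [NormedSpace ℂ E] (k : ℝ)
    (Q : Fin 3 → ℂ) {P : E → Fin 3 → ℂ} {x y : E → Osc → ℂ}
    (hP : ∀ j, Differentiable ℂ fun z => P z j) (hx : ∀ i, Differentiable ℂ fun z => x z i)
    (hy : ∀ i, Differentiable ℂ fun z => y z i) (s t : State) :
    Differentiable ℂ fun z => gaussOp k Q (P z) (x z) (y z) s t := by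
  by_cases h : s.1 = t.1 + Q * zeroComm k
  · simp only [gaussOp, if_pos h, gaussMatrix]
    refine Differentiable.mul (Differentiable.cexp ?_) ?_
    · exact Differentiable.fun_sum fun j _ => (hP j).mul_const _
    · exact differentiable_prod_of_forall _ fun i => differentiable_gaussCoeff (hx i) (hy i) _ _
  · simp only [gaussOp, if_neg h]
    exact differentiable_const 0

theorem Vertex.differentiable_op₂ (k : ℝ) (V W : Vertex) (i j : State) :
    Differentiable ℂ fun x : ℂ × ℂ => V.op₂ k W x.1 x.2 i j := by
  unfold Vertex.op₂
  refine differentiable_gaussOp k _ (fun j => ?_) (fun i => ?_) (fun i => ?_) i j <;>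
  · simp only [Pi.add_apply]; fun_prop

theorem exists_exp_eq_of_eventually {p : ℂ → Prop} (h : ∀ᶠ u in 𝓝 (0 : ℂ), p u) :
    ∃ R : ℝ, ∀ ζ : ℂ, ζ.re < -R → p (Complex.exp ζ) := by
  obtain ⟨δ, hδ, h⟩ := Metric.eventually_nhds_iff.1 h
  refine ⟨-Real.log δ, fun ζ hζ => h ?_⟩
  rw [dist_zero_right, Complex.norm_exp]
  calc Real.exp ζ.re < Real.exp (Real.log δ) := Real.exp_lt_exp.2 (by linarith)
    _ = δ := Real.exp_log hδ

/-- As `w / z` tends to `0` the denominator tends to `D 0`; this makes it a legitimate denominator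
of a meromorphic function. -/
theorem exists_ne_zero_comp_exp_sub {D : ℂ → ℂ} (hD : Continuous D) (h0 : D 0 ≠ 0) :
    ∃ x : ℂ × ℂ, D (Complex.exp (x.2 - x.1)) ≠ 0 := by
  obtain ⟨R, hR⟩ := exists_exp_eq_of_eventually (hD.continuousAt.eventually_ne h0)
  refine ⟨(0, ((-R - 1 : ℝ) : ℂ)), hR _ ?_⟩
  simp

/-- Continuation of the products of finite sums of vertex operators. -/
theorem isContinuation_of_vertices {ι κ : Type} [Fintype ι] [Fintype κ] (k : ℝ)
    {A B : ℂ → Op State} {V : ι → Vertex} {W : κ → Vertex} {a : ι → ℂ} {b : κ → ℂ}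
    (hA : ∀ ζ i j, A ζ i j = ∑ p, a p * (V p).op k ζ i j)
    (hB : ∀ ζ i j, B ζ i j = ∑ p, b p * (W p).op k ζ i j)
    (hV : ∀ p, (V p).Bounded) (hW : ∀ p, (W p).Bounded) {Z : ℂ}
    (hZ : ∀ p q, Vertex.zeroPow k (V p) (W q) = Z) {N : ι → κ → ℂ → ℂ} {D : ℂ → ℂ}
    (hN : ∀ p q, Differentiable ℂ (N p q)) (hD : Differentiable ℂ D) (hD0 : D 0 ≠ 0)
    (h : ∀ p q, ExpSeriesEq (Vertex.contr (V p) (W q)) (N p q) D) :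
    ∃ R₀ : ℝ, ∀ R, R₀ ≤ R → ∀ i j, ∃ f : MeroFun, IsContinuation A B R i j f ∧
      (∀ ζ ω, f.num (ζ, ω) = ∑ p, ∑ q, a p * b q *
        (Complex.exp (Z * ζ + Vertex.zeroConst k (V p) (W q)) *
          N p q (Complex.exp (ω - ζ)) * (V p).op₂ k (W q) ζ ω i j)) ∧
      ∀ ζ ω, f.den (ζ, ω) = D (Complex.exp (ω - ζ)) := by
  obtain ⟨R₀, hR₀⟩ := exists_exp_eq_of_eventually (eventually_all.2 fun p => eventually_all.2
    fun q => Vertex.hasSum_op_mul k (hV p) (hW q) (h p q))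
  refine ⟨R₀, fun R hR i j => ⟨⟨fun x => ∑ p, ∑ q, a p * b q *
        (Complex.exp (Z * x.1 + Vertex.zeroConst k (V p) (W q)) *
          N p q (Complex.exp (x.2 - x.1)) * (V p).op₂ k (W q) x.1 x.2 i j),
      fun x => D (Complex.exp (x.2 - x.1)), ?_, ?_, ?_⟩, ?_, fun _ _ => rfl, fun _ _ => rfl⟩⟩
  · refine Differentiable.fun_sum fun p _ => Differentiable.fun_sum fun q _ => ?_
    have h1 := (hN p q).comp (show Differentiable ℂ fun x : ℂ × ℂ => Complex.exp (x.2 - x.1) by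
      fun_prop)
    have h2 := Vertex.differentiable_op₂ k (V p) (W q) i j
    exact (((show Differentiable ℂ fun x : ℂ × ℂ =>
      Complex.exp (Z * x.1 + Vertex.zeroConst k (V p) (W q)) by fun_prop).mul h1).mul
        h2).const_mul _
  · exact hD.comp (show Differentiable ℂ fun x : ℂ × ℂ => Complex.exp (x.2 - x.1) by fun_prop)
  · exact exists_ne_zero_comp_exp_sub hD.continuous hD0
  · intro ζ ω hζω
    have hc := fun p q => hR₀ (ω - ζ)
      (by rw [Complex.sub_re] at hζω ⊢; linarith) p q
    choose c hcD hc using hc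
    refine ⟨∑ p, ∑ q, a p * b q *
      (Complex.exp (Vertex.zeroPow k (V p) (W q) * ζ + Vertex.zeroConst k (V p) (W q)) * c p q *
        (V p).op₂ k (W q) ζ ω i j), ?_, ?_⟩
    · refine hasSum_of_eq (hasSum_sum fun p _ => hasSum_sum fun q _ =>
        (hc p q ζ ω rfl i j).mul_left (a p * b q)) (fun l => ?_) rfl
      rw [hA, hB, Finset.sum_mul_sum]
      exact Finset.sum_congr rfl fun p _ => Finset.sum_congr rfl fun q _ => by ring
    · simp only [Finset.sum_mul]
      refine Finset.sum_congr rfl fun p _ => Finset.sum_congr rfl fun q _ => ?_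
      rw [hZ, ← hcD]; ring

/-- Exchange relations of finite sums of vertex operators. -/
theorem exchange_of_vertices {ι κ : Type} [Fintype ι] [Fintype κ] (k : ℝ)
    {A B : ℂ → Op State} {V : ι → Vertex} {W : κ → Vertex} {a : ι → ℂ} {b : κ → ℂ}
    (hA : ∀ ζ i j, A ζ i j = ∑ p, a p * (V p).op k ζ i j)
    (hB : ∀ ζ i j, B ζ i j = ∑ p, b p * (W p).op k ζ i j)
    (hV : ∀ p, (V p).Bounded) (hW : ∀ p, (W p).Bounded) {Z Z' : ℂ}
    (hZ : ∀ p q, Vertex.zeroPow k (V p) (W q) = Z)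
    (hZ' : ∀ q p, Vertex.zeroPow k (W q) (V p) = Z')
    {N₁ : ι → κ → ℂ → ℂ} {N₂ : κ → ι → ℂ → ℂ} {D₁ D₂ : ℂ → ℂ}
    (hN₁ : ∀ p q, Differentiable ℂ (N₁ p q)) (hN₂ : ∀ q p, Differentiable ℂ (N₂ q p))
    (hD₁ : Differentiable ℂ D₁) (hD₂ : Differentiable ℂ D₂) (hD₁0 : D₁ 0 ≠ 0) (hD₂0 : D₂ 0 ≠ 0)
    (h₁ : ∀ p q, ExpSeriesEq (Vertex.contr (V p) (W q)) (N₁ p q) D₁)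
    (h₂ : ∀ q p, ExpSeriesEq (Vertex.contr (W q) (V p)) (N₂ q p) D₂) (N D : ℂ → ℂ → ℂ)
    (hrel : ∀ p q ζ ω, D ζ ω *
      (Complex.exp (Z * ζ + Vertex.zeroConst k (V p) (W q)) * N₁ p q (Complex.exp (ω - ζ)) *
        D₂ (Complex.exp (ζ - ω))) = N ζ ω *
      (Complex.exp (Z' * ω + Vertex.zeroConst k (W q) (V p)) * N₂ q p (Complex.exp (ζ - ω)) *
        D₁ (Complex.exp (ω - ζ)))) :
    Exchange A B N D := by
  obtain ⟨R₁, h₁⟩ := isContinuation_of_vertices k hA hB hV hW hZ hN₁ hD₁ hD₁0 h₁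
  obtain ⟨R₂, h₂⟩ := isContinuation_of_vertices k hB hA hW hV hZ' hN₂ hD₂ hD₂0 h₂
  -- Both orders of the product must share one domain constant, which is why the continuation is
  -- available for every sufficiently large `R`.
  refine ⟨max R₁ R₂, fun i j => ?_⟩
  obtain ⟨f, hf, hfn, hfd⟩ := h₁ _ (le_max_left _ _) i j
  obtain ⟨g, hg, hgn, hgd⟩ := h₂ _ (le_max_right R₁ R₂) i j
  refine ⟨f, g, hf, hg, fun ζ ω => ?_⟩
  rw [hfn, hgn, hfd, hgd, Finset.sum_comm (s := Finset.univ (α := κ))]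
  simp only [Finset.sum_mul, Finset.mul_sum]
  refine Finset.sum_congr rfl fun p _ => Finset.sum_congr rfl fun q _ => ?_
  -- The normal ordered products agree in the two orders; dividing them out leaves the scalar
  -- relation.
  rw [Vertex.op₂_comm k (W q) (V p)]
  linear_combination (a p * b q * (V p).op₂ k (W q) ζ ω i j) * hrel p q ζ ω

/-! ### The currents as vertex operators -/

section qNumbers

variable (lq : ℂ)

/-- `(a - a⁻¹) / (q - q⁻¹)`. -/
def brk (a : ℂ) : ℂ := (a - a⁻¹) / (qpow lq 1 - qpow lq (-1))

theorem qpow_neg (x : ℂ) : qpow lq (-x) = (qpow lq x)⁻¹ := by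
  rw [qpow, qpow, neg_mul, Complex.exp_neg]

theorem qpow_add (x y : ℂ) : qpow lq (x + y) = qpow lq x * qpow lq y := by
  rw [qpow, qpow, qpow, add_mul, Complex.exp_add]

theorem qpow_mul_nat (x : ℂ) (n : ℕ) : qpow lq (x * n) = qpow lq x ^ n := by
  rw [qpow, qpow, ← Complex.exp_nat_mul]; congr 1; ring

theorem qpow_ne_zero (x : ℂ) : qpow lq x ≠ 0 := Complex.exp_ne_zero _

@[simp]
theorem qpow_zero : qpow lq 0 = 1 := by simp [qpow]

theorem qnum_neg (x : ℂ) : qnum lq (-x) = -qnum lq x := by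
  rw [qnum, qnum, neg_neg, ← neg_div, neg_sub]

theorem qnum_mul_nat (x : ℂ) (n : ℕ) : qnum lq (x * n) = brk lq (qpow lq x ^ n) := by
  rw [qnum, brk, qpow_neg, qpow_mul_nat]

theorem qpow_neg_mul_nat (x : ℂ) (n : ℕ) : qpow lq (-(x * n)) = qpow lq (-x) ^ n := by
  rw [← neg_mul, qpow_mul_nat]

theorem qnum_nat (n : ℕ) : qnum lq n = brk lq (qpow lq 1 ^ n) := by
  rw [← qnum_mul_nat, one_mul]

variable {lq}

theorem norm_qpow_ofReal (x : ℝ) : ‖qpow lq x‖ = Real.exp (x * lq.re) := by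
  rw [qpow, Complex.norm_exp]; simp

theorem re_neg_of_norm_exp_lt_one (hq : ‖Complex.exp lq‖ < 1) : lq.re < 0 := by
  rwa [Complex.norm_exp, Real.exp_lt_one_iff] at hq

theorem norm_qpow_lt_one (hq : ‖Complex.exp lq‖ < 1) {x : ℝ} (hx : 0 < x) : ‖qpow lq x‖ < 1 := by
  rw [norm_qpow_ofReal, Real.exp_lt_one_iff]
  exact mul_neg_of_pos_of_neg hx (re_neg_of_norm_exp_lt_one hq)

theorem qpow_pow_ne_one (hq : ‖Complex.exp lq‖ < 1) {x : ℝ} (hx : x ≠ 0) {n : ℕ} (hn : n ≠ 0) :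
    qpow lq x ^ n ≠ 1 := by
  intro h
  have h1 := congrArg norm h
  rw [norm_pow, norm_qpow_ofReal, norm_one, ← Real.exp_nat_mul, Real.exp_eq_one_iff] at h1
  have h2 := (re_neg_of_norm_exp_lt_one hq).ne
  have h3 : (n : ℝ) ≠ 0 := by exact_mod_cast hn
  exact (mul_ne_zero h3 (mul_ne_zero hx h2)) h1

theorem qpow_one_sub_ne_zero (hq : ‖Complex.exp lq‖ < 1) : qpow lq 1 - qpow lq (-1) ≠ 0 := by
  rw [qpow_neg, sub_ne_zero]
  intro h
  have h1 := qpow_pow_ne_one hq (x := 1) one_ne_zero (n := 2) two_ne_zero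
  rw [Complex.ofReal_one, pow_two] at h1
  apply h1
  nth_rewrite 2 [h]
  exact mul_inv_cancel₀ (qpow_ne_zero _ _)

theorem brk_pow_ne_zero (hq : ‖Complex.exp lq‖ < 1) {x : ℝ} (hx : x ≠ 0) (m : ℕ+) :
    brk lq (qpow lq x ^ (m : ℕ)) ≠ 0 := by
  refine div_ne_zero ?_ (qpow_one_sub_ne_zero hq)
  rw [sub_ne_zero]
  intro h
  apply qpow_pow_ne_one hq hx (n := m * 2) (by simp)
  rw [pow_mul, pow_two]
  nth_rewrite 2 [h]
  exact mul_inv_cancel₀ (pow_ne_zero _ (qpow_ne_zero _ _))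

theorem geomBounded_brk (a : ℂ) : GeomBounded fun m : ℕ+ => brk lq (a ^ (m : ℕ)) := by
  simp only [brk, div_eq_mul_inv]
  refine ((geomBounded_pow a).sub ?_).mul (geomBounded_const _)
  simpa only [inv_pow] using geomBounded_pow a⁻¹

/-- For `0 < x` use `1 / (a ^ m - a ^ (-m)) = -a ^ m / (1 - a ^ (2 m))` with `‖a‖ < 1`. Negative
`x`, needed because `k` may be negative, follows since the bracket is odd. -/
theorem geomBounded_inv_brk (hq : ‖Complex.exp lq‖ < 1) {x : ℝ} (hx : x ≠ 0) :
    GeomBounded fun m : ℕ+ => (brk lq (qpow lq x ^ (m : ℕ)))⁻¹ := by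
  have main : ∀ y : ℝ, 0 < y →
      GeomBounded fun m : ℕ+ => (brk lq (qpow lq y ^ (m : ℕ)))⁻¹ := fun y hy => by
    simp only [brk, inv_div]
    simp only [div_eq_mul_inv]
    exact (geomBounded_const _).mul
      (geomBounded_inv_sub_inv (norm_qpow_lt_one hq hy) (qpow_ne_zero _ _))
  rcases hx.lt_or_gt with h | h
  · have e : ∀ m : ℕ+, (brk lq (qpow lq x ^ (m : ℕ)))⁻¹ =
        -(brk lq (qpow lq ((-x : ℝ) : ℂ) ^ (m : ℕ)))⁻¹ := fun m => by
      rw [Complex.ofReal_neg, qpow_neg, brk, brk, inv_pow, inv_inv, ← inv_neg, ← neg_div, neg_sub]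
    simp only [e]
    exact (main (-x) (by linarith)).neg
  · exact main x h

end qNumbers

theorem nexp_eq_op (lq : ℂ) (r k : ℝ) (V : Vertex) (ζ : ℂ) (X : LinForm) (hQ : X.1 = V.Q)
    (hP : ∀ j, X.2.1 j = V.s j * ζ + V.t j)
    (hx : ∀ j (m : ℕ+), X.2.2 j (-((m : ℕ) : ℤ)) = V.x (j, m) * Complex.exp ((m : ℕ) * ζ))
    (hy : ∀ j (m : ℕ+), X.2.2 j ((m : ℕ) : ℤ) * commCoeff lq r k (j, m) =
      V.y (j, m) * Complex.exp (-((m : ℕ) * ζ))) :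
    nexp lq r k X = V.op k ζ := by
  rw [nexp_eq_gaussOp, Vertex.op, hQ, funext hP]
  congr 1
  · funext i; exact hx _ _
  · funext i; exact hy _ _

/-- The vertex operators of which the parafermion currents are linear combinations. -/
def paraVertex (lq : ℂ) (r k ε : ℝ) : Bool → Vertex
  | true => {
      Q := ![0, 0, -ε / k]
      s := ![0, 0, -ε / k]
      t := ![0, ε * (lq / 2), -(lq / 2)]
      x := fun i => ![0, 0, -ε * (qpow lq (ε * (k / 2)) ^ (i.2 : ℕ) /
        brk lq (qpow lq k ^ (i.2 : ℕ)))] i.1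
      y := fun i => ![0,
        ε * ((qpow lq 1 - qpow lq (-1)) * (brk lq (qpow lq 1 ^ (i.2 : ℕ)) /
          brk lq (qpow lq 2 ^ (i.2 : ℕ))) * qpow lq (-ε * (k / 2)) ^ (i.2 : ℕ)),
        ε * (qpow lq (ε * (k / 2)) ^ (i.2 : ℕ) / brk lq (qpow lq k ^ (i.2 : ℕ))) -
        (qpow lq 1 - qpow lq (-1)) * (brk lq (qpow lq 1 ^ (i.2 : ℕ)) /
          brk lq (qpow lq 2 ^ (i.2 : ℕ))) * qpow lq (-ε * ((k + 2) / 2)) ^ (i.2 : ℕ)] i.1 *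
        commCoeff lq r k i }
  | false => {
      Q := ![0, 0, -ε / k]
      s := ![0, 0, -ε / k]
      t := ![0, -(ε * (lq / 2)), lq / 2]
      x := fun i => ![0,
        -ε * ((qpow lq 1 - qpow lq (-1)) * (brk lq (qpow lq 1 ^ (i.2 : ℕ)) /
          brk lq (qpow lq 2 ^ (i.2 : ℕ))) * qpow lq (-ε * (k / 2)) ^ (i.2 : ℕ)),
        -ε * (qpow lq (ε * (k / 2)) ^ (i.2 : ℕ) / brk lq (qpow lq k ^ (i.2 : ℕ))) +
        (qpow lq 1 - qpow lq (-1)) * (brk lq (qpow lq 1 ^ (i.2 : ℕ)) /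
          brk lq (qpow lq 2 ^ (i.2 : ℕ))) * qpow lq (-ε * ((k + 2) / 2)) ^ (i.2 : ℕ)] i.1
      y := fun i => ![0, 0, ε * (qpow lq (ε * (k / 2)) ^ (i.2 : ℕ) /
        brk lq (qpow lq k ^ (i.2 : ℕ)))] i.1 * commCoeff lq r k i }

theorem nexp_para_true {lq : ℂ} (hq : ‖Complex.exp lq‖ < 1) (r k ε : ℝ) (ζ : ℂ) :
    nexp lq r k (ε • phi lq 2 1 1 k ζ (ε * (k / 2)) +
        (-phiPlus lq 2 1 2 ζ (-ε * ((k + 2) / 2)) + ε • phiPlus lq 1 1 2 ζ (-ε * (k / 2)))) =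
      (paraVertex lq r k ε true).op k ζ := by
  have hb := fun m : ℕ+ => brk_pow_ne_zero hq (x := 1) one_ne_zero m
  simp only [Complex.ofReal_one] at hb
  refine nexp_eq_op lq r k _ ζ _ ?_ ?_ ?_ ?_
  · funext j; fin_cases j <;> simp [phi, phiPlus, paraVertex, div_eq_mul_inv]
  · intro j
    fin_cases j <;> simp [phi, phiPlus, paraVertex]
    ring
  · intro j m
    have h0 : ¬ ((m : ℕ) : ℤ) < 0 := by have := m.pos; omega
    fin_cases j <;> simp [phi, phiPlus, paraVertex, qnum_neg, qnum_mul_nat, qnum_nat, qpow_mul_nat,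
      neg_div, div_mul_cancel_left₀ (hb m), h0]
    ring
  · intro j m
    fin_cases j <;> simp [phi, phiPlus, paraVertex, qnum_mul_nat, qnum_nat, qpow_mul_nat,
      qpow_neg_mul_nat, div_mul_cancel_left₀ (hb m)] <;> ring

theorem nexp_para_false {lq : ℂ} (hq : ‖Complex.exp lq‖ < 1) (r k ε : ℝ) (ζ : ℂ) :
    nexp lq r k (ε • phi lq 2 1 1 k ζ (ε * (k / 2)) +
        (phiMinus lq 2 1 2 ζ (-ε * ((k + 2) / 2)) - ε • phiMinus lq 1 1 2 ζ (-ε * (k / 2)))) =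
      (paraVertex lq r k ε false).op k ζ := by
  have hb := fun m : ℕ+ => brk_pow_ne_zero hq (x := 1) one_ne_zero m
  simp only [Complex.ofReal_one] at hb
  refine nexp_eq_op lq r k _ ζ _ ?_ ?_ ?_ ?_
  · funext j; fin_cases j <;> simp [phi, phiMinus, paraVertex, div_eq_mul_inv]
  · intro j
    fin_cases j <;> simp [phi, phiMinus, paraVertex]
    ring
  · intro j m
    fin_cases j <;> simp [phi, phiMinus, paraVertex, qnum_neg, qnum_mul_nat, qnum_nat, qpow_mul_nat,
      qpow_neg_mul_nat, neg_div, div_mul_cancel_left₀ (hb m)]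
    all_goals ring
  · intro j m
    have h0 : ¬ ((m : ℕ) : ℤ) < 0 := by have := m.pos; omega
    fin_cases j <;> simp [phi, phiMinus, paraVertex, qnum_mul_nat, qnum_nat, qpow_mul_nat,
      div_mul_cancel_left₀ (hb m), h0]
    ring

/-- A vertex operator of the boson `a_0`. -/
def zeroVertex (lq : ℂ) (r k : ℝ) (s : ℂ) (c : ℕ+ → ℂ) : Vertex where
  Q := ![s * Complex.I, 0, 0]
  s := ![s, 0, 0]
  t := 0
  x := fun i => ![c i.2, 0, 0] i.1
  y := fun i => ![-c i.2, 0, 0] i.1 * commCoeff lq r k i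

/-- The vertex operator `k(z)`. -/
def vertexK (lq : ℂ) (r k : ℝ) : Vertex :=
  zeroVertex lq r k (-(1 / (2 * r) * ((2 * k * r / (r - k) : ℝ) : ℂ) ^ (1 / 2 : ℂ))) fun m =>
    brk lq (qpow lq 1 ^ (m : ℕ)) /
      (brk lq (qpow lq 2 ^ (m : ℕ)) * brk lq (qpow lq r ^ (m : ℕ)))

/-- The vertex operator `:exp (-φ_0(k | z)):`. -/
def vertexE (lq : ℂ) (r k : ℝ) : Vertex :=
  zeroVertex lq r k (-(1 / k * ((2 * k * r / (r - k) : ℝ) : ℂ) ^ (1 / 2 : ℂ))) fun m =>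
    (brk lq (qpow lq k ^ (m : ℕ)))⁻¹

/-- The vertex operator `:exp (φ'_0(k | z)):`. -/
def vertexF (lq : ℂ) (r k : ℝ) : Vertex :=
  zeroVertex lq r k (1 / k * ((2 * k * (r - k) / r : ℝ) : ℂ) ^ (1 / 2 : ℂ)) fun m =>
    -((brk lq (qpow lq k ^ (m : ℕ)))⁻¹ *
      (brk lq (qpow lq (r - k) ^ (m : ℕ)) / brk lq (qpow lq r ^ (m : ℕ))))

theorem currentK_eq_op (lq : ℂ) (r k : ℝ) (ζ : ℂ) :
    currentK lq r k ζ = (vertexK lq r k).op k ζ := by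
  refine nexp_eq_op lq r k _ ζ _ ?_ ?_ ?_ ?_
  · funext j; fin_cases j <;> simp [phi0, vertexK, zeroVertex]
  · intro j
    fin_cases j <;> simp [phi0, vertexK, zeroVertex]
  · intro j m
    fin_cases j <;> simp [phi0, vertexK, zeroVertex, qnum_neg, qnum_mul_nat, qnum_nat, neg_div]
  · intro j m
    fin_cases j <;> simp [phi0, vertexK, zeroVertex, qnum_mul_nat, qnum_nat]
    ring

theorem nexp_phi0_eq_op {lq : ℂ} (hq : ‖Complex.exp lq‖ < 1) (r k : ℝ) (ζ : ℂ) :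
    nexp lq r k (-phi0 lq r k 1 1 k ζ 0) = (vertexE lq r k).op k ζ := by
  have hb := fun m : ℕ+ => brk_pow_ne_zero hq (x := 1) one_ne_zero m
  simp only [Complex.ofReal_one] at hb
  refine nexp_eq_op lq r k _ ζ _ ?_ ?_ ?_ ?_
  · funext j; fin_cases j <;> simp [phi0, vertexE, zeroVertex]
  · intro j
    fin_cases j <;> simp [phi0, vertexE, zeroVertex]
  · intro j m
    fin_cases j <;> simp [phi0, vertexE, zeroVertex, qnum_neg, qnum_mul_nat, qnum_nat, neg_div,
      div_mul_cancel_left₀ (hb m)]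
  · intro j m
    fin_cases j <;> simp [phi0, vertexE, zeroVertex, qnum_mul_nat, qnum_nat,
      div_mul_cancel_left₀ (hb m)]
    ring

theorem nexp_phi0'_eq_op {lq : ℂ} (hq : ‖Complex.exp lq‖ < 1) (r k : ℝ) (ζ : ℂ) :
    nexp lq r k (phi0' lq r k 1 1 k ζ 0) = (vertexF lq r k).op k ζ := by
  have hb := fun m : ℕ+ => brk_pow_ne_zero hq (x := 1) one_ne_zero m
  simp only [Complex.ofReal_one] at hb
  refine nexp_eq_op lq r k _ ζ _ ?_ ?_ ?_ ?_
  · funext j; fin_cases j <;> simp [phi0', vertexF, zeroVertex]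
  · intro j
    fin_cases j <;> simp [phi0', vertexF, zeroVertex]
  · intro j m
    fin_cases j <;> simp [phi0', vertexF, zeroVertex, qnum_neg, qnum_mul_nat, qnum_nat, neg_div,
      div_mul_cancel_left₀ (hb m), div_neg]
  · intro j m
    fin_cases j <;> simp [phi0', vertexF, zeroVertex, qnum_mul_nat, qnum_nat,
      div_mul_cancel_left₀ (hb m)]
    ring

/-- The normal ordered product of two vertex operators at the same point. -/
def Vertex.add (V W : Vertex) : Vertex where
  Q := V.Q + W.Q
  s := V.s + W.s
  t := V.t + W.t
  x := V.x + W.x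
  y := V.y + W.y

/-- The parafermion involves `a_1` and `a_2`, the other factor only `a_0`. They have no contraction,
so their product at the same point converges and is already normal ordered. -/
theorem hasSum_para_mul_zero (lq : ℂ) (r k ε : ℝ) (b : Bool) (s : ℂ) (c : ℕ+ → ℂ) (ζ : ℂ)
    (i j : State) :
    HasSum (fun l => (paraVertex lq r k ε b).op k ζ i l * (zeroVertex lq r k s c).op k ζ l j)
      (((paraVertex lq r k ε b).add (zeroVertex lq r k s c)).op k ζ i j) := by
  set V := paraVertex lq r k ε b with hV
  set W := zeroVertex lq r k s c with hW
  have h0 : ∀ p : Osc, V.y p * W.x p = 0 := by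
    rintro ⟨p, m⟩
    fin_cases p <;> cases b <;> simp [hV, hW, paraVertex, zeroVertex]
  have h1 : ∀ p, V.y p * Complex.exp (-((p.2 : ℕ) * ζ)) *
      (W.x p * Complex.exp ((p.2 : ℕ) * ζ)) = 0 := fun p => by
    rw [mul_mul_mul_comm, h0, zero_mul]
  have h2 : ∑ p, (V.s p * ζ + V.t p) * (W.Q p * zeroComm k p) = 0 := by
    refine Finset.sum_eq_zero fun p _ => ?_
    fin_cases p <;> cases b <;> simp [hV, hW, paraVertex, zeroVertex]
  have key := hasSum_gaussOp_mul k V.Q (fun j => V.s j * ζ + V.t j) W.Q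
    (fun j => W.s j * ζ + W.t j) (fun i => V.x i * Complex.exp ((i.2 : ℕ) * ζ))
    (fun i => V.y i * Complex.exp (-((i.2 : ℕ) * ζ)))
    (fun i => W.x i * Complex.exp ((i.2 : ℕ) * ζ))
    (fun i => W.y i * Complex.exp (-((i.2 : ℕ) * ζ)))
    (by simp only [h1, norm_zero]; exact summable_zero) i j
  simp only [h1, h2, tsum_zero, Complex.exp_zero, one_mul] at key
  refine hasSum_of_eq key (fun _ => rfl) ?_
  rw [Vertex.op]
  congr 1
  · funext p; simp only [Vertex.add, Pi.add_apply]; ring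
  · funext p; simp only [Vertex.add, Pi.add_apply]; ring
  · funext p; simp only [Vertex.add, Pi.add_apply]; ring

/-- The coefficients of the two vertex operators in the parafermion currents. -/
def paraCoeff (lq : ℂ) (ε : ℝ) : Bool → ℂ
  | true => -ε / (qpow lq 1 - qpow lq (-1))
  | false => ε / (qpow lq 1 - qpow lq (-1))

theorem opMul_parafermion {lq : ℂ} (hq : ‖Complex.exp lq‖ < 1) (r k ε : ℝ) (s : ℂ) (c : ℕ+ → ℂ)
    (ζ : ℂ) (i j : State) :
    opMul (parafermion lq r k ε ζ) ((zeroVertex lq r k s c).op k ζ) i j =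
      ∑ b, paraCoeff lq ε b *
        ((paraVertex lq r k ε b).add (zeroVertex lq r k s c)).op k ζ i j := by
  refine HasSum.tsum_eq (hasSum_of_eq (hasSum_sum fun b _ =>
    (hasSum_para_mul_zero lq r k ε b s c ζ i j).mul_left (paraCoeff lq ε b)) (fun l => ?_) rfl)
  rw [parafermion, nexp_para_true hq, nexp_para_false hq]
  simp only [Fintype.sum_bool, paraCoeff, Matrix.smul_apply, Matrix.sub_apply, smul_eq_mul]
  ring

theorem currentE_eq_sum {lq : ℂ} (hq : ‖Complex.exp lq‖ < 1) (r k : ℝ) (ζ : ℂ) (i j : State) :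
    currentE lq r k ζ i j = ∑ b, paraCoeff lq (-1) b *
      ((paraVertex lq r k (-1) b).add (vertexE lq r k)).op k ζ i j := by
  rw [currentE, nexp_phi0_eq_op hq, vertexE, opMul_parafermion hq]

theorem currentF_eq_sum {lq : ℂ} (hq : ‖Complex.exp lq‖ < 1) (r k : ℝ) (ζ : ℂ) (i j : State) :
    currentF lq r k ζ i j = ∑ b, paraCoeff lq 1 b *
      ((paraVertex lq r k 1 b).add (vertexF lq r k)).op k ζ i j := by
  rw [currentF, nexp_phi0'_eq_op hq, vertexF, opMul_parafermion hq]

/-! ### Contractions -/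

theorem commCoeff_zero (lq : ℂ) (r k : ℝ) (m : ℕ+) : commCoeff lq r k (0, m) =
    brk lq (qpow lq 2 ^ (m : ℕ)) * brk lq (qpow lq k ^ (m : ℕ)) / (m : ℕ) *
      (brk lq (qpow lq r ^ (m : ℕ)) / brk lq (qpow lq (r - k) ^ (m : ℕ))) := by
  simp [commCoeff, qnum_mul_nat]

theorem commCoeff_one (lq : ℂ) (r k : ℝ) (m : ℕ+) : commCoeff lq r k (1, m) =
    brk lq (qpow lq 2 ^ (m : ℕ)) * brk lq (qpow lq (k + 2) ^ (m : ℕ)) / (m : ℕ) := by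
  simp [commCoeff, qnum_mul_nat]

theorem commCoeff_two (lq : ℂ) (r k : ℝ) (m : ℕ+) : commCoeff lq r k (2, m) =
    -(brk lq (qpow lq 2 ^ (m : ℕ)) * brk lq (qpow lq k ^ (m : ℕ)) / (m : ℕ)) := by
  simp [commCoeff, qnum_mul_nat]

theorem GeomBounded.div {Γ Γ' : ℕ+ → ℂ} (h : GeomBounded Γ) (h' : GeomBounded fun m => (Γ' m)⁻¹) :
    GeomBounded fun m => Γ m / Γ' m := by
  simp only [div_eq_mul_inv]
  exact h.mul h'

theorem geomBounded_commCoeff {lq : ℂ} (hq : ‖Complex.exp lq‖ < 1) {r k : ℝ} (hkr : k < r)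
    (j : Fin 3) : GeomBounded fun m : ℕ+ => commCoeff lq r k (j, m) := by
  have h := geomBounded_inv_brk hq (x := r - k) (by linarith)
  rw [Complex.ofReal_sub] at h
  fin_cases j
  · simp only [commCoeff_zero, Fin.zero_eta]
    exact (((geomBounded_brk _).mul (geomBounded_brk _)).div geomBounded_inv_natCast).mul
      ((geomBounded_brk _).div h)
  · simp only [commCoeff_one, Fin.mk_one]
    exact ((geomBounded_brk _).mul (geomBounded_brk _)).div geomBounded_inv_natCast
  · simp only [commCoeff_two, Fin.reduceFinMk]
    exact (((geomBounded_brk _).mul (geomBounded_brk _)).div geomBounded_inv_natCast).neg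

theorem zeroVertex_bounded {lq : ℂ} (hq : ‖Complex.exp lq‖ < 1) {r k : ℝ} (hkr : k < r) (s : ℂ)
    {c : ℕ+ → ℂ} (hc : GeomBounded c) : (zeroVertex lq r k s c).Bounded := by
  intro j
  refine ⟨?_, GeomBounded.mul ?_ (geomBounded_commCoeff hq hkr j)⟩
  · fin_cases j
    exacts [hc, geomBounded_const 0, geomBounded_const 0]
  · fin_cases j
    exacts [hc.neg, geomBounded_const 0, geomBounded_const 0]

theorem paraVertex_bounded {lq : ℂ} (hq : ‖Complex.exp lq‖ < 1) {r k : ℝ} (hkr : k < r)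
    (hk0 : k ≠ 0) (ε : ℝ) (b : Bool) : (paraVertex lq r k ε b).Bounded := by
  have hk := geomBounded_inv_brk hq hk0
  have h2 := geomBounded_inv_brk hq (x := 2) two_ne_zero
  rw [Complex.ofReal_ofNat] at h2
  have h21 : ∀ x : ℂ, GeomBounded fun m : ℕ+ => (qpow lq 1 - qpow lq (-1)) *
      (brk lq (qpow lq 1 ^ (m : ℕ)) / brk lq (qpow lq 2 ^ (m : ℕ))) * qpow lq x ^ (m : ℕ) := fun x =>
    ((geomBounded_const _).mul ((geomBounded_brk _).div h2)).mul (geomBounded_pow _)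
  have hx : ∀ x : ℂ, GeomBounded fun m : ℕ+ => qpow lq x ^ (m : ℕ) /
      brk lq (qpow lq k ^ (m : ℕ)) := fun x => (geomBounded_pow _).div hk
  intro j
  cases b
  · refine ⟨?_, GeomBounded.mul ?_ (geomBounded_commCoeff hq hkr j)⟩
    · fin_cases j
      exacts [geomBounded_const 0, (geomBounded_const _).mul (h21 _),
        ((geomBounded_const _).mul (hx _)).add (h21 _)]
    · fin_cases j
      exacts [geomBounded_const 0, geomBounded_const 0, (geomBounded_const _).mul (hx _)]
  · refine ⟨?_, GeomBounded.mul ?_ (geomBounded_commCoeff hq hkr j)⟩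
    · fin_cases j
      exacts [geomBounded_const 0, geomBounded_const 0, (geomBounded_const _).mul (hx _)]
    · fin_cases j
      exacts [geomBounded_const 0, (geomBounded_const _).mul (h21 _),
        ((geomBounded_const _).mul (hx _)).sub (h21 _)]

theorem Vertex.Bounded.add {V W : Vertex} (hV : V.Bounded) (hW : W.Bounded) :
    (V.add W).Bounded :=
  fun j => ⟨(hV j).1.add (hW j).1, (hV j).2.add (hW j).2⟩

theorem contr_zero_zero (lq : ℂ) (r k : ℝ) (s s' : ℂ) (c c' : ℕ+ → ℂ) (m : ℕ+) :
    Vertex.contr (zeroVertex lq r k s c) (zeroVertex lq r k s' c') m =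
      -(c m * commCoeff lq r k (0, m) * c' m) := by
  simp [Vertex.contr, zeroVertex, Fin.sum_univ_three]

theorem contr_zero_add (lq : ℂ) (r k ε : ℝ) (b : Bool) (s s' : ℂ) (c c' : ℕ+ → ℂ) (m : ℕ+) :
    Vertex.contr (zeroVertex lq r k s c) ((paraVertex lq r k ε b).add (zeroVertex lq r k s' c')) m =
      -(c m * commCoeff lq r k (0, m) * c' m) := by
  cases b <;> simp [Vertex.contr, Vertex.add, paraVertex, zeroVertex, Fin.sum_univ_three]

theorem contr_add_zero (lq : ℂ) (r k ε : ℝ) (b : Bool) (s s' : ℂ) (c c' : ℕ+ → ℂ) (m : ℕ+) :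
    Vertex.contr ((paraVertex lq r k ε b).add (zeroVertex lq r k s' c')) (zeroVertex lq r k s c) m =
      -(c m * commCoeff lq r k (0, m) * c' m) := by
  cases b <;> simp [Vertex.contr, Vertex.add, paraVertex, zeroVertex, Fin.sum_univ_three] <;> ring

theorem contr_add_add (lq : ℂ) (r k ε ε' : ℝ) (b b' : Bool) (s s' : ℂ) (c c' : ℕ+ → ℂ) (m : ℕ+) :
    Vertex.contr ((paraVertex lq r k ε b).add (zeroVertex lq r k s c))
      ((paraVertex lq r k ε' b').add (zeroVertex lq r k s' c')) m =
      -(c m * commCoeff lq r k (0, m) * c' m) +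
        Vertex.contr (paraVertex lq r k ε b) (paraVertex lq r k ε' b') m := by
  cases b <;> cases b' <;>
    simp [Vertex.contr, Vertex.add, paraVertex, zeroVertex, Fin.sum_univ_three, add_assoc]

theorem zeroPow_zero_zero (lq : ℂ) (r k : ℝ) (s s' : ℂ) (c c' : ℕ+ → ℂ) :
    Vertex.zeroPow k (zeroVertex lq r k s c) (zeroVertex lq r k s' c') = s * s' := by
  simp [Vertex.zeroPow, zeroVertex, Fin.sum_univ_three, zeroComm, mul_assoc]

theorem zeroPow_zero_add (lq : ℂ) (r k ε : ℝ) (b : Bool) (s s' : ℂ) (c c' : ℕ+ → ℂ) :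
    Vertex.zeroPow k (zeroVertex lq r k s c)
      ((paraVertex lq r k ε b).add (zeroVertex lq r k s' c')) = s * s' := by
  cases b <;> simp [Vertex.zeroPow, Vertex.add, paraVertex, zeroVertex, Fin.sum_univ_three,
    zeroComm, mul_assoc]

theorem zeroPow_add_zero (lq : ℂ) (r k ε : ℝ) (b : Bool) (s s' : ℂ) (c c' : ℕ+ → ℂ) :
    Vertex.zeroPow k ((paraVertex lq r k ε b).add (zeroVertex lq r k s' c'))
      (zeroVertex lq r k s c) = s * s' := by
  cases b <;> simp [Vertex.zeroPow, Vertex.add, paraVertex, zeroVertex, Fin.sum_univ_three,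
    zeroComm] <;> linear_combination (-(s * s')) * Complex.I_mul_I

/-- The two terms of a parafermion differ in the constant multiples of the `P_j`, not in the
multiples of `P_j log z`. So one power of `z` is common to all four products. -/
theorem zeroPow_add_add (lq : ℂ) (r : ℝ) {k : ℝ} (hk0 : k ≠ 0) (ε ε' : ℝ) (b b' : Bool) (s s' : ℂ)
    (c c' : ℕ+ → ℂ) :
    Vertex.zeroPow k ((paraVertex lq r k ε b).add (zeroVertex lq r k s c))
      ((paraVertex lq r k ε' b').add (zeroVertex lq r k s' c')) = s * s' - 2 * ε * ε' / k := by
  have hk : (k : ℂ) ≠ 0 := by exact_mod_cast hk0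
  cases b <;> cases b' <;>
    simp [Vertex.zeroPow, Vertex.add, paraVertex, zeroVertex, Fin.sum_univ_three,
      zeroComm, mul_assoc] <;> field_simp <;> ring

theorem zeroConst_zero (lq : ℂ) (r k : ℝ) (s : ℂ) (c : ℕ+ → ℂ) (W : Vertex) :
    Vertex.zeroConst k (zeroVertex lq r k s c) W = 0 := by
  simp [Vertex.zeroConst, zeroVertex]

theorem zeroConst_add_zero (lq : ℂ) (r k ε : ℝ) (b : Bool) (s s' : ℂ) (c c' : ℕ+ → ℂ) :
    Vertex.zeroConst k ((paraVertex lq r k ε b).add (zeroVertex lq r k s' c'))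
      (zeroVertex lq r k s c) = 0 := by
  cases b <;> simp [Vertex.zeroConst, Vertex.add, paraVertex, zeroVertex, Fin.sum_univ_three]

/-- Only `P_2` meets a `Q_2`. Its constant coefficient is `∓ (log q) / 2` according to the term on
the left, so the term chosen on the right does not matter. -/
theorem zeroConst_add_add (lq : ℂ) (r : ℝ) {k : ℝ} (hk0 : k ≠ 0) (ε ε' : ℝ) (b b' : Bool)
    (s s' : ℂ) (c c' : ℕ+ → ℂ) :
    Vertex.zeroConst k ((paraVertex lq r k ε b).add (zeroVertex lq r k s c))
      ((paraVertex lq r k ε' b').add (zeroVertex lq r k s' c')) =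
      (if b then -1 else 1) * (ε' * lq) := by
  have hk : (k : ℂ) ≠ 0 := by exact_mod_cast hk0
  cases b <;> cases b' <;>
    simp [Vertex.zeroConst, Vertex.add, paraVertex, zeroVertex, Fin.sum_univ_three,
      zeroComm] <;> field_simp

/-! ### Square roots -/

theorem cpow_half_mul_self (x : ℂ) : x ^ (1 / 2 : ℂ) * x ^ (1 / 2 : ℂ) = x := by
  rw [← pow_two]
  simp

/-- A positive factor leaves the branch of the principal root unchanged, also on the negative axis.
Negative radicands do occur, namely for `k < 0`. -/
theorem cpow_half_pos_mul {c : ℝ} (hc : 0 < c) (x : ℝ) :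
    ((c ^ 2 * x : ℝ) : ℂ) ^ (1 / 2 : ℂ) = c * (x : ℂ) ^ (1 / 2 : ℂ) := by
  have key : ∀ y : ℝ, 0 ≤ y →
      ((c ^ 2 * y : ℝ) : ℂ) ^ (1 / 2 : ℂ) = c * (y : ℂ) ^ (1 / 2 : ℂ) := fun y hy => by
    have e : (1 / 2 : ℂ) = ((1 / 2 : ℝ) : ℂ) := by norm_num
    rw [e, ← Complex.ofReal_cpow (by positivity), ← Complex.ofReal_cpow hy,
      Real.mul_rpow (by positivity) hy, ← Real.sqrt_eq_rpow, Real.sqrt_sq hc.le]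
    push_cast; rfl
  rcases le_total 0 x with h | h
  · exact key x h
  · have h1 := key (-x) (by linarith)
    rw [Complex.ofReal_cpow_of_nonpos h, Complex.ofReal_cpow_of_nonpos
      (mul_nonpos_of_nonneg_of_nonpos (by positivity) h), ← mul_assoc]
    congr 1
    rw [← Complex.ofReal_neg, ← Complex.ofReal_neg, ← h1]
    congr 2; ring

/-- The coefficient of `P_0 log z` in `E(z)`. -/
def chargeE (r k : ℝ) : ℂ := -(1 / k * ((2 * k * r / (r - k) : ℝ) : ℂ) ^ (1 / 2 : ℂ))

theorem chargeE_mul_self {r k : ℝ} (hk0 : k ≠ 0) :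
    chargeE r k * chargeE r k = 2 * r / (k * (r - k)) := by
  have h := cpow_half_mul_self ((2 * k * r / (r - k) : ℝ) : ℂ)
  have hk : (k : ℂ) ≠ 0 := by exact_mod_cast hk0
  rw [chargeE]
  calc _ = 1 / (k : ℂ) ^ 2 * (((2 * k * r / (r - k) : ℝ) : ℂ) ^ (1 / 2 : ℂ) *
        ((2 * k * r / (r - k) : ℝ) : ℂ) ^ (1 / 2 : ℂ)) := by ring
    _ = _ := by rw [h]; push_cast; field_simp

/-- The radicands for `E` and `F` differ by the positive square `((r - k) / r) ^ 2`, so both roots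
lie on the same branch and products of charges carry no sign ambiguity. -/
theorem chargeF_eq {r k : ℝ} (hr : 0 < r) (hkr : k < r) (hk0 : k ≠ 0) :
    1 / k * ((2 * k * (r - k) / r : ℝ) : ℂ) ^ (1 / 2 : ℂ) = -(chargeE r k * ((r - k) / r)) := by
  have h1 : r - k ≠ 0 := by linarith
  have h2 : (2 * k * (r - k) / r : ℝ) = ((r - k) / r) ^ 2 * (2 * k * r / (r - k)) := by
    field_simp
  rw [h2, cpow_half_pos_mul (div_pos (by linarith) hr), chargeE]
  push_cast; ring

theorem chargeK_eq {r k : ℝ} (hr : 0 < r) (hk0 : k ≠ 0) :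
    -(1 / (2 * r) * ((2 * k * r / (r - k) : ℝ) : ℂ) ^ (1 / 2 : ℂ)) =
      chargeE r k * (k / (2 * r)) := by
  have hk : (k : ℂ) ≠ 0 := by exact_mod_cast hk0
  have hr' : (r : ℂ) ≠ 0 := by exact_mod_cast hr.ne'
  rw [chargeE]; field_simp

/-- The values of the relevant powers of `q ^ m`, as rational functions of `g = q ^ m`,
`h = q ^ (k m / 2)` and `ρ = q ^ (r m)`. -/
structure PowerValues (lq : ℂ) (r k : ℝ) (m : ℕ+) (g h ρ d M : ℂ) : Prop where
  hg : g ≠ 0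
  hh : h ≠ 0
  hρ : ρ ≠ 0
  hd : d ≠ 0
  hM : M ≠ 0
  hg2 : g ^ 2 - 1 ≠ 0
  hg4 : g ^ 4 - 1 ≠ 0
  hg41 : 1 - g ^ 4 ≠ 0
  hh4 : h ^ 4 - 1 ≠ 0
  hρ2 : ρ ^ 2 - 1 ≠ 0
  hρ21 : 1 - ρ ^ 2 ≠ 0
  hρh : ρ ^ 2 - h ^ 4 ≠ 0
  hρh1 : h ^ 4 - ρ ^ 2 ≠ 0
  cast : ((m : ℕ) : ℂ) = M
  d_eq : qpow lq 1 - qpow lq (-1) = d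
  brk_one : brk lq g = (g ^ 2 - 1) / (g * d)
  brk_two : brk lq (g ^ 2) = (g ^ 4 - 1) / (g ^ 2 * d)
  brk_k : brk lq (h ^ 2) = (h ^ 4 - 1) / (h ^ 2 * d)
  brk_r : brk lq ρ = (ρ ^ 2 - 1) / (ρ * d)
  brk_sub : brk lq (ρ / h ^ 2) = (ρ ^ 2 - h ^ 4) / (ρ * h ^ 2 * d)
  brk_add : brk lq (h ^ 2 * g ^ 2) = (h ^ 4 * g ^ 4 - 1) / (h ^ 2 * g ^ 2 * d)
  pow_one : qpow lq 1 ^ (m : ℕ) = g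
  pow_neg_one : qpow lq (-1) ^ (m : ℕ) = g⁻¹
  pow_two : qpow lq 2 ^ (m : ℕ) = g ^ 2
  pow_neg_two : qpow lq (-2) ^ (m : ℕ) = (g ^ 2)⁻¹
  pow_r : qpow lq r ^ (m : ℕ) = ρ
  pow_sub : qpow lq (r - k) ^ (m : ℕ) = ρ / h ^ 2
  pow_add : qpow lq (k + 2) ^ (m : ℕ) = h ^ 2 * g ^ 2
  pow_p : qpow lq (2 * r) ^ (m : ℕ) = ρ ^ 2
  pow_ps : qpow lq (2 * (r - k)) ^ (m : ℕ) = ρ ^ 2 / h ^ 4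
  pow_k : qpow lq k ^ (m : ℕ) = h ^ 2
  pow_neg_k : qpow lq (-k) ^ (m : ℕ) = (h ^ 2)⁻¹
  pow_half : qpow lq (k / 2) ^ (m : ℕ) = h
  pow_neg_half : qpow lq (-(k / 2)) ^ (m : ℕ) = h⁻¹
  pow_half_add : qpow lq ((k + 2) / 2) ^ (m : ℕ) = h * g
  pow_neg_half_add : qpow lq (-((k + 2) / 2)) ^ (m : ℕ) = (h * g)⁻¹

/-- As `‖q‖ < 1`, no non-zero real power of `q` has modulus `1`, so none of the denominators in the
contractions vanishes. Every comparison of coefficients becomes an identity of rational functions.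
-/
theorem exists_powerValues {lq : ℂ} (hq : ‖Complex.exp lq‖ < 1) {r k : ℝ} (hr : 0 < r) (hkr : k < r)
    (hk0 : k ≠ 0) (m : ℕ+) : ∃ g h ρ d M, PowerValues lq r k m g h ρ d M := by
  have hm := m.ne_zero
  have hneg : ∀ a : ℂ, a ≠ 0 → a - a⁻¹ = (a ^ 2 - 1) / a := fun a ha => by field_simp
  have n0 : ∀ x, qpow lq x ^ (m : ℕ) ≠ 0 := fun x => pow_ne_zero _ (qpow_ne_zero _ _)
  have nn : ∀ {x : ℝ} {a : ℂ}, x ≠ 0 → qpow lq x ^ (m : ℕ) = a → a - 1 ≠ 0 := by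
    intro x a hx h
    rw [← h]; exact sub_ne_zero.2 (qpow_pow_ne_one hq hx hm)
  have hadd : ∀ x y : ℂ, qpow lq (x + y) ^ (m : ℕ) = qpow lq x ^ (m : ℕ) * qpow lq y ^ (m : ℕ) :=
    fun x y => by rw [qpow_add, mul_pow]
  have hinv : ∀ x : ℂ, qpow lq (-x) ^ (m : ℕ) = (qpow lq x ^ (m : ℕ))⁻¹ := fun x => by
    rw [qpow_neg, inv_pow]
  set g := qpow lq 1 ^ (m : ℕ) with hg
  set h := qpow lq (k / 2) ^ (m : ℕ) with hh
  set ρ := qpow lq r ^ (m : ℕ) with hρ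
  set d := qpow lq 1 - qpow lq (-1) with hd
  have g0 : g ≠ 0 := n0 _
  have h0 : h ≠ 0 := n0 _
  have ρ0 : ρ ≠ 0 := n0 _
  have d0 : d ≠ 0 := qpow_one_sub_ne_zero hq
  have e2 : qpow lq 2 ^ (m : ℕ) = g ^ 2 := by
    rw [show (2 : ℂ) = 1 + 1 by norm_num, hadd, ← hg, sq]
  have e4 : qpow lq 4 ^ (m : ℕ) = g ^ 4 := by
    rw [show (4 : ℂ) = 2 + 2 by norm_num, hadd, e2]; ring
  have ek : qpow lq k ^ (m : ℕ) = h ^ 2 := by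
    rw [show (k : ℂ) = k / 2 + k / 2 by ring, hadd, ← hh, sq]
  have esub : qpow lq (r - k) ^ (m : ℕ) = ρ / h ^ 2 := by
    rw [sub_eq_add_neg, hadd, hinv, ek, ← hρ, div_eq_mul_inv]
  have ep : qpow lq (2 * r) ^ (m : ℕ) = ρ ^ 2 := by rw [two_mul, hadd, ← hρ, sq]
  have eps : qpow lq (2 * (r - k)) ^ (m : ℕ) = ρ ^ 2 / h ^ 4 := by
    rw [two_mul, hadd, esub]; field_simp
  have eadd : qpow lq (k + 2) ^ (m : ℕ) = h ^ 2 * g ^ 2 := by rw [hadd, ek, e2]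
  have ehadd : qpow lq ((k + 2) / 2) ^ (m : ℕ) = h * g := by
    rw [add_div, hadd, ← hh, div_self two_ne_zero]
  have g2 : g ^ 2 - 1 ≠ 0 := nn (x := 2) two_ne_zero (by push_cast; exact e2)
  have g4 : g ^ 4 - 1 ≠ 0 := nn (x := 4) four_ne_zero (by push_cast; exact e4)
  have h4 : h ^ 4 - 1 ≠ 0 := nn (x := 2 * k) (by positivity) (by
    push_cast; rw [two_mul, hadd, ek]; ring)
  have ρ2 : ρ ^ 2 - 1 ≠ 0 := nn (x := 2 * r) (by positivity) (by push_cast; exact ep)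
  have hrk : r - k ≠ 0 := by linarith
  have ρh : ρ ^ 2 - h ^ 4 ≠ 0 := by
    have := nn (x := 2 * (r - k)) (by positivity) (by push_cast; exact eps)
    intro hc
    apply this
    rw [sub_eq_zero.1 hc, div_self (pow_ne_zero _ h0), sub_self]
  refine ⟨g, h, ρ, d, (m : ℕ), g0, h0, ρ0, d0, by exact_mod_cast hm, g2, g4, ?_, h4, ρ2, ?_, ρh, ?_,
    rfl, rfl, ?_, ?_, ?_, ?_, ?_, ?_, hg.symm, hinv 1, e2, by rw [hinv, e2], hρ.symm, esub, eadd, ep, eps,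
    ek, by rw [hinv, ek], hh.symm, hinv _, ehadd, by rw [hinv, ehadd]⟩
  · rwa [← neg_sub, neg_ne_zero]
  · rwa [← neg_sub, neg_ne_zero]
  · rwa [← neg_sub, neg_ne_zero]
  · rw [brk, ← hd, hneg g g0]; field_simp
  · rw [brk, ← hd, hneg _ (pow_ne_zero _ g0)]; field_simp
  · rw [brk, ← hd, hneg _ (pow_ne_zero _ h0)]; field_simp
  · rw [brk, ← hd, hneg _ ρ0]; field_simp
  · rw [brk, ← hd, hneg _ (div_ne_zero ρ0 (pow_ne_zero _ h0))]; field_simp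
  · rw [brk, ← hd, hneg _ (mul_ne_zero (pow_ne_zero _ h0) (pow_ne_zero _ g0))]; field_simp

/-! ### Contractions of the currents in closed form -/

section contractions

variable {lq : ℂ} (hq : ‖Complex.exp lq‖ < 1) {r k : ℝ} (hr : 0 < r) (hkr : k < r) (hk0 : k ≠ 0)

theorem norm_p_lt_one (hq : ‖Complex.exp lq‖ < 1) (hr : 0 < r) : ‖qpow lq (2 * r)‖ < 1 := by
  have := norm_qpow_lt_one hq (x := 2 * r) (by linarith)
  push_cast at this; exact this

theorem norm_ps_lt_one (hq : ‖Complex.exp lq‖ < 1) (hkr : k < r) : ‖qpow lq (2 * (r - k))‖ < 1 := by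
  have := norm_qpow_lt_one hq (x := 2 * (r - k)) (by linarith)
  push_cast at this; exact this

theorem norm_q_pow_four_lt_one (hq : ‖Complex.exp lq‖ < 1) : ‖qpow lq 1 ^ 4‖ < 1 := by
  have := norm_qpow_lt_one hq (x := 1) one_pos
  rw [Complex.ofReal_one] at this
  rw [norm_pow]
  exact pow_lt_one₀ (norm_nonneg _) this four_ne_zero

include hq hr hkr hk0

/-- The coefficient is `-[m]² [km] / (m [2m] [rm] [(r-k)m])`. By the addition formula for `coth`,
`[km] / ([rm] [(r-k)m])` splits into a function of `p ^ m` minus the same function of `p* ^ m`,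
hence a quotient of `ξ` for the two nomes. -/
theorem expSeriesEq_K_K : ExpSeriesEq (Vertex.contr (vertexK lq r k) (vertexK lq r k))
    (fun u => xiNum (qpow lq (2 * r)) (qpow lq 1) u * xiDen (qpow lq (2 * (r - k))) (qpow lq 1) u)
    (fun u => xiDen (qpow lq (2 * r)) (qpow lq 1) u *
      xiNum (qpow lq (2 * (r - k))) (qpow lq 1) u) := by
  have hp := norm_p_lt_one hq hr
  have hps := norm_ps_lt_one hq hkr
  have h4 := norm_q_pow_four_lt_one hq
  have hN : ∀ {s : ℂ}, ‖s‖ < 1 → _ := fun {s} hs =>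
    (expSeriesEq_poch₂ hs h4 (qpow lq 1 ^ 2)).add (expSeriesEq_poch₂ hs h4 (s * qpow lq 1 ^ 2))
  have hD : ∀ {s : ℂ}, ‖s‖ < 1 → _ := fun {s} hs =>
    (expSeriesEq_poch₂ hs h4 (qpow lq 1 ^ 4)).add (expSeriesEq_poch₂ hs h4 s)
  refine (((hN hp).add (hD hps)).add ((hD hp).add (hN hps)).neg).congr (fun m => ?_) (fun u => ?_)
    fun u => ?_
  · obtain ⟨g, h, ρ, d, M, H⟩ := exists_powerValues hq hr hkr hk0 m
    obtain ⟨h1, h2, h3, h4, h5, h6, h7, h8, h9, h10, h11, h12, h13⟩ := H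
    simp only [vertexK, contr_zero_zero, commCoeff_zero, mul_pow, ← pow_mul, mul_comm _ (m : ℕ)]
    simp only [pow_mul, *]
    have e : 1 - ρ ^ 2 / h ^ 4 = (h ^ 4 - ρ ^ 2) / h ^ 4 := by field_simp
    rw [e]
    field_simp
    ring
  · simp only [xiNum, xiDen, mul_one]
  · simp only [xiNum, xiDen, one_mul, mul_one]

/-- All brackets cancel except `-[m] / (m [(r-k)m])`, so only the nome `p*` appears. For `F` the
factor `[(r-k)m] / [rm]` in `a'_{0,m}` replaces it by `p`. -/
theorem expSeriesEq_K_zeroE : ExpSeriesEq (fun m =>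
      -((vertexK lq r k).x (0, m) * commCoeff lq r k (0, m) * (vertexE lq r k).x (0, m)))
    (fun u => poch (qpow lq (2 * (r - k))) (qpow lq (-1) * qpow lq (r - k) * u))
    (fun u => poch (qpow lq (2 * (r - k))) (qpow lq 1 * qpow lq (r - k) * u)) := by
  have hps := norm_ps_lt_one hq hkr
  refine ((expSeriesEq_poch hps (qpow lq (-1) * qpow lq (r - k))).add
    (expSeriesEq_poch hps (qpow lq 1 * qpow lq (r - k))).neg).congr (fun m => ?_) (fun u => ?_)
    fun u => ?_
  · obtain ⟨g, h, ρ, d, M, H⟩ := exists_powerValues hq hr hkr hk0 m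
    obtain ⟨h1, h2, h3, h4, h5, h6, h7, h8, h9, h10, h11, h12, h13⟩ := H
    simp only [vertexK, vertexE, zeroVertex, commCoeff_zero, mul_pow, Matrix.cons_val_zero, *]
    have e : 1 - ρ ^ 2 / h ^ 4 = (h ^ 4 - ρ ^ 2) / h ^ 4 := by field_simp
    rw [e]
    field_simp
    ring
  · rw [mul_one]
  · rw [one_mul]

theorem expSeriesEq_K_zeroF : ExpSeriesEq (fun m =>
      -((vertexK lq r k).x (0, m) * commCoeff lq r k (0, m) * (vertexF lq r k).x (0, m)))
    (fun u => poch (qpow lq (2 * r)) (qpow lq 1 * qpow lq r * u))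
    (fun u => poch (qpow lq (2 * r)) (qpow lq (-1) * qpow lq r * u)) := by
  have hp := norm_p_lt_one hq hr
  refine ((expSeriesEq_poch hp (qpow lq 1 * qpow lq r)).add
    (expSeriesEq_poch hp (qpow lq (-1) * qpow lq r)).neg).congr (fun m => ?_) (fun u => ?_)
    fun u => ?_
  · obtain ⟨g, h, ρ, d, M, H⟩ := exists_powerValues hq hr hkr hk0 m
    obtain ⟨h1, h2, h3, h4, h5, h6, h7, h8, h9, h10, h11, h12, h13⟩ := H
    simp only [vertexK, vertexF, zeroVertex, commCoeff_zero, mul_pow, Matrix.cons_val_zero, *]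
    field_simp
    ring
  · rw [mul_one]
  · rw [one_mul]

end contractions

/-- The zero of the numerator of the contraction of two parafermion currents of equal sign, where
`a = q ^ (±2)`. -/
def paraRoot (a : ℂ) : Bool → Bool → ℂ
  | true, true => 1
  | true, false => a⁻¹
  | false, true => a
  | false, false => 1

theorem expSeriesEq_ratio (α β : ℂ) :
    ExpSeriesEq (fun m => (β ^ (m : ℕ) - α ^ (m : ℕ)) / (m : ℕ)) (fun u => 1 - α * u)
      fun u => 1 - β * u := by
  refine ((expSeriesEq_one_sub α).add (expSeriesEq_one_sub β).neg).congr (fun m => ?_)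
    (fun u => ?_) fun u => ?_
  · ring
  · rw [mul_one]
  · rw [one_mul]

theorem expSeriesEq_poch_ratio {s : ℂ} (hs : ‖s‖ < 1) (a b α β : ℂ) :
    ExpSeriesEq (fun m => (b ^ (m : ℕ) - a ^ (m : ℕ)) * (1 - s ^ (m : ℕ))⁻¹ / (m : ℕ) +
        (β ^ (m : ℕ) - α ^ (m : ℕ)) / (m : ℕ))
      (fun u => (1 - α * u) * poch s (a * u)) fun u => (1 - β * u) * poch s (b * u) := by
  refine (((expSeriesEq_poch hs a).add (expSeriesEq_poch hs b).neg).add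
    (expSeriesEq_ratio α β)).congr (fun m => ?_) (fun u => ?_) fun u => ?_
  · ring
  · ring
  · ring

section contractions

variable {lq : ℂ} (hq : ‖Complex.exp lq‖ < 1) {r k : ℝ} (hr : 0 < r) (hkr : k < r) (hk0 : k ≠ 0)
include hq hr hkr hk0

/-- The `a_0` part has the denominator `[km] [(r-k)m]`. Adding the leading `a_2` part, `[2m] q ^
(-km) / (m [km])`, cancels `[km]` because `[rm] - q ^ (-km) [(r-k)m] = q ^ ((r-k)m) [km]`. The
half-sums `φ^(±)` only change a rational factor, and the choice of terms is visible in its numerator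
alone. -/
theorem expSeriesEq_E_E (b b' : Bool) :
    ExpSeriesEq (Vertex.contr ((paraVertex lq r k (-1) b).add (vertexE lq r k))
      ((paraVertex lq r k (-1) b').add (vertexE lq r k)))
    (fun u => (1 - paraRoot (qpow lq 2) b b' * u) *
      poch (qpow lq (2 * (r - k))) (qpow lq (2 * (r - k)) * (qpow lq 2)⁻¹ * u))
    (fun u => (1 - qpow lq 2 * u) *
      poch (qpow lq (2 * (r - k))) (qpow lq (2 * (r - k)) * qpow lq 2 * u)) := by
  refine (expSeriesEq_poch_ratio (norm_ps_lt_one hq hkr) _ _ _ _).congr (fun m => ?_)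
    (fun u => rfl) fun u => rfl
  obtain ⟨g, h, ρ, d, M, H⟩ := exists_powerValues hq hr hkr hk0 m
  obtain ⟨h1, h2, h3, h4, h5, h6, h7, h8, h9, h10, h11, h12, h13⟩ := H
  rw [vertexE, contr_add_add]
  have e : 1 - ρ ^ 2 / h ^ 4 = (h ^ 4 - ρ ^ 2) / h ^ 4 := by field_simp
  cases b <;> cases b' <;>
    simp only [Vertex.contr, Fin.sum_univ_three, paraVertex, commCoeff_zero, commCoeff_one,
      commCoeff_two, paraRoot, Complex.ofReal_neg, Complex.ofReal_one, neg_neg, one_mul, neg_mul,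
      mul_pow, inv_pow, one_pow, Matrix.cons_val_zero, Matrix.cons_val_one, Matrix.cons_val, *] <;>
    field_simp <;> ring

end contractions

section contractions

variable {lq : ℂ} (hq : ‖Complex.exp lq‖ < 1) {r k : ℝ} (hr : 0 < r) (hkr : k < r) (hk0 : k ≠ 0)
include hq hr hkr hk0

/-- As for `E`, with `q` inverted in the rational factor; the cancellation of `[km]` now reads `q ^
(km) [rm] - [(r-k)m] = q ^ (rm) [km]` and leaves the nome `p`. -/
theorem expSeriesEq_F_F (b b' : Bool) :
    ExpSeriesEq (Vertex.contr ((paraVertex lq r k 1 b).add (vertexF lq r k))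
      ((paraVertex lq r k 1 b').add (vertexF lq r k)))
    (fun u => (1 - paraRoot (qpow lq 2)⁻¹ b b' * u) *
      poch (qpow lq (2 * r)) (qpow lq (2 * r) * qpow lq 2 * u))
    (fun u => (1 - (qpow lq 2)⁻¹ * u) *
      poch (qpow lq (2 * r)) (qpow lq (2 * r) * (qpow lq 2)⁻¹ * u)) := by
  refine (expSeriesEq_poch_ratio (norm_p_lt_one hq hr) _ _ _ _).congr (fun m => ?_)
    (fun u => rfl) fun u => rfl
  obtain ⟨g, h, ρ, d, M, H⟩ := exists_powerValues hq hr hkr hk0 m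
  obtain ⟨h1, h2, h3, h4, h5, h6, h7, h8, h9, h10, h11, h12, h13⟩ := H
  rw [vertexF, contr_add_add]
  cases b <;> cases b' <;>
    simp only [Vertex.contr, Fin.sum_univ_three, paraVertex, commCoeff_zero, commCoeff_one,
      commCoeff_two, paraRoot, Complex.ofReal_one, neg_neg, one_mul, neg_mul,
      mul_pow, inv_pow, one_pow, inv_inv, Matrix.cons_val_zero, Matrix.cons_val_one,
      Matrix.cons_val, *] <;>
    field_simp <;> ring

/-- The numerator and the denominator of the contraction of `E(z) F(w)` vanish at `u = α⁻¹` and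
`u = β⁻¹` with `(α, β) = edgeRoots`. -/
def edgeRoots (lq : ℂ) (k : ℝ) : Bool → Bool → ℂ × ℂ
  | true, true => (qpow lq (k + 2), qpow lq k)
  | true, false => (0, 0)
  | false, true => (0, 0)
  | false, false => ((qpow lq (k + 2))⁻¹, (qpow lq k)⁻¹)

/-- The `a_0` part `[2m] / (m [km])` and the leading `a_2` part are opposite, so no infinite product
is left. The half-sums leave a rational function for like terms and nothing for unlike ones. -/
theorem expSeriesEq_E_F (b b' : Bool) :
    ExpSeriesEq (Vertex.contr ((paraVertex lq r k (-1) b).add (vertexE lq r k))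
      ((paraVertex lq r k 1 b').add (vertexF lq r k)))
    (fun u => 1 - (edgeRoots lq k b b').1 * u) (fun u => 1 - (edgeRoots lq k b b').2 * u) := by
  refine (expSeriesEq_ratio _ _).congr (fun m => ?_) (fun u => rfl) fun u => rfl
  obtain ⟨g, h, ρ, d, M, H⟩ := exists_powerValues hq hr hkr hk0 m
  obtain ⟨h1, h2, h3, h4, h5, h6, h7, h8, h9, h10, h11, h12, h13⟩ := H
  rw [vertexE, vertexF, contr_add_add]
  cases b <;> cases b' <;>
    simp only [Vertex.contr, Fin.sum_univ_three, paraVertex, commCoeff_zero, commCoeff_one,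
      commCoeff_two, edgeRoots, Complex.ofReal_neg, Complex.ofReal_one, neg_neg, one_mul, neg_mul,
      inv_pow, Matrix.cons_val_zero, Matrix.cons_val_one,
      Matrix.cons_val, *] <;>
    field_simp <;> ring

/-- Negating both flags inverts the non-zero roots: up to a constant this is the contraction of the
opposite order as a function of `u⁻¹`. -/
theorem expSeriesEq_F_E (b b' : Bool) :
    ExpSeriesEq (Vertex.contr ((paraVertex lq r k 1 b').add (vertexF lq r k))
      ((paraVertex lq r k (-1) b).add (vertexE lq r k)))
    (fun u => 1 - (edgeRoots lq k (!b) (!b')).1 * u)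
    (fun u => 1 - (edgeRoots lq k (!b) (!b')).2 * u) := by
  refine (expSeriesEq_ratio _ _).congr (fun m => ?_) (fun u => rfl) fun u => rfl
  obtain ⟨g, h, ρ, d, M, H⟩ := exists_powerValues hq hr hkr hk0 m
  obtain ⟨h1, h2, h3, h4, h5, h6, h7, h8, h9, h10, h11, h12, h13⟩ := H
  rw [vertexE, vertexF, contr_add_add]
  cases b <;> cases b' <;>
    simp only [Vertex.contr, Fin.sum_univ_three, paraVertex, commCoeff_zero, commCoeff_one,
      commCoeff_two, edgeRoots, Complex.ofReal_neg, Complex.ofReal_one, neg_neg, one_mul, neg_mul,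
      inv_pow, Matrix.cons_val_zero, Matrix.cons_val_one,
      Matrix.cons_val, Bool.not_true, Bool.not_false, *] <;>
    field_simp <;> ring

end contractions

/-! ### The exchange relations -/

theorem theta_mul (s a u : ℂ) :
    theta s (a * u) = poch s (a * u) * poch s (s * a⁻¹ * u⁻¹) * poch s s := by
  rw [theta, div_eq_mul_inv, mul_inv, mul_assoc s]

theorem exp_sub_swap (ζ ω : ℂ) : Complex.exp (ζ - ω) = (Complex.exp (ω - ζ))⁻¹ := by
  rw [← Complex.exp_neg, neg_sub]

theorem exp_mul_eq_exp_mul_sub (Z ζ ω : ℂ) :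
    Complex.exp (Z * ζ) = Complex.exp (Z * (ζ - ω)) * Complex.exp (Z * ω) := by
  rw [← Complex.exp_add]; congr 1; ring

theorem differentiable_poch_mul {s : ℂ} (hs : ‖s‖ < 1) (a : ℂ) :
    Differentiable ℂ fun u => poch s (a * u) :=
  (differentiable_poch hs).comp (by fun_prop)

theorem differentiable_xiNum {p q : ℂ} (hp : ‖p‖ < 1) (hq : ‖q ^ 4‖ < 1) :
    Differentiable ℂ fun u => xiNum p q u :=
  ((differentiable_poch₂ hp hq).comp (by fun_prop : Differentiable ℂ fun u => q ^ 2 * u)).mul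
    ((differentiable_poch₂ hp hq).comp (by fun_prop : Differentiable ℂ fun u => p * q ^ 2 * u))

theorem differentiable_xiDen {p q : ℂ} (hp : ‖p‖ < 1) (hq : ‖q ^ 4‖ < 1) :
    Differentiable ℂ fun u => xiDen p q u :=
  ((differentiable_poch₂ hp hq).comp (by fun_prop : Differentiable ℂ fun u => q ^ 4 * u)).mul
    ((differentiable_poch₂ hp hq).comp (by fun_prop : Differentiable ℂ fun u => p * u))

@[simp]
theorem xiNum_zero (p q : ℂ) : xiNum p q 0 = 1 := by simp [xiNum]

@[simp]
theorem xiDen_zero (p q : ℂ) : xiDen p q 0 = 1 := by simp [xiDen]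

theorem zeroVertexK_bounded {lq : ℂ} (hq : ‖Complex.exp lq‖ < 1) {r k : ℝ} (hr : 0 < r)
    (hkr : k < r) : (vertexK lq r k).Bounded := by
  have h2 := geomBounded_inv_brk hq (x := 2) two_ne_zero
  rw [Complex.ofReal_ofNat] at h2
  refine zeroVertex_bounded hq hkr _ ((geomBounded_brk _).div ?_)
  simp only [mul_inv]
  exact h2.mul (geomBounded_inv_brk hq hr.ne')

theorem addVertexE_bounded {lq : ℂ} (hq : ‖Complex.exp lq‖ < 1) {r k : ℝ} (hkr : k < r)
    (hk0 : k ≠ 0) (b : Bool) : ((paraVertex lq r k (-1) b).add (vertexE lq r k)).Bounded :=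
  (paraVertex_bounded hq hkr hk0 _ b).add
    (zeroVertex_bounded hq hkr _ (geomBounded_inv_brk hq hk0))

theorem addVertexF_bounded {lq : ℂ} (hq : ‖Complex.exp lq‖ < 1) {r k : ℝ} (hr : 0 < r)
    (hkr : k < r) (hk0 : k ≠ 0) (b : Bool) :
    ((paraVertex lq r k 1 b).add (vertexF lq r k)).Bounded :=
  (paraVertex_bounded hq hkr hk0 _ b).add
    (zeroVertex_bounded hq hkr _ ((geomBounded_inv_brk hq hk0).mul
      ((geomBounded_brk _).div (geomBounded_inv_brk hq hr.ne'))).neg)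

/-- The constants `κ` or `κ⁻¹` from the zero modes compensate the different numerators, so all four
pairs of terms obey one relation. -/
theorem paraRoot_exchange {κ u : ℂ} (hκ : κ ≠ 0) (hu : u ≠ 0) (b b' : Bool) :
    (if b then κ else κ⁻¹) * ((1 - paraRoot (κ ^ 2) b b' * u) * (1 - κ ^ 2 * u⁻¹)) =
      κ ^ 2 * (if b' then κ else κ⁻¹) *
        ((1 - (κ ^ 2)⁻¹ * u) * (1 - paraRoot (κ ^ 2) b' b * u⁻¹)) := by
  cases b <;> cases b' <;> simp only [paraRoot, if_true, Bool.false_eq_true, if_false] <;>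
    field_simp <;> ring

/-- The functional equation behind the exchange relations of `E` and of `F`. -/
theorem theta_exchange {s κ : ℂ} (hs : ‖s‖ < 1) (hκ : κ ≠ 0) (Z ζ ω : ℂ) (b b' : Bool) :
    theta s (κ ^ 2 * Complex.exp (ω - ζ)) *
      (Complex.exp (Z * ζ) * (if b then κ else κ⁻¹) *
        ((1 - paraRoot (κ ^ 2) b b' * Complex.exp (ω - ζ)) *
          poch s (s * (κ ^ 2)⁻¹ * Complex.exp (ω - ζ))) *
        ((1 - κ ^ 2 * Complex.exp (ζ - ω)) * poch s (s * κ ^ 2 * Complex.exp (ζ - ω)))) =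
    κ ^ 2 * Complex.exp (Z * (ζ - ω)) * theta s ((κ ^ 2)⁻¹ * Complex.exp (ω - ζ)) *
      (Complex.exp (Z * ω) * (if b' then κ else κ⁻¹) *
        ((1 - paraRoot (κ ^ 2) b' b * Complex.exp (ζ - ω)) *
          poch s (s * (κ ^ 2)⁻¹ * Complex.exp (ζ - ω))) *
        ((1 - κ ^ 2 * Complex.exp (ω - ζ)) * poch s (s * κ ^ 2 * Complex.exp (ω - ζ)))) := by
  rw [exp_mul_eq_exp_mul_sub Z ζ ω, exp_sub_swap ζ ω, theta_mul, theta_mul, inv_inv,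
    poch_eq_mul hs (κ ^ 2 * _), poch_eq_mul hs ((κ ^ 2)⁻¹ * _)]
  set u := Complex.exp (ω - ζ) with hu
  have key := paraRoot_exchange hκ (u := u) (Complex.exp_ne_zero _) b b'
  have e1 : s * (κ ^ 2 * u) = s * κ ^ 2 * u := by ring
  have e2 : s * ((κ ^ 2)⁻¹ * u) = s * (κ ^ 2)⁻¹ * u := by ring
  rw [e1, e2]
  -- Every infinite product occurs on both sides, once the first factor of each Pochhammer symbol at
  -- `κ ^ 2 u` and `(κ ^ 2)⁻¹ u` has been split off; the split factors enter `key`.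
  linear_combination (1 - κ ^ 2 * u) * poch s (s * κ ^ 2 * u) * poch s (s * (κ ^ 2)⁻¹ * u⁻¹) *
    poch s s * Complex.exp (Z * (ζ - ω)) * Complex.exp (Z * ω) *
    poch s (s * (κ ^ 2)⁻¹ * u) * poch s (s * κ ^ 2 * u⁻¹) * key

theorem qpow_two_mul (lq x : ℂ) : qpow lq (2 * x) = qpow lq x * qpow lq x := by
  rw [two_mul, qpow_add]

section exchange

variable {lq : ℂ} (hq : ‖Complex.exp lq‖ < 1) {r k : ℝ} (hr : 0 < r) (hkr : k < r) (hk0 : k ≠ 0)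
include hq hr hkr hk0

omit hq hkr in
theorem zeroPow_K_K : Vertex.zeroPow k (vertexK lq r k) (vertexK lq r k) =
    k / (2 * r * (r - k)) := by
  have hr' : (r : ℂ) ≠ 0 := by exact_mod_cast hr.ne'
  have hk : (k : ℂ) ≠ 0 := by exact_mod_cast hk0
  rw [vertexK, zeroPow_zero_zero, chargeK_eq hr hk0]
  linear_combination (norm := skip) (k / (2 * r) : ℂ) ^ 2 * chargeE_mul_self (r := r) hk0
  field_simp
  ring

theorem exchange_K_K : Exchange (currentK lq r k) (currentK lq r k)
    (fun ζ ω => Complex.exp (k / (2 * r * (r - k)) * (ζ - ω)) *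
      (xiNum (qpow lq (2 * r)) (qpow lq 1) (Complex.exp (ω - ζ)) *
        xiDen (qpow lq (2 * (r - k))) (qpow lq 1) (Complex.exp (ω - ζ))) *
      (xiNum (qpow lq (2 * (r - k))) (qpow lq 1) (Complex.exp (ζ - ω)) *
        xiDen (qpow lq (2 * r)) (qpow lq 1) (Complex.exp (ζ - ω))))
    (fun ζ ω => (xiDen (qpow lq (2 * r)) (qpow lq 1) (Complex.exp (ω - ζ)) *
        xiNum (qpow lq (2 * (r - k))) (qpow lq 1) (Complex.exp (ω - ζ))) *
      (xiDen (qpow lq (2 * (r - k))) (qpow lq 1) (Complex.exp (ζ - ω)) *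
        xiNum (qpow lq (2 * r)) (qpow lq 1) (Complex.exp (ζ - ω)))) := by
  have hp := norm_p_lt_one hq hr
  have hps := norm_ps_lt_one hq hkr
  have h4 := norm_q_pow_four_lt_one hq
  have hK : ∀ ζ i j, currentK lq r k ζ i j =
      ∑ p : Unit, (fun _ => 1) p * ((fun _ => vertexK lq r k) p).op k ζ i j := fun ζ i j => by
    simp [currentK_eq_op]
  have hB := zeroVertexK_bounded hq hr hkr
  have hZ := zeroPow_K_K (lq := lq) hr hk0
  have hN := (differentiable_xiNum hp h4).mul (differentiable_xiDen hps h4)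
  have hD := (differentiable_xiDen hp h4).mul (differentiable_xiNum hps h4)
  have h := expSeriesEq_K_K hq hr hkr hk0
  refine exchange_of_vertices k hK hK (fun _ => hB) (fun _ => hB) (fun _ _ => hZ) (fun _ _ => hZ)
    (fun _ _ => hN) (fun _ _ => hN) hD hD (by simp) (by simp) (fun _ _ => h) (fun _ _ => h) _ _ ?_
  intro _ _ ζ ω
  simp only [vertexK, zeroConst_zero, add_zero, Pi.mul_apply]
  rw [exp_mul_eq_exp_mul_sub _ ζ ω]
  ring

theorem exchange_K_E : Exchange (currentK lq r k) (currentE lq r k)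
    (fun ζ ω => Complex.exp (1 / (r - k) * (ζ - ω)) *
      theta (qpow lq (2 * (r - k))) (qpow lq (-1) * qpow lq (r - k) * Complex.exp (ω - ζ)))
    (fun ζ ω =>
      theta (qpow lq (2 * (r - k))) (qpow lq 1 * qpow lq (r - k) * Complex.exp (ω - ζ))) := by
  have hps := norm_ps_lt_one hq hkr
  have hK : ∀ ζ i j, currentK lq r k ζ i j =
      ∑ p : Unit, (fun _ => 1) p * ((fun _ => vertexK lq r k) p).op k ζ i j := fun ζ i j => by
    simp [currentK_eq_op]
  have hZ : chargeE r k * (k / (2 * r)) * chargeE r k = 1 / (r - k) := by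
    have hr' : (r : ℂ) ≠ 0 := by exact_mod_cast hr.ne'
    have hk : (k : ℂ) ≠ 0 := by exact_mod_cast hk0
    linear_combination (norm := skip) (k / (2 * r) : ℂ) * chargeE_mul_self (r := r) hk0
    field_simp
    ring
  have h := expSeriesEq_K_zeroE hq hr hkr hk0
  refine exchange_of_vertices k hK (currentE_eq_sum hq r k)
    (fun _ => zeroVertexK_bounded hq hr hkr) (addVertexE_bounded hq hkr hk0)
    (Z := 1 / (r - k)) (Z' := 1 / (r - k)) (fun _ b => ?_) (fun b _ => ?_)
    (fun _ _ => differentiable_poch_mul hps (qpow lq (-1) * qpow lq (r - k)))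
    (fun _ _ => differentiable_poch_mul hps (qpow lq (-1) * qpow lq (r - k)))
    (differentiable_poch_mul hps (qpow lq 1 * qpow lq (r - k)))
    (differentiable_poch_mul hps (qpow lq 1 * qpow lq (r - k))) (by simp) (by simp)
    (fun _ b => ?_) (fun b _ => ?_) _ _ ?_
  · rw [vertexK, vertexE, zeroPow_zero_add, chargeK_eq hr hk0]; exact hZ
  · rw [vertexK, vertexE, zeroPow_add_zero, chargeK_eq hr hk0]; exact hZ
  · refine h.congr (fun m => ?_) (fun _ => rfl) fun _ => rfl
    rw [vertexK, vertexE, contr_zero_add]; rfl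
  · refine h.congr (fun m => ?_) (fun _ => rfl) fun _ => rfl
    rw [vertexK, vertexE, contr_add_zero]; rfl
  · intro _ b ζ ω
    simp only [vertexK, vertexE, zeroConst_zero, zeroConst_add_zero, add_zero]
    rw [exp_mul_eq_exp_mul_sub _ ζ ω, theta_mul, theta_mul, exp_sub_swap ζ ω, qpow_two_mul, qpow_neg]
    have h1 := qpow_ne_zero lq (r - k)
    -- Since `p* = (q ^ (r - k)) ^ 2`, the second Pochhammer factor of each theta function is the
    -- one from the contraction in the opposite order.
    have e : ∀ a : ℂ, qpow lq (r - k) * qpow lq (r - k) * (a * qpow lq (r - k))⁻¹ =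
        a⁻¹ * qpow lq (r - k) := fun a => by rw [mul_inv]; field_simp
    simp only [e, inv_inv]
    ring

theorem exchange_K_F : Exchange (currentK lq r k) (currentF lq r k)
    (fun ζ ω => Complex.exp (-(1 / r) * (ζ - ω)) *
      theta (qpow lq (2 * r)) (qpow lq 1 * qpow lq r * Complex.exp (ω - ζ)))
    (fun ζ ω =>
      theta (qpow lq (2 * r)) (qpow lq (-1) * qpow lq r * Complex.exp (ω - ζ))) := by
  have hp := norm_p_lt_one hq hr
  have hK : ∀ ζ i j, currentK lq r k ζ i j =
      ∑ p : Unit, (fun _ => 1) p * ((fun _ => vertexK lq r k) p).op k ζ i j := fun ζ i j => by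
    simp [currentK_eq_op]
  have hZ : chargeE r k * (k / (2 * r)) * -(chargeE r k * ((r - k) / r)) = -(1 / r) := by
    have hr' : (r : ℂ) ≠ 0 := by exact_mod_cast hr.ne'
    have hk : (k : ℂ) ≠ 0 := by exact_mod_cast hk0
    have hrk : (r : ℂ) - k ≠ 0 := by rw [← Complex.ofReal_sub]; exact_mod_cast (sub_pos.2 hkr).ne'
    linear_combination (norm := skip)
      -((k / (2 * r) : ℂ) * ((r - k) / r)) * chargeE_mul_self (r := r) hk0
    field_simp
    ring
  have h := expSeriesEq_K_zeroF hq hr hkr hk0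
  refine exchange_of_vertices k hK (currentF_eq_sum hq r k)
    (fun _ => zeroVertexK_bounded hq hr hkr) (addVertexF_bounded hq hr hkr hk0)
    (Z := -(1 / r)) (Z' := -(1 / r)) (fun _ b => ?_) (fun b _ => ?_)
    (fun _ _ => differentiable_poch_mul hp (qpow lq 1 * qpow lq r))
    (fun _ _ => differentiable_poch_mul hp (qpow lq 1 * qpow lq r))
    (differentiable_poch_mul hp (qpow lq (-1) * qpow lq r))
    (differentiable_poch_mul hp (qpow lq (-1) * qpow lq r)) (by simp) (by simp)
    (fun _ b => ?_) (fun b _ => ?_) _ _ ?_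
  · rw [vertexK, vertexF, zeroPow_zero_add, chargeK_eq hr hk0, chargeF_eq hr hkr hk0]; exact hZ
  · rw [vertexK, vertexF, zeroPow_add_zero, chargeK_eq hr hk0, chargeF_eq hr hkr hk0]; exact hZ
  · refine h.congr (fun m => ?_) (fun _ => rfl) fun _ => rfl
    rw [vertexK, vertexF, contr_zero_add]; rfl
  · refine h.congr (fun m => ?_) (fun _ => rfl) fun _ => rfl
    rw [vertexK, vertexF, contr_add_zero]; rfl
  · intro _ b ζ ω
    simp only [vertexK, vertexF, zeroConst_zero, zeroConst_add_zero, add_zero]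
    rw [exp_mul_eq_exp_mul_sub _ ζ ω, theta_mul, theta_mul, exp_sub_swap ζ ω, qpow_two_mul, qpow_neg]
    have h1 := qpow_ne_zero lq r
    have e : ∀ a : ℂ, qpow lq r * qpow lq r * (a * qpow lq r)⁻¹ = a⁻¹ * qpow lq r := fun a => by
      rw [mul_inv]; field_simp
    simp only [e, inv_inv]
    ring

theorem exchange_E_E : Exchange (currentE lq r k) (currentE lq r k)
    (fun ζ ω => qpow lq 2 * Complex.exp (2 / (r - k) * (ζ - ω)) *
      theta (qpow lq (2 * (r - k))) (qpow lq (-2) * Complex.exp (ω - ζ)))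
    (fun ζ ω => theta (qpow lq (2 * (r - k))) (qpow lq 2 * Complex.exp (ω - ζ))) := by
  have hps := norm_ps_lt_one hq hkr
  have hZ : chargeE r k * chargeE r k - 2 * ((-1 : ℝ) : ℂ) * ((-1 : ℝ) : ℂ) / k = 2 / (r - k) := by
    have hk : (k : ℂ) ≠ 0 := by exact_mod_cast hk0
    have hrk : (r : ℂ) - k ≠ 0 := by rw [← Complex.ofReal_sub]; exact_mod_cast (sub_pos.2 hkr).ne'
    rw [chargeE_mul_self hk0]
    push_cast
    field_simp
    ring
  have hpow : ∀ b b', Vertex.zeroPow k ((paraVertex lq r k (-1) b).add (vertexE lq r k))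
      ((paraVertex lq r k (-1) b').add (vertexE lq r k)) = 2 / (r - k) := fun b b' => by
    rw [vertexE, zeroPow_add_add lq r hk0]; exact hZ
  have hconst : ∀ b b', Complex.exp (Vertex.zeroConst k
      ((paraVertex lq r k (-1) b).add (vertexE lq r k))
      ((paraVertex lq r k (-1) b').add (vertexE lq r k))) =
      if b then qpow lq 1 else (qpow lq 1)⁻¹ := fun b b' => by
    rw [vertexE, zeroConst_add_add lq r hk0, ← qpow_neg]
    cases b <;> simp [qpow]
  have h2 : qpow lq 2 = qpow lq 1 ^ 2 := by rw [← qpow_mul_nat]; norm_num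
  refine exchange_of_vertices k (currentE_eq_sum hq r k) (currentE_eq_sum hq r k)
    (addVertexE_bounded hq hkr hk0) (addVertexE_bounded hq hkr hk0) hpow hpow
    (fun _ _ => .mul (by fun_prop) (differentiable_poch_mul hps _))
    (fun _ _ => .mul (by fun_prop) (differentiable_poch_mul hps _))
    (.mul (by fun_prop) (differentiable_poch_mul hps _))
    (.mul (by fun_prop) (differentiable_poch_mul hps _)) (by simp) (by simp)
    (expSeriesEq_E_E hq hr hkr hk0) (expSeriesEq_E_E hq hr hkr hk0) _ _ ?_
  intro b b' ζ ω
  rw [Complex.exp_add, Complex.exp_add, hconst, hconst, qpow_neg, h2]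
  exact theta_exchange hps (qpow_ne_zero _ _) _ ζ ω b b'

theorem exchange_F_F : Exchange (currentF lq r k) (currentF lq r k)
    (fun ζ ω => qpow lq (-2) * Complex.exp (-(2 / r) * (ζ - ω)) *
      theta (qpow lq (2 * r)) (qpow lq 2 * Complex.exp (ω - ζ)))
    (fun ζ ω => theta (qpow lq (2 * r)) (qpow lq (-2) * Complex.exp (ω - ζ))) := by
  have hp := norm_p_lt_one hq hr
  have hZ : -(chargeE r k * ((r - k) / r)) * -(chargeE r k * ((r - k) / r)) -
      2 * ((1 : ℝ) : ℂ) * ((1 : ℝ) : ℂ) / k = -(2 / r) := by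
    have hr' : (r : ℂ) ≠ 0 := by exact_mod_cast hr.ne'
    have hk : (k : ℂ) ≠ 0 := by exact_mod_cast hk0
    have hrk : (r : ℂ) - k ≠ 0 := by rw [← Complex.ofReal_sub]; exact_mod_cast (sub_pos.2 hkr).ne'
    push_cast
    linear_combination (norm := skip) (((r : ℂ) - k) / r) ^ 2 * chargeE_mul_self (r := r) hk0
    field_simp
    ring
  have hpow : ∀ b b', Vertex.zeroPow k ((paraVertex lq r k 1 b).add (vertexF lq r k))
      ((paraVertex lq r k 1 b').add (vertexF lq r k)) = -(2 / r) := fun b b' => by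
    rw [vertexF, zeroPow_add_add lq r hk0, chargeF_eq hr hkr hk0]; exact hZ
  have hconst : ∀ b b', Complex.exp (Vertex.zeroConst k
      ((paraVertex lq r k 1 b).add (vertexF lq r k))
      ((paraVertex lq r k 1 b').add (vertexF lq r k))) =
      if b then (qpow lq 1)⁻¹ else ((qpow lq 1)⁻¹)⁻¹ := fun b b' => by
    rw [vertexF, zeroConst_add_add lq r hk0, ← qpow_neg, ← qpow_neg]
    cases b <;> simp [qpow]
  have h2 : (qpow lq 2)⁻¹ = (qpow lq 1)⁻¹ ^ 2 := by rw [inv_pow, ← qpow_mul_nat]; norm_num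
  have h3 : qpow lq 2 = ((qpow lq 1)⁻¹ ^ 2)⁻¹ := by rw [← h2, inv_inv]
  refine exchange_of_vertices k (currentF_eq_sum hq r k) (currentF_eq_sum hq r k)
    (addVertexF_bounded hq hr hkr hk0) (addVertexF_bounded hq hr hkr hk0) hpow hpow
    (fun _ _ => .mul (by fun_prop) (differentiable_poch_mul hp _))
    (fun _ _ => .mul (by fun_prop) (differentiable_poch_mul hp _))
    (.mul (by fun_prop) (differentiable_poch_mul hp _))
    (.mul (by fun_prop) (differentiable_poch_mul hp _)) (by simp) (by simp)
    (expSeriesEq_F_F hq hr hkr hk0) (expSeriesEq_F_F hq hr hkr hk0) _ _ ?_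
  intro b b' ζ ω
  rw [Complex.exp_add, Complex.exp_add, hconst, hconst, qpow_neg, h2, h3]
  -- The relation for `F` is the one for `E` with `κ = q⁻¹` in place of `q` and the nome `p` in
  -- place of `p*`.
  exact theta_exchange hp (inv_ne_zero (qpow_ne_zero _ _)) _ ζ ω b b'

end exchange

/-! ### The currents `H^±` -/

/-- Zeros of a non-zero entire function are isolated, and this one is non-zero because its argument
can be made as close to `0` as desired. -/
theorem eventually_comp_exp_sub_ne_zero {G : ℂ → ℂ} (hG : Differentiable ℂ G) (h0 : G 0 ≠ 0)
    (x y : ℂ) : ∀ᶠ y' in 𝓝[≠] y, G (Complex.exp (y' - x)) ≠ 0 := by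
  have hd : Differentiable ℂ fun y' => G (Complex.exp (y' - x)) :=
    hG.comp (by fun_prop : Differentiable ℂ fun y' => Complex.exp (y' - x))
  rcases (hd.analyticAt y).eventually_eq_zero_or_eventually_ne_zero with h | h
  · exfalso
    have h1 := AnalyticOnNhd.eqOn_zero_of_preconnected_of_eventuallyEq_zero
      (fun z _ => hd.analyticAt z) isPreconnected_univ (Set.mem_univ y) h
    obtain ⟨R, hR⟩ := exists_exp_eq_of_eventually (hG.continuous.continuousAt.eventually_ne h0)
    refine hR ((-R - 1 : ℝ)) (by simp) ?_
    simpa using h1 (Set.mem_univ (x + ((-R - 1 : ℝ) : ℂ)))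
  · exact h

/-- The current `H^±(z)`, `ε = ±1`. -/
def currentH (lq : ℂ) (r k ε : ℝ) (ζ : ℂ) : Op State :=
  (vertexK lq r k).op₂ k (vertexK lq r k) (ζ + (ε * (r - k / 2) + 1) * lq)
    (ζ + (ε * (r - k / 2) - 1) * lq)

/-- The contraction of `k(x) k(y')` is `x ^ (k / (2 r (r - k)))` times `ξ(y'/x; p, q) / ξ(y'/x; p*,
q)`. The prefactor of `H^±` is its inverse, so off the isolated zeros only the entire normal ordered
product is left, and the limit is its value. -/
theorem isH_currentH {lq : ℂ} (hq : ‖Complex.exp lq‖ < 1) {r k : ℝ} (hr : 0 < r) (hkr : k < r)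
    (hk0 : k ≠ 0) (ε : ℝ) : IsH lq r k (currentK lq r k) ε (currentH lq r k ε) := by
  have hp := norm_p_lt_one hq hr
  have hps := norm_ps_lt_one hq hkr
  have h4 := norm_q_pow_four_lt_one hq
  have hK : ∀ ζ i j, currentK lq r k ζ i j =
      ∑ p : Unit, (fun _ => 1) p * ((fun _ => vertexK lq r k) p).op k ζ i j := fun ζ i j => by
    simp [currentK_eq_op]
  have hB := zeroVertexK_bounded hq hr hkr
  have hD := (differentiable_xiDen hp h4).mul (differentiable_xiNum hps h4)
  have hD0 : xiDen (qpow lq (2 * r)) (qpow lq 1) 0 * xiNum (qpow lq (2 * (r - k))) (qpow lq 1) 0 ≠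
    0 := by simp
  obtain ⟨R, hR⟩ := isContinuation_of_vertices k hK hK (fun _ => hB) (fun _ => hB)
    (fun _ _ => zeroPow_K_K hr hk0)
    (fun _ _ => (differentiable_xiNum hp h4).mul (differentiable_xiDen hps h4)) hD hD0
    (fun _ _ => expSeriesEq_K_K hq hr hkr hk0)
  refine ⟨R, fun i j => ?_⟩
  obtain ⟨f, hf, hfn, hfd⟩ := hR R le_rfl i j
  refine ⟨f, hf, fun ζ => ?_⟩
  intro x y
  have h1 := eventually_comp_exp_sub_ne_zero (differentiable_xiNum hp h4) (by simp) x y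
  have h2 := eventually_comp_exp_sub_ne_zero (differentiable_xiDen hp h4) (by simp) x y
  have h3 := eventually_comp_exp_sub_ne_zero (differentiable_xiNum hps h4) (by simp) x y
  have h5 := eventually_comp_exp_sub_ne_zero (differentiable_xiDen hps h4) (by simp) x y
  refine ⟨?_, ?_⟩
  · filter_upwards [h2, h3] with y' h2 h3
    rw [hfd]
    exact mul_ne_zero h2 h3
  · have hc : Tendsto (fun y' => (vertexK lq r k).op₂ k (vertexK lq r k) x y' i j) (𝓝[≠] y)
        (𝓝 (currentH lq r k ε ζ i j)) := by
      have hd := Vertex.differentiable_op₂ k (vertexK lq r k) (vertexK lq r k) i j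
      have := hd.continuous.comp (by fun_prop : Continuous fun y' : ℂ => (x, y'))
      exact (this.tendsto y).mono_left nhdsWithin_le_nhds
    refine hc.congr' ?_
    filter_upwards [h1, h2, h3, h5] with y' h1 h2 h3 h5
    rw [hfn, hfd]
    simp only [Finset.univ_unique, Finset.sum_singleton, vertexK, zeroConst_zero, add_zero,
      Pi.mul_apply, xi, neg_mul, Complex.exp_neg]
    have := Complex.exp_ne_zero (k / (2 * r * (r - k)) * x)
    field_simp

theorem exp_nat_mul_add (lq ζ c : ℂ) (m : ℕ) :
    Complex.exp (m * (ζ + c * lq)) = Complex.exp (m * ζ) * qpow lq c ^ m := by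
  rw [mul_add, Complex.exp_add, qpow, ← Complex.exp_nat_mul]

theorem exp_neg_nat_mul_add (lq ζ c : ℂ) (m : ℕ) :
    Complex.exp (-(m * (ζ + c * lq))) = Complex.exp (-(m * ζ)) * (qpow lq c ^ m)⁻¹ := by
  rw [Complex.exp_neg, exp_nat_mul_add, mul_inv, Complex.exp_neg]

theorem gaussOp_congr {k : ℝ} {Q Q' P P' : Fin 3 → ℂ} {x x' y y' : Osc → ℂ} (hQ : Q = Q')
    (hP : P = P') (hx : x = x') (hy : y = y') : gaussOp k Q P x y = gaussOp k Q' P' x' y' := by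
  rw [hQ, hP, hx, hy]

theorem vertexE_eq (lq : ℂ) (r k : ℝ) : vertexE lq r k =
    zeroVertex lq r k (chargeE r k) fun m => (brk lq (qpow lq k ^ (m : ℕ)))⁻¹ := rfl

theorem vertexF_eq (lq : ℂ) {r k : ℝ} (hr : 0 < r) (hkr : k < r) (hk0 : k ≠ 0) : vertexF lq r k =
    zeroVertex lq r k (-(chargeE r k * ((r - k) / r))) fun m =>
      -((brk lq (qpow lq k ^ (m : ℕ)))⁻¹ *
        (brk lq (qpow lq (r - k) ^ (m : ℕ)) / brk lq (qpow lq r ^ (m : ℕ)))) := by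
  rw [vertexF, chargeF_eq hr hkr hk0]

theorem vertexK_eq (lq : ℂ) {r k : ℝ} (hr : 0 < r) (hk0 : k ≠ 0) : vertexK lq r k =
    zeroVertex lq r k (chargeE r k * (k / (2 * r))) fun m =>
      brk lq (qpow lq 1 ^ (m : ℕ)) /
        (brk lq (qpow lq 2 ^ (m : ℕ)) * brk lq (qpow lq r ^ (m : ℕ))) := by
  rw [vertexK, chargeK_eq hr hk0]

/-! ### Fusion of `E` and `F` into `H^±` at the poles of their contraction -/

section fusion

variable {lq : ℂ} (hq : ‖Complex.exp lq‖ < 1) {r k : ℝ} (hr : 0 < r) (hkr : k < r) (hk0 : k ≠ 0)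
include hq hr hkr hk0

/-- At `w = q ^ (-k) z` the contributions of `a_1` and `a_2` from the two parafermion terms cancel.
The `a_0` contributions recombine to two copies of `k` at `q ^ (r - k ± 1) z`. -/
theorem op₂_true_eq_currentH (ζ : ℂ) :
    ((paraVertex lq r k (-1) true).add (vertexE lq r k)).op₂ k
      ((paraVertex lq r k 1 true).add (vertexF lq r k)) ζ (ζ + (-k) * lq) =
    currentH lq r k 1 (ζ + (-(k / 2)) * lq) := by
  have hr' : (r : ℂ) ≠ 0 := by exact_mod_cast hr.ne'
  have hk : (k : ℂ) ≠ 0 := by exact_mod_cast hk0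
  have ex : ζ + -(k / 2) * lq + (((1 : ℝ) : ℂ) * (r - k / 2) + 1) * lq =
      ζ + ((r - k) + 1) * lq := by push_cast; ring
  have ey : ζ + -(k / 2) * lq + (((1 : ℝ) : ℂ) * (r - k / 2) - 1) * lq =
      ζ + ((r - k) + (-1)) * lq := by push_cast; ring
  rw [currentH, Vertex.op₂, Vertex.op₂, ex, ey, vertexE_eq, vertexF_eq lq hr hkr hk0,
    vertexK_eq lq hr hk0]
  refine gaussOp_congr ?_ ?_ ?_ ?_
  · funext j
    fin_cases j <;> simp [Vertex.add, paraVertex, zeroVertex, neg_div]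
    field_simp
    ring
  · funext j
    fin_cases j <;> simp [Vertex.add, paraVertex, zeroVertex, neg_div] <;> field_simp <;> ring
  · funext ⟨j, m⟩
    obtain ⟨g, h, ρ, d, M, H⟩ := exists_powerValues hq hr hkr hk0 m
    obtain ⟨h1, h2, h3, h4, h5, h6, h7, h8, h9, h10, h11, h12, h13⟩ := H
    simp only [Pi.add_apply, exp_nat_mul_add, qpow_add lq (r - k), mul_pow, *]
    fin_cases j <;>
      simp only [Vertex.add, paraVertex, zeroVertex, Pi.add_apply, Complex.ofReal_neg,
        Complex.ofReal_one, neg_neg, one_mul, neg_mul, Matrix.cons_val_zero, Matrix.cons_val_one,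
        Matrix.cons_val, Fin.zero_eta, Fin.mk_one, Fin.reduceFinMk, *] <;>
      field_simp <;> ring
  · funext ⟨j, m⟩
    obtain ⟨g, h, ρ, d, M, H⟩ := exists_powerValues hq hr hkr hk0 m
    obtain ⟨h1, h2, h3, h4, h5, h6, h7, h8, h9, h10, h11, h12, h13⟩ := H
    simp only [Pi.add_apply, exp_neg_nat_mul_add, qpow_add lq (r - k), mul_pow, *]
    fin_cases j <;>
      simp only [Vertex.add, paraVertex, zeroVertex, Pi.add_apply, Complex.ofReal_neg,
        Complex.ofReal_one, neg_neg, one_mul, neg_mul, Matrix.cons_val_zero, Matrix.cons_val_one,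
        Matrix.cons_val, Fin.zero_eta, Fin.mk_one, Fin.reduceFinMk, *] <;>
      field_simp <;> ring

/-- The mirror image at `z = q ^ (-k) w`: again only `a_0` survives, now as two copies of `k` at `q
^ (-r ± 1) w`. -/
theorem op₂_false_eq_currentH (ζ : ℂ) :
    ((paraVertex lq r k (-1) false).add (vertexE lq r k)).op₂ k
      ((paraVertex lq r k 1 false).add (vertexF lq r k)) (ζ + (-k) * lq) ζ =
    currentH lq r k (-1) (ζ + (-(k / 2)) * lq) := by
  have hr' : (r : ℂ) ≠ 0 := by exact_mod_cast hr.ne'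
  have hk : (k : ℂ) ≠ 0 := by exact_mod_cast hk0
  have ex : ζ + -(k / 2) * lq + (((-1 : ℝ) : ℂ) * (r - k / 2) + 1) * lq =
      ζ + (-r + 1) * lq := by push_cast; ring
  have ey : ζ + -(k / 2) * lq + (((-1 : ℝ) : ℂ) * (r - k / 2) - 1) * lq =
      ζ + (-r + (-1)) * lq := by push_cast; ring
  rw [currentH, Vertex.op₂, Vertex.op₂, ex, ey, vertexE_eq, vertexF_eq lq hr hkr hk0,
    vertexK_eq lq hr hk0]
  refine gaussOp_congr ?_ ?_ ?_ ?_
  · funext j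
    fin_cases j <;> simp [Vertex.add, paraVertex, zeroVertex, neg_div]
    field_simp
    ring
  · funext j
    fin_cases j <;> simp [Vertex.add, paraVertex, zeroVertex, neg_div] <;> field_simp <;> ring
  · funext ⟨j, m⟩
    obtain ⟨g, h, ρ, d, M, H⟩ := exists_powerValues hq hr hkr hk0 m
    obtain ⟨h1, h2, h3, h4, h5, h6, h7, h8, h9, h10, h11, h12, h13⟩ := H
    simp only [Pi.add_apply, exp_nat_mul_add, qpow_add lq (-r), qpow_neg lq r, inv_pow, mul_pow, *]
    fin_cases j <;>
      simp only [Vertex.add, paraVertex, zeroVertex, Pi.add_apply, Complex.ofReal_neg,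
        Complex.ofReal_one, neg_neg, one_mul, neg_mul, Matrix.cons_val_zero, Matrix.cons_val_one,
        Matrix.cons_val, Fin.zero_eta, Fin.mk_one, Fin.reduceFinMk, *] <;>
      field_simp <;> ring
  · funext ⟨j, m⟩
    obtain ⟨g, h, ρ, d, M, H⟩ := exists_powerValues hq hr hkr hk0 m
    obtain ⟨h1, h2, h3, h4, h5, h6, h7, h8, h9, h10, h11, h12, h13⟩ := H
    simp only [Pi.add_apply, exp_neg_nat_mul_add, qpow_add lq (-r), qpow_neg lq r, inv_pow, mul_pow, *]
    fin_cases j <;>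
      simp only [Vertex.add, paraVertex, zeroVertex, Pi.add_apply, Complex.ofReal_neg,
        Complex.ofReal_one, neg_neg, one_mul, neg_mul, Matrix.cons_val_zero, Matrix.cons_val_one,
        Matrix.cons_val, Fin.zero_eta, Fin.mk_one, Fin.reduceFinMk, *] <;>
      field_simp <;> ring

end fusion

/-! ### Homogeneity -/

/-- The degree of the monomial `∏ a_{j,-m} ^ ν(j,m)`, where `a_{j,-m}` has degree `m`. -/
def level (ν : Osc →₀ ℕ) : ℕ := ν.sum fun p n => (p.2 : ℕ) * n

theorem level_eq_sum {ν : Osc →₀ ℕ} {s : Finset Osc} (h : ν.support ⊆ s) :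
    level ν = ∑ p ∈ s, (p.2 : ℕ) * ν p :=
  Finsupp.sum_of_support_subset ν h _ fun _ _ => mul_zero _

theorem gaussMatrix_scale (x y : Osc → ℂ) (ζ : ℂ) (μ ν : Osc →₀ ℕ) :
    gaussMatrix (fun p => x p * Complex.exp ((p.2 : ℕ) * ζ))
      (fun p => y p * Complex.exp (-((p.2 : ℕ) * ζ))) μ ν =
    Complex.exp (((level μ : ℂ) - level ν) * ζ) * gaussMatrix x y μ ν := by
  classical
  set s := μ.support ∪ ν.support with hs
  have hμ : μ.support ⊆ s := Finset.subset_union_left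
  have hν : ν.support ⊆ s := Finset.subset_union_right
  rw [gaussMatrix_eq_prod _ _ _ _ s hμ hν, gaussMatrix_eq_prod x y _ _ s hμ hν, level_eq_sum hμ,
    level_eq_sum hν, Nat.cast_sum, Nat.cast_sum, ← Finset.sum_sub_distrib, Finset.sum_mul,
    Complex.exp_sum, ← Finset.prod_mul_distrib]
  refine Finset.prod_congr rfl fun p _ => ?_
  rw [Complex.exp_neg, gaussCoeff_scale _ _ _ (Complex.exp_ne_zero _), ← Complex.exp_int_mul]
  congr 2
  push_cast; ring

/-- The inverse of `t` enters only through the factor `(X + y + y' t⁻¹) ^ b`, so `t ^ b` clears it.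
-/
theorem exists_polynomial_gaussCoeff (x y x' y' : ℂ) (a b : ℕ) :
    ∃ P : Polynomial ℂ, P.natDegree ≤ a + b ∧ ∀ t : ℂ, t ≠ 0 →
      t ^ b * gaussCoeff (x + x' * t) (y + y' * t⁻¹) a b = P.eval t := by
  have hlin : ∀ c d : ℂ, (Polynomial.C c + Polynomial.C d * Polynomial.X).natDegree ≤ 1 :=
    fun c d => by
      refine (Polynomial.natDegree_add_le _ _).trans (max_le (by simp) ?_)
      exact (Polynomial.natDegree_C_mul_le _ _).trans Polynomial.natDegree_X_le
  induction b generalizing a with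
  | zero =>
    refine ⟨Polynomial.C ((a.factorial : ℂ)⁻¹) *
      (Polynomial.C x + Polynomial.C x' * Polynomial.X) ^ a, ?_, fun t ht => ?_⟩
    · refine (Polynomial.natDegree_C_mul_le _ _).trans ?_
      exact (Polynomial.natDegree_pow_le_of_le a (hlin x x')).trans (by simp)
    · rw [gaussCoeff_zero_right]; simp; ring
  | succ b ih =>
    obtain ⟨P, hPd, hP⟩ := ih a
    have hdeg := (Polynomial.natDegree_mul_le_of_le (hlin y' y) hPd)
    cases a with
    | zero =>
      refine ⟨_, hdeg.trans (by omega), fun t ht => ?_⟩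
      rw [Polynomial.eval_mul, ← hP t ht, gaussCoeff_zero_succ]
      simp; field_simp; ring
    | succ a =>
      obtain ⟨P', hPd', hP'⟩ := ih a
      refine ⟨Polynomial.X * P' + (Polynomial.C y' + Polynomial.C y * Polynomial.X) * P, ?_,
        fun t ht => ?_⟩
      · refine (Polynomial.natDegree_add_le _ _).trans (max_le ?_ (hdeg.trans (by omega)))
        exact (Polynomial.natDegree_mul_le_of_le Polynomial.natDegree_X_le hPd').trans (by omega)
      · rw [gaussCoeff_succ_succ, Polynomial.eval_add, Polynomial.eval_mul, Polynomial.eval_mul,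
          ← hP' t ht, ← hP t ht]
        simp; field_simp; ring

theorem exists_polynomial_gaussMatrix (x y x' y' : Osc → ℂ) (μ ν : Osc →₀ ℕ) :
    ∃ P : Polynomial ℂ, P.natDegree ≤ level μ + level ν ∧ ∀ t : ℂ, t ≠ 0 →
      t ^ level ν * gaussMatrix (fun p => x p + x' p * t ^ (p.2 : ℕ))
        (fun p => y p + y' p * (t ^ (p.2 : ℕ))⁻¹) μ ν = P.eval t := by
  classical
  choose P hPd hP using fun p : Osc => exists_polynomial_gaussCoeff (x p) (y p) (x' p) (y' p)
    (μ p) (ν p)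
  set s := μ.support ∪ ν.support with hs
  have hμ : μ.support ⊆ s := Finset.subset_union_left
  have hν : ν.support ⊆ s := Finset.subset_union_right
  -- The mode `a_{j,m}` sees `t ^ m`, so its polynomial is expanded by `m`; this turns occupation
  -- numbers into levels in the degree bound.
  refine ⟨∏ p ∈ s, Polynomial.expand ℂ (p.2 : ℕ) (P p), ?_, fun t ht => ?_⟩
  · refine (Polynomial.natDegree_prod_le _ _).trans ?_
    rw [level_eq_sum hμ, level_eq_sum hν, ← Finset.sum_add_distrib]
    refine Finset.sum_le_sum fun p _ => ?_
    rw [Polynomial.natDegree_expand, mul_comm, ← mul_add]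
    exact Nat.mul_le_mul_left _ (hPd p)
  · rw [gaussMatrix_eq_prod _ _ _ _ s hμ hν, level_eq_sum hν, ← Finset.prod_pow_eq_pow_sum,
      ← Finset.prod_mul_distrib, Polynomial.eval_prod]
    refine Finset.prod_congr rfl fun p _ => ?_
    rw [Polynomial.expand_eval, ← hP p _ (pow_ne_zero _ ht), ← pow_mul]

namespace Vertex

/-- The exponent of `z` in `:exp (∑ s_j P_j log z + …):` between the zero modes of `|j⟩` and the
vacuum of the oscillators. -/
def charge (V : Vertex) (j : State) : ℂ := ∑ p, V.s p * j.1 p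

theorem op_homogeneous (k : ℝ) (V : Vertex) (ζ : ℂ) (i j : State) :
    V.op k ζ i j =
      Complex.exp ((V.charge j + ((level i.2 : ℂ) - level j.2)) * ζ) * V.op k 0 i j := by
  unfold op gaussOp
  split_ifs
  · rw [gaussMatrix_scale, gaussMatrix_scale, mul_left_comm, ← mul_assoc, ← mul_assoc,
      ← mul_assoc, ← Complex.exp_add, ← Complex.exp_add, ← Complex.exp_add]
    congr 2
    simp only [charge, add_mul, Finset.sum_add_distrib, Finset.sum_mul, mul_zero, zero_mul,
      Finset.sum_const_zero]
    have : ∀ p, V.s p * j.1 p * ζ = V.s p * ζ * j.1 p := fun p => by ring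
    simp only [this]
    ring
  · simp

/-- The matrix element `⟨i| :V(z) W(w): |j⟩` is `z ^ A w ^ B P(w / z)`. -/
def IsMatrixPolynomial (k : ℝ) (V W : Vertex) (i j : State) (P : Polynomial ℂ) : Prop :=
  P.natDegree ≤ level i.2 + level j.2 ∧ ∀ ζ ω, V.op₂ k W ζ ω i j =
    Complex.exp ((V.charge j + level i.2) * ζ + (W.charge j - level j.2) * ω) *
      P.eval (Complex.exp (ω - ζ))

theorem exists_isMatrixPolynomial (k : ℝ) (V W : Vertex) (i j : State) :
    ∃ P, IsMatrixPolynomial k V W i j P := by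
  by_cases h : i.1 = j.1 + (V.Q + W.Q) * zeroComm k
  · obtain ⟨P, hPd, hP⟩ := exists_polynomial_gaussMatrix V.x V.y W.x W.y i.2 j.2
    refine ⟨Polynomial.C (Complex.exp (∑ p, (V.t p + W.t p) * j.1 p)) * P,
      (Polynomial.natDegree_C_mul_le _ _).trans hPd, fun ζ ω => ?_⟩
    rw [op₂, gaussOp, if_pos h, Polynomial.eval_mul, Polynomial.eval_C,
      ← hP _ (Complex.exp_ne_zero _)]
    have hx : ((fun i : Osc => V.x i * Complex.exp ((i.2 : ℕ) * ζ)) +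
        fun i => W.x i * Complex.exp ((i.2 : ℕ) * ω)) = fun p : Osc =>
          (V.x p + W.x p * Complex.exp (ω - ζ) ^ (p.2 : ℕ)) * Complex.exp ((p.2 : ℕ) * ζ) := by
      funext p
      rw [Pi.add_apply, add_mul, mul_assoc (W.x p), ← Complex.exp_nat_mul, ← Complex.exp_add]
      congr 3; ring
    have hy : ((fun i : Osc => V.y i * Complex.exp (-((i.2 : ℕ) * ζ))) +
        fun i => W.y i * Complex.exp (-((i.2 : ℕ) * ω))) = fun p : Osc =>
          (V.y p + W.y p * (Complex.exp (ω - ζ) ^ (p.2 : ℕ))⁻¹) *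
            Complex.exp (-((p.2 : ℕ) * ζ)) := by
      funext p
      rw [Pi.add_apply, add_mul, mul_assoc (W.y p), ← Complex.exp_nat_mul, ← Complex.exp_neg,
        ← Complex.exp_add]
      congr 3; ring
    rw [hx, hy, gaussMatrix_scale, ← Complex.exp_nat_mul]
    simp only [← mul_assoc, ← Complex.exp_add]
    congr 2
    simp only [charge, Pi.add_apply, add_mul, sub_mul, Finset.sum_add_distrib, Finset.sum_mul]
    have : ∀ (U : Vertex) ζ p, U.s p * j.1 p * ζ = U.s p * ζ * j.1 p := fun U ζ p => by ring
    simp only [this]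
    ring
  · refine ⟨0, by simp, fun ζ ω => ?_⟩
    rw [op₂, gaussOp, if_neg h]
    simp

/-- Exchanging the factors replaces `w / z` by its inverse. The polynomial is reversed with respect
to the formal degree `level i + level j`, not its actual degree. -/
theorem IsMatrixPolynomial.reflect {k : ℝ} {V W : Vertex} {i j : State} {P : Polynomial ℂ}
    (h : IsMatrixPolynomial k V W i j P) :
    IsMatrixPolynomial k W V i j (P.reflect (level i.2 + level j.2)) := by
  refine ⟨?_, fun ω ζ => ?_⟩
  · exact (Polynomial.natDegree_reflect_le).trans (max_le le_rfl h.1)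
  · let := invertibleOfNonzero (Complex.exp_ne_zero (ω - ζ))
    have hr := Polynomial.eval₂_reflect_mul_pow (RingHom.id ℂ) (Complex.exp (ω - ζ))
      (level i.2 + level j.2) P h.1
    rw [invOf_eq_inv, ← Complex.exp_neg, neg_sub] at hr
    rw [op₂_comm, h.2, ← Polynomial.eval₂_id, ← hr, ← Complex.exp_nat_mul, Polynomial.eval₂_id,
      mul_left_comm, ← Complex.exp_add, mul_comm]
    congr 2
    push_cast; ring

end Vertex

/-! ### Coefficients of products of vertex operators -/

theorem coeff_eq_of_eventually_hasSum {a b : ℕ → ℂ} {s : ℂ → ℂ}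
    (ha : ∀ᶠ u in 𝓝[≠] (0 : ℂ), HasSum (fun n => a n * u ^ n) (s u))
    (hb : ∀ᶠ u in 𝓝[≠] (0 : ℂ), HasSum (fun n => b n * u ^ n) (s u)) : a = b := by
  set p := FormalMultilinearSeries.ofScalars ℂ (a - b) with hp
  have hpc : ∀ n, p.coeff n = a n - b n := fun n => by
    rw [hp, FormalMultilinearSeries.coeff_ofScalars, Pi.sub_apply]
  -- The series are compared off `0` only, so the value of the difference at `0` is not known in
  -- advance; continuity of a power series forces it to vanish.
  have h : HasFPowerSeriesAt (fun u => if u = 0 then a 0 - b 0 else 0) p (0 : ℂ) := by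
    rw [hasFPowerSeriesAt_iff]
    have ha' := eventually_nhdsWithin_iff.1 ha
    have hb' := eventually_nhdsWithin_iff.1 hb
    filter_upwards [ha', hb'] with u ha hb
    rw [zero_add]
    split_ifs with hu
    · subst hu
      have := hasSum_single (f := fun n => (0 : ℂ) ^ n • p.coeff n) 0 fun n hn => by simp [hn]
      simpa [hpc] using this
    · refine hasSum_of_eq ((ha hu).sub (hb hu)) (fun n => ?_) (by ring)
      rw [hpc, smul_eq_mul]; ring
  have h0 : a 0 - b 0 = 0 := by
    have h1 := h.continuousAt.tendsto.mono_left (nhdsWithin_le_nhds (s := {0}ᶜ))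
    rw [if_pos rfl] at h1
    refine tendsto_nhds_unique h1 (tendsto_const_nhds.congr' ?_)
    filter_upwards [self_mem_nhdsWithin] with u hu
    exact (if_neg hu).symm
  rw [h0] at h
  simp only [ite_self] at h
  have hp0 := h.eq_zero
  funext n
  have := hpc n
  rw [hp0] at this
  exact sub_eq_zero.1 this.symm

/-- The coefficients of the expansion of `κ (1 - α u) / (1 - β u)` in powers of `u`. -/
def ratioCoeff (κ α β : ℂ) : ℤ → ℂ
  | .ofNat 0 => κ
  | .ofNat (n + 1) => κ * (β - α) * β ^ n
  | .negSucc _ => 0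

theorem hasSum_ratioCoeff (κ α β : ℂ) : ∀ᶠ u in 𝓝 (0 : ℂ), 1 - β * u ≠ 0 ∧
    HasSum (fun n : ℕ => ratioCoeff κ α β n * u ^ n) (κ * (1 - α * u) / (1 - β * u)) := by
  have hc : Tendsto (fun u : ℂ => ‖β * u‖) (𝓝 0) (𝓝 0) := by
    have : Continuous fun u : ℂ => ‖β * u‖ := by fun_prop
    simpa using this.tendsto 0
  filter_upwards [hc.eventually_lt_const one_pos] with u hu
  have h1 : 1 - β * u ≠ 0 := by
    intro h
    rw [← sub_eq_zero.1 h, norm_one] at hu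
    exact lt_irrefl _ hu
  refine ⟨h1, (hasSum_nat_add_iff' 1).1 ?_⟩
  refine hasSum_of_eq ((hasSum_geometric_of_norm_lt_one hu).mul_left (κ * (β - α) * u))
    (fun n => ?_) ?_
  · rw [pow_succ u, mul_pow]
    have : ratioCoeff κ α β ((n + 1 : ℕ) : ℤ) = κ * (β - α) * β ^ n := rfl
    rw [this]; ring
  · have : ratioCoeff κ α β ((0 : ℕ) : ℤ) = κ := rfl
    rw [Finset.sum_range_one, this]
    field_simp
    ring

theorem ratioCoeff_of_neg (κ α β : ℂ) {m : ℤ} (hm : m < 0) : ratioCoeff κ α β m = 0 := by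
  cases m with
  | ofNat n => exact absurd hm (by simp)
  | negSucc n => rfl

theorem hasSum_ratioCoeff_sub {κ α β u c : ℂ}
    (h : HasSum (fun n : ℕ => ratioCoeff κ α β n * u ^ n) c) (d : ℕ) :
    HasSum (fun n : ℕ => ratioCoeff κ α β ((n : ℤ) - d) * u ^ n) (c * u ^ d) := by
  refine (Function.Injective.hasSum_iff (add_left_injective d) fun n hn => ?_).1 ?_
  · have : n < d := by
      by_contra hc
      exact hn ⟨n - d, Nat.sub_add_cancel (not_lt.1 hc)⟩
    rw [ratioCoeff_of_neg _ _ _ (by omega), zero_mul]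
  · refine hasSum_of_eq (h.mul_right (u ^ d)) (fun n => ?_) rfl
    simp only [Function.comp_apply]
    push_cast
    rw [add_sub_cancel_right, pow_add, mul_assoc]

/-- The bridge from functions to modes: grouping a convergent sum by the weight `w` gives a power
series in `u`, so uniqueness of coefficients evaluates each weight separately. -/
theorem hasSum_fiber {ι : Type*} {w : ι → ℕ} {g : ι → ℂ} {s : ℂ → ℂ}
    (h : ∀ᶠ u in 𝓝[≠] (0 : ℂ), HasSum (fun l => g l * u ^ w l) (s u)) {a : ℕ → ℂ}
    (ha : ∀ᶠ u in 𝓝[≠] (0 : ℂ), HasSum (fun n => a n * u ^ n) (s u)) (n : ℕ) :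
    HasSum (fun l => if w l = n then g l else 0) (a n) := by
  set S : ℕ → ℂ := fun n => ∑' l : {l // w l = n}, g l with hS
  have hmul : ∀ n u, ∑' l : {l // w l = n}, g l * u ^ w l = S n * u ^ n := fun n u => by
    rw [hS, ← tsum_mul_right]
    exact tsum_congr fun l => by rw [l.2]
  have hfib : ∀ u, ∀ (t : ℂ), HasSum (fun l => g l * u ^ w l) t →
      ∀ n, HasSum (fun l : {l // w l = n} => g l * u ^ w l) (S n * u ^ n) := fun u t ht n => by
    rw [← hmul]
    exact (ht.summable.comp_injective Subtype.val_injective).hasSum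
  have hSa : S = a := coeff_eq_of_eventually_hasSum (h.mono fun u hu =>
    ((Equiv.sigmaFiberEquiv w).hasSum_iff.2 hu).sigma (hfib u _ hu)) ha
  obtain ⟨u, hu, hu0⟩ := (h.and self_mem_nhdsWithin).exists
  have hu0' : u ^ n ≠ 0 := pow_ne_zero _ hu0
  have h1 : HasSum (fun l : {l // w l = n} => g l) (S n) := by
    refine hasSum_of_eq ((hfib u _ hu n).mul_right (u ^ n)⁻¹) (fun l => ?_) ?_
    · rw [l.2, mul_assoc, mul_inv_cancel₀ hu0', mul_one]
    · rw [mul_assoc, mul_inv_cancel₀ hu0', mul_one]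
  rw [← hSa]
  refine hasSum_of_eq ((hasSum_subtype_iff_indicator (s := {l | w l = n})).1 h1) (fun l => ?_) rfl
  simp [Set.indicator_apply]

theorem hasSum_fiber_of_ratio {ι : Type*} {w : ι → ℕ} {g : ι → ℂ} {P : Polynomial ℂ} {D : ℕ}
    (hP : P.natDegree ≤ D) {κ α β : ℂ}
    (h : ∀ᶠ u in 𝓝[≠] (0 : ℂ), HasSum (fun l => g l * u ^ w l)
      (κ * (1 - α * u) / (1 - β * u) * P.eval u)) (N : ℤ) :
    HasSum (fun l => if (w l : ℤ) = N then g l else 0)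
      (∑ d ∈ Finset.range (D + 1), P.coeff d * ratioCoeff κ α β (N - d)) := by
  cases N with
  | ofNat n =>
    have ha : ∀ᶠ u in 𝓝[≠] (0 : ℂ), HasSum (fun n : ℕ => (∑ d ∈ Finset.range (D + 1),
        P.coeff d * ratioCoeff κ α β ((n : ℤ) - d)) * u ^ n)
        (κ * (1 - α * u) / (1 - β * u) * P.eval u) := by
      filter_upwards [(hasSum_ratioCoeff κ α β).filter_mono nhdsWithin_le_nhds] with u hu
      refine hasSum_of_eq (hasSum_sum (s := Finset.range (D + 1)) fun d _ =>
        (hasSum_ratioCoeff_sub hu.2 d).mul_left (P.coeff d)) (fun n => ?_) ?_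
      · rw [Finset.sum_mul]
        exact Finset.sum_congr rfl fun d _ => by ring
      · rw [Polynomial.eval_eq_sum_range' (Nat.lt_succ_of_le hP), Finset.mul_sum]
        exact Finset.sum_congr rfl fun d _ => by ring
    refine hasSum_of_eq (hasSum_fiber h ha n) (fun l => ?_) rfl
    simp
  | negSucc n =>
    refine hasSum_of_eq hasSum_zero (fun l => if_neg (by omega)) ?_
    refine (Finset.sum_eq_zero fun d _ => ?_).symm
    rw [ratioCoeff_of_neg _ _ _ (by omega), mul_zero]

theorem Vertex.hasSum_op_mul_level (k : ℝ) {V W : Vertex} (hV : V.Bounded) (hW : W.Bounded)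
    {α β : ℂ} (h : ExpSeriesEq (contr V W) (fun u => 1 - α * u) fun u => 1 - β * u)
    {i j : State} {P : Polynomial ℂ} (hP : IsMatrixPolynomial k V W i j P) (N : ℤ) :
    HasSum (fun l : State => if (level l.2 : ℤ) = N then V.op k 0 i l * W.op k 0 l j else 0)
      (∑ d ∈ Finset.range (level i.2 + level j.2 + 1),
        P.coeff d * ratioCoeff (Complex.exp (zeroConst k V W)) α β (N - d)) := by
  refine hasSum_fiber_of_ratio hP.1 (w := fun l : State => level l.2) ?_ N
  filter_upwards [(hasSum_op_mul k hV hW h).filter_mono nhdsWithin_le_nhds,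
    (hasSum_ratioCoeff 1 α β).filter_mono nhdsWithin_le_nhds, self_mem_nhdsWithin]
    with u ⟨c, hc, hu⟩ hβ hu0
  have hu0 : u ≠ 0 := hu0
  have he : Complex.exp (Complex.log u - 0) = u := by rw [sub_zero, Complex.exp_log hu0]
  have hc' : c = (1 - α * u) / (1 - β * u) := by rw [eq_div_iff hβ.1, hc]
  -- Take `z = 1` and `w = u`. The exponential removes the complex power of `u`, so that the
  -- intermediate state `l` contributes exactly `u ^ level l`; hence the choice of logarithm is
  -- immaterial.
  have key := (hu 0 (Complex.log u) he i j).mul_left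
    (Complex.exp (-((W.charge j - level j.2) * Complex.log u)))
  refine hasSum_of_eq key (fun l => ?_) ?_
  · rw [op_homogeneous k W (Complex.log u)]
    nth_rewrite 1 [← Complex.exp_log hu0]
    rw [← Complex.exp_nat_mul]
    have : ∀ a b c d : ℂ, a * (b * (c * d)) = b * d * (a * c) := fun a b c d => by ring
    rw [this, ← Complex.exp_add]
    congr 2
    ring
  · rw [hP.2, he, mul_zero, mul_zero, zero_add, zero_add, hc']
    have : Complex.exp (-((W.charge j - level j.2) * Complex.log u)) *
        Complex.exp ((W.charge j - level j.2) * Complex.log u) = 1 := by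
      rw [← Complex.exp_add, neg_add_cancel, Complex.exp_zero]
    linear_combination (Complex.exp (zeroConst k V W) * ((1 - α * u) / (1 - β * u)) *
      P.eval u) * this

/-- The hypotheses say that one rational function is expanded at `0` and at `∞`. The difference is
`X ∑ (β u) ^ m` over all integers: positive powers come from the first expansion, negative ones from
the second, and the constant terms differ by `X`. -/
theorem ratioCoeff_sub_of_inv {κ κ' α β α' β' X : ℂ} (hβ' : β' = β⁻¹)
    (h : κ * (β - α) = X * β) (h' : κ' * (β' - α') = -(X * β')) (hX : κ - κ' = X) (m : ℤ) :
    ratioCoeff κ α β m - ratioCoeff κ' α' β' (-m) = X * β ^ m := by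
  match m with
  | .ofNat 0 => simpa [ratioCoeff] using hX
  | .ofNat (n + 1) =>
    rw [ratioCoeff_of_neg κ' _ _ (by simp; omega), sub_zero]
    have : ratioCoeff κ α β (.ofNat (n + 1)) = κ * (β - α) * β ^ n := rfl
    rw [this, h, Int.ofNat_eq_natCast, zpow_natCast, pow_succ']
    ring
  | .negSucc n =>
    rw [ratioCoeff_of_neg κ _ _ (Int.negSucc_lt_zero n), Int.neg_negSucc]
    have : ratioCoeff κ' α' β' ((n + 1 : ℕ) : ℤ) = κ' * (β' - α') * β' ^ n := rfl
    rw [this, h', zpow_negSucc, hβ', ← inv_pow, pow_succ]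
    ring

theorem ratioCoeff_zero_sub (κ : ℂ) (m : ℤ) :
    ratioCoeff κ 0 0 m - ratioCoeff κ 0 0 (-m) = 0 := by
  match m with
  | .ofNat 0 => simp
  | .ofNat (n + 1) =>
    rw [ratioCoeff_of_neg κ _ _ (m := -_) (by simp; omega)]
    simp [ratioCoeff]
  | .negSucc n =>
    rw [ratioCoeff_of_neg κ _ _ (Int.negSucc_lt_zero n), Int.neg_negSucc]
    have : ratioCoeff κ 0 0 ((n + 1 : ℕ) : ℤ) = κ * (0 - 0) * 0 ^ n := rfl
    rw [this]
    ring

/-- A delta function times a polynomial evaluates it on the support: `∑ P_d X x ^ (N - d) = X x ^ N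
P(x⁻¹)`. The level `level i + level j - N` in the opposite order belongs to the same pair of modes.
-/
theorem Vertex.hasSum_commutator (k : ℝ) {V W : Vertex} (hV : V.Bounded) (hW : W.Bounded)
    {α β α' β' : ℂ} (h : ExpSeriesEq (contr V W) (fun u => 1 - α * u) fun u => 1 - β * u)
    (h' : ExpSeriesEq (contr W V) (fun u => 1 - α' * u) fun u => 1 - β' * u) {X x : ℂ}
    (hX : ∀ m, ratioCoeff (Complex.exp (zeroConst k V W)) α β m -
      ratioCoeff (Complex.exp (zeroConst k W V)) α' β' (-m) = X * x ^ m) {ζ ω : ℂ}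
    (hx : Complex.exp (ω - ζ) = x⁻¹) (i j : State) (N : ℤ) :
    ∃ S T : ℂ,
      HasSum (fun l : State => if (level l.2 : ℤ) = N then V.op k 0 i l * W.op k 0 l j else 0) S ∧
      HasSum (fun l : State => if (level l.2 : ℤ) = level i.2 + level j.2 - N then
        W.op k 0 i l * V.op k 0 l j else 0) T ∧
      S - T = X * x ^ N * (Complex.exp (-((V.charge j + level i.2) * ζ +
        (W.charge j - level j.2) * ω)) * V.op₂ k W ζ ω i j) := by
  obtain ⟨P, hP⟩ := exists_isMatrixPolynomial k V W i j
  refine ⟨_, _, hasSum_op_mul_level k hV hW h hP N, hasSum_op_mul_level k hW hV h' hP.reflect _, ?_⟩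
  have hx0 : x ≠ 0 := fun hc => by
    rw [hc, inv_zero] at hx
    exact Complex.exp_ne_zero _ hx
  -- Substituting `level i + level j - d` for `d` undoes the reversal of the polynomial.
  have hT : ∑ d ∈ Finset.range (level i.2 + level j.2 + 1),
      (P.reflect (level i.2 + level j.2)).coeff d * ratioCoeff (Complex.exp (zeroConst k W V)) α' β'
        (level i.2 + level j.2 - N - d) =
      ∑ d ∈ Finset.range (level i.2 + level j.2 + 1),
        P.coeff d * ratioCoeff (Complex.exp (zeroConst k W V)) α' β' (-(N - d)) := by
    rw [← Finset.sum_range_reflect]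
    refine Finset.sum_congr rfl fun d hd => ?_
    rw [Finset.mem_range] at hd
    rw [Polynomial.coeff_reflect, Polynomial.revAt_le (by omega)]
    congr 2
    · omega
    · omega
  rw [hP.2, ← mul_assoc (Complex.exp _), ← Complex.exp_add, neg_add_cancel, Complex.exp_zero,
    one_mul, hx, Polynomial.eval_eq_sum_range' (Nat.lt_succ_of_le hP.1), Finset.mul_sum, hT,
    ← Finset.sum_sub_distrib]
  refine Finset.sum_congr rfl fun d _ => ?_
  rw [← mul_sub, hX, zpow_sub₀ hx0, zpow_natCast, inv_pow]
  ring

/-! ### Modes -/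

/-- `A(z)` maps `|j⟩` to a series in `z ^ (ch j + n)`, `n ∈ ℤ`, and is homogeneous. -/
def Graded (A : ℂ → Op State) (ch : State → ℂ) : Prop :=
  ∀ ζ i j, A ζ i j = Complex.exp ((ch j + ((level i.2 : ℂ) - level j.2)) * ζ) * A 0 i j

open Classical in
/-- The modes of a homogeneous current. -/
def mode (A : ℂ → Op State) (ch : State → ℂ) (a : ℂ) : Op State := fun i j =>
  if a = ch j + ((level i.2 : ℂ) - level j.2) then A 0 i j else 0

theorem Graded.isModeExpansion {A : ℂ → Op State} {ch : State → ℂ} (h : Graded A ch) :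
    IsModeExpansion A (mode A ch) := by
  intro i j
  have h0 : ∀ a, a ≠ ch j + ((level i.2 : ℂ) - level j.2) → mode A ch a i j = 0 :=
    fun a ha => if_neg ha
  refine ⟨(Set.finite_singleton (ch j + ((level i.2 : ℂ) - level j.2))).subset fun a ha => ?_,
    fun ζ => ?_⟩
  · by_contra hc
    exact ha (h0 a hc)
  · rw [finsum_eq_single _ (ch j + ((level i.2 : ℂ) - level j.2)) fun a ha => by
      rw [h0 a ha, zero_mul], h, mode, if_pos rfl, mul_comm]

/-- Monodromy fixes the exponent modulo integers, but only through a non-zero matrix element: on an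
annihilated vector every exponent would be single-valued. -/
theorem Graded.exists_int {A : ℂ → Op State} {ch : State → ℂ} (h : Graded A ch) {a : ℂ} {j : State}
    (hne : ∃ i, A 0 i j ≠ 0) (ha : SingleValued A a j) : ∃ n : ℤ, a = ch j + n := by
  obtain ⟨i, hi⟩ := hne
  have h1 := ha i 0
  rw [h, zero_add, mul_zero, Complex.exp_zero, one_mul, ← mul_assoc, ← Complex.exp_add] at h1
  have h2 := mul_right_cancel₀ hi (h1.trans (one_mul _).symm)
  obtain ⟨n, hn⟩ := Complex.exp_eq_one_iff.1 h2
  refine ⟨level i.2 - level j.2 - n, ?_⟩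
  have hpi : (2 * Real.pi * Complex.I : ℂ) ≠ 0 := Complex.two_pi_I_ne_zero
  have h3 : ch j + ((level i.2 : ℂ) - level j.2) - a = n := by
    refine mul_right_cancel₀ hpi ?_
    rw [← hn]; ring
  push_cast
  linear_combination -h3

/-- As `B` preserves the charge seen by `A`, the two conditions on complex exponents become integer
conditions: one fixes the level of the intermediate state, the other the total degree. -/
theorem mode_mul_mode {A B : ℂ → Op State} {ch ch' : State → ℂ} {j : State}
    (hch : ∀ l, B 0 l j ≠ 0 → ch l = ch j) (n n' : ℤ) (i l : State) :
    mode A ch (ch j + n) i l * mode B ch' (ch' j + n') l j =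
      if (level l.2 : ℤ) = level i.2 - n ∧ n + n' = level i.2 - level j.2 then
        A 0 i l * B 0 l j else 0 := by
  by_cases hB : B 0 l j = 0
  · have : mode B ch' (ch' j + n') l j = 0 := by
      rw [mode, hB, ite_self]
    rw [this, hB, mul_zero, mul_zero, ite_self]
  · have e1 : ch j + (n : ℂ) = ch l + ((level i.2 : ℂ) - level l.2) ↔
        (level l.2 : ℤ) = level i.2 - n := by
      rw [hch l hB, add_right_inj]
      constructor
      · intro h
        have : n = level i.2 - level l.2 := by exact_mod_cast h
        omega
      · intro h
        have : n = level i.2 - level l.2 := by omega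
        exact_mod_cast this
    have e2 : ch' j + (n' : ℂ) = ch' j + ((level l.2 : ℂ) - level j.2) ↔
        n' = level l.2 - level j.2 := by
      rw [add_right_inj]
      norm_cast
    simp only [mode, e1, e2]
    split_ifs with h1 h2 h3 h3 h3
    all_goals first | rfl | (exfalso; omega) | simp

theorem graded_of_vertices {ι : Type} [Fintype ι] {k : ℝ} {A : ℂ → Op State} {V : ι → Vertex}
    {a : ι → ℂ} (hA : ∀ ζ i j, A ζ i j = ∑ p, a p * (V p).op k ζ i j) {ch : State → ℂ}
    (hch : ∀ p j, (V p).charge j = ch j) : Graded A ch := by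
  intro ζ i j
  rw [hA, hA, Finset.mul_sum]
  refine Finset.sum_congr rfl fun p _ => ?_
  rw [Vertex.op_homogeneous, hch]
  ring

/-- `W` shifts the charge seen by `V` by exactly the power of `z` in their contraction. -/
theorem Vertex.charge_eq_of_op_ne_zero {k : ℝ} {V W : Vertex} (h : zeroPow k V W = 0) {l j : State}
    (hne : W.op k 0 l j ≠ 0) : V.charge l = V.charge j := by
  have hl : l.1 = j.1 + W.Q * zeroComm k := by
    by_contra hc
    exact hne (if_neg hc)
  simp only [charge, hl, Pi.add_apply, Pi.mul_apply, mul_add, Finset.sum_add_distrib]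
  rw [add_eq_left]
  exact h

theorem charge_eq_of_sum_ne_zero {κ : Type} [Fintype κ] {k : ℝ} {B : ℂ → Op State} {W : κ → Vertex}
    {b : κ → ℂ} (hB : ∀ ζ i j, B ζ i j = ∑ q, b q * (W q).op k ζ i j) {V : Vertex}
    (h : ∀ q, Vertex.zeroPow k V (W q) = 0) {l j : State} (hne : B 0 l j ≠ 0) :
    V.charge l = V.charge j := by
  rw [hB] at hne
  obtain ⟨q, -, hq⟩ := Finset.exists_ne_zero_of_sum_ne_zero hne
  exact Vertex.charge_eq_of_op_ne_zero (h q) (right_ne_zero_of_mul hq)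

/-- The commutator of modes of two finite sums of vertex operators. -/
theorem hasSum_mode_commutator {ι κ : Type} [Fintype ι] [Fintype κ] [Nonempty ι] [Nonempty κ]
    (k : ℝ) {A B : ℂ → Op State} {V : ι → Vertex} {W : κ → Vertex} {a : ι → ℂ} {b : κ → ℂ}
    (hA : ∀ ζ i j, A ζ i j = ∑ p, a p * (V p).op k ζ i j)
    (hB : ∀ ζ i j, B ζ i j = ∑ p, b p * (W p).op k ζ i j)
    (hV : ∀ p, (V p).Bounded) (hW : ∀ p, (W p).Bounded)
    (hZ : ∀ p q, Vertex.zeroPow k (V p) (W q) = 0) (hZ' : ∀ q p, Vertex.zeroPow k (W q) (V p) = 0)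
    {chA chB : State → ℂ} (hchA : ∀ p j, (V p).charge j = chA j)
    (hchB : ∀ q j, (W q).charge j = chB j) {α β α' β' X x ζ ω : ι → κ → ℂ}
    (h : ∀ p q, ExpSeriesEq (Vertex.contr (V p) (W q)) (fun u => 1 - α p q * u)
      fun u => 1 - β p q * u)
    (h' : ∀ p q, ExpSeriesEq (Vertex.contr (W q) (V p)) (fun u => 1 - α' p q * u)
      fun u => 1 - β' p q * u)
    (hX : ∀ p q m, ratioCoeff (Complex.exp (Vertex.zeroConst k (V p) (W q))) (α p q) (β p q) m -
      ratioCoeff (Complex.exp (Vertex.zeroConst k (W q) (V p))) (α' p q) (β' p q) (-m) =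
        X p q * x p q ^ m)
    (hx : ∀ p q, Complex.exp (ω p q - ζ p q) = (x p q)⁻¹) (i j : State) (n n' : ℤ) :
    ∃ s t : ℂ,
      HasSum (fun l => mode A chA (chA j + n) i l * mode B chB (chB j + n') l j) s ∧
      HasSum (fun l => mode B chB (chB j + n') i l * mode A chA (chA j + n) l j) t ∧
      s - t = if n + n' = level i.2 - level j.2 then
        ∑ p, ∑ q, a p * b q * (X p q * x p q ^ (level i.2 - n) *
          (Complex.exp (-((chA j + level i.2) * ζ p q + (chB j - level j.2) * ω p q)) *
            (V p).op₂ k (W q) (ζ p q) (ω p q) i j)) else 0 := by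
  obtain ⟨p₀⟩ := ‹Nonempty ι›
  obtain ⟨q₀⟩ := ‹Nonempty κ›
  have hAB := fun l => mode_mul_mode (A := A) (B := B) (ch := chA) (ch' := chB) (fun l hl => by
    rw [← hchA p₀, ← hchA p₀]; exact charge_eq_of_sum_ne_zero hB (hZ p₀) hl) n n' i l (j := j)
  have hBA := fun l => mode_mul_mode (A := B) (B := A) (ch := chB) (ch' := chA) (fun l hl => by
    rw [← hchB q₀, ← hchB q₀]; exact charge_eq_of_sum_ne_zero hA (hZ' q₀) hl) n' n i l (j := j)
  by_cases hn : n + n' = level i.2 - level j.2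
  · choose S T hS hT hST using fun p q => Vertex.hasSum_commutator k (hV p) (hW q) (h p q) (h' p q)
      (hX p q) (hx p q) i j (level i.2 - n)
    refine ⟨∑ p, ∑ q, a p * b q * S p q, ∑ p, ∑ q, a p * b q * T p q, ?_, ?_, ?_⟩
    · refine hasSum_of_eq (hasSum_sum fun p _ => hasSum_sum fun q _ =>
        (hS p q).mul_left (a p * b q)) (fun l => ?_) rfl
      rw [hAB, hA, hB, Finset.sum_mul_sum]
      split_ifs with h1 h2 h2
      · exact Finset.sum_congr rfl fun p _ => Finset.sum_congr rfl fun q _ => by ring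
      · exact absurd h1.1 h2
      · exact absurd ⟨h2, hn⟩ h1
      · simp
    · refine hasSum_of_eq (hasSum_sum fun p _ => hasSum_sum fun q _ =>
        (hT p q).mul_left (a p * b q)) (fun l => ?_) rfl
      rw [hBA, hA, hB, Finset.sum_mul_sum, Finset.sum_comm]
      split_ifs with h1 h2 h2
      · exact Finset.sum_congr rfl fun p _ => Finset.sum_congr rfl fun q _ => by ring
      · exact absurd (by omega) h2
      · exact absurd (by omega) h1
      · simp
    · rw [if_pos hn, ← Finset.sum_sub_distrib]
      refine Finset.sum_congr rfl fun p _ => ?_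
      rw [← Finset.sum_sub_distrib]
      refine Finset.sum_congr rfl fun q _ => ?_
      rw [← mul_sub, hST, hchA, hchB]
  · refine ⟨0, 0, hasSum_of_eq hasSum_zero (fun l => ?_) rfl,
      hasSum_of_eq hasSum_zero (fun l => ?_) rfl, by rw [if_neg hn, sub_zero]⟩
    · rw [hAB, if_neg fun hc => hn hc.2]
    · rw [hBA, if_neg fun hc => hn (by rw [add_comm]; exact hc.2)]

theorem commCoeff_ne_zero {lq : ℂ} (hq : ‖Complex.exp lq‖ < 1) {r k : ℝ} (hr : 0 < r) (hkr : k < r)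
    (hk0 : k ≠ 0) {j : Fin 3} (hj : j ≠ 1) (m : ℕ+) : commCoeff lq r k (j, m) ≠ 0 := by
  have h2 := brk_pow_ne_zero hq (x := 2) two_ne_zero m
  have hk := brk_pow_ne_zero hq hk0 m
  have hr := brk_pow_ne_zero hq hr.ne' m
  have hrk := brk_pow_ne_zero hq (sub_pos.2 hkr).ne' m
  have hm : ((m : ℕ) : ℂ) ≠ 0 := by exact_mod_cast m.ne_zero
  rw [Complex.ofReal_ofNat] at h2
  rw [Complex.ofReal_sub] at hrk
  fin_cases j
  · rw [Fin.zero_eta, commCoeff_zero]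
    exact mul_ne_zero (div_ne_zero (mul_ne_zero h2 hk) hm) (div_ne_zero hr hrk)
  · exact absurd rfl hj
  · refine (commCoeff_two lq r k m).symm ▸ ?_
    exact neg_ne_zero.2 (div_ne_zero (mul_ne_zero h2 hk) hm)

/-- A sum of vertex operators as in `E(z)` and `F(z)` does not annihilate any basis vector. -/
theorem exists_sum_para_ne_zero {lq : ℂ} (hq : ‖Complex.exp lq‖ < 1) {r k : ℝ} (hr : 0 < r)
    (hkr : k < r) (hk0 : k ≠ 0) {ε : ℝ} (hε : ε ≠ 0) (s : ℂ) {c : ℕ+ → ℂ} (hc : ∀ m, c m ≠ 0)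
    (j : State) : ∃ i, ∑ b, paraCoeff lq ε b *
      ((paraVertex lq r k ε b).add (zeroVertex lq r k s c)).op k 0 i j ≠ 0 := by
  classical
  -- The witness keeps the `a_1` quanta of `j`, adds one `a_{1,-1}` and drops all other quanta. The
  -- term `true` creates no `a_1` quanta and cannot reach it, so nothing can cancel the term
  -- `false`.
  set μ : Osc →₀ ℕ := j.2.filter (fun p => p.1 = 1) + Finsupp.single (1, 1) 1 with hμ
  have hε' : (ε : ℂ) ≠ 0 := by exact_mod_cast hε
  have hμ1 : μ (1, 1) = j.2 (1, 1) + 1 := by simp [hμ]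
  have hμ0 : ∀ p : Osc, p.1 ≠ 1 → μ p = 0 := fun p hp => by
    have : ((1, 1) : Osc) ≠ p := fun h => hp (by rw [← h])
    simp [hμ, hp, Finsupp.single_eq_of_ne' this]
  have hμ2 : ∀ m : ℕ+, ∃ c, μ (1, m) = j.2 (1, m) + c := fun m =>
    ⟨Finsupp.single ((1, 1) : Osc) 1 (1, m), by simp [hμ]⟩
  have h1 := fun m : ℕ+ => brk_pow_ne_zero hq (x := 1) one_ne_zero m
  have h2 := fun m : ℕ+ => brk_pow_ne_zero hq (x := 2) two_ne_zero m
  have hk := fun m : ℕ+ => brk_pow_ne_zero hq hk0 m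
  have hd := qpow_one_sub_ne_zero hq
  have hqp : ∀ y (m : ℕ+), qpow lq y ^ (m : ℕ) ≠ 0 := fun y m => pow_ne_zero _ (qpow_ne_zero _ _)
  simp only [Complex.ofReal_one] at h1
  simp only [Complex.ofReal_ofNat] at h2
  refine ⟨(j.1 + ((paraVertex lq r k ε false).add (zeroVertex lq r k s c)).Q * zeroComm k, μ), ?_⟩
  have ht : ((paraVertex lq r k ε true).add (zeroVertex lq r k s c)).op k 0
      (j.1 + ((paraVertex lq r k ε false).add (zeroVertex lq r k s c)).Q * zeroComm k, μ) j = 0 := by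
    rw [Vertex.op, gaussOp]
    split_ifs
    · rw [gaussMatrix, Finset.prod_eq_zero (i := ((1, 1) : Osc)), mul_zero]
      · simp [hμ1]
      · have : ((paraVertex lq r k ε true).add (zeroVertex lq r k s c)).x (1, 1) = 0 := by
          simp [Vertex.add, paraVertex, zeroVertex]
        rw [this, zero_mul]
        exact gaussCoeff_zero_left_of_lt _ _ _ (by rw [hμ1]; omega)
    · rfl
  rw [Fintype.sum_bool, ht, mul_zero, zero_add]
  refine mul_ne_zero (div_ne_zero hε' hd) ?_
  rw [Vertex.op, gaussOp, if_pos rfl]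
  refine mul_ne_zero (Complex.exp_ne_zero _) (Finset.prod_ne_zero_iff.2 ?_)
  rintro ⟨p, m⟩ -
  -- In the term `false`, `a_1` is only created, so its factor is `x ^ e / e!`; the other two bosons
  -- are emptied, with factor a power of `y`. All these coefficients are non-zero.
  by_cases hp : p = 1
  · subst hp
    obtain ⟨e, he⟩ := hμ2 m
    have hy : ((paraVertex lq r k ε false).add (zeroVertex lq r k s c)).y (1, m) = 0 := by
      simp [Vertex.add, paraVertex, zeroVertex]
    have hx : ((paraVertex lq r k ε false).add (zeroVertex lq r k s c)).x (1, m) ≠ 0 := by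
      simp [Vertex.add, paraVertex, zeroVertex, hε', hd, h1, h2, hqp]
    simp only [he, hy, zero_mul, gaussCoeff_zero_right_arg]
    exact div_ne_zero (pow_ne_zero _ (mul_ne_zero hx (Complex.exp_ne_zero _)))
      (by exact_mod_cast Nat.factorial_ne_zero _)
  · have hy : ((paraVertex lq r k ε false).add (zeroVertex lq r k s c)).y (p, m) ≠ 0 := by
      have hcc := commCoeff_ne_zero hq hr hkr hk0 hp m
      fin_cases p
      · simpa [Vertex.add, paraVertex, zeroVertex, hc] using hcc
      · exact absurd rfl hp
      · simpa [Vertex.add, paraVertex, zeroVertex, hε', hk, hqp] using hcc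
    rw [hμ0 _ hp, gaussCoeff_zero_left]
    exact pow_ne_zero _ (mul_ne_zero hy (Complex.exp_ne_zero _))

theorem graded_currentH (lq : ℂ) (r k ε : ℝ) :
    Graded (currentH lq r k ε) fun j => 2 * (vertexK lq r k).charge j := by
  intro ζ i j
  obtain ⟨P, -, hP⟩ := Vertex.exists_isMatrixPolynomial k (vertexK lq r k) (vertexK lq r k) i j
  simp only [currentH, hP]
  rw [← mul_assoc, ← Complex.exp_add]
  congr 2
  · ring
  · congr 1; ring

/-! ### The commutator of `E` and `F` -/

section commutator

variable {lq : ℂ} (hq : ‖Complex.exp lq‖ < 1) {r k : ℝ} (hr : 0 < r) (hkr : k < r) (hk0 : k ≠ 0)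
include hq hr hkr hk0

omit hq in
-- The boson `a_0` contributes `-2 / k` and the parafermions `2 / k`. So `E` and `F` do not shift
-- each other's exponents, and their commutator makes sense mode by mode.
theorem zeroPow_E_F (b b' : Bool) :
    Vertex.zeroPow k ((paraVertex lq r k (-1) b).add (vertexE lq r k))
      ((paraVertex lq r k 1 b').add (vertexF lq r k)) = 0 ∧
    Vertex.zeroPow k ((paraVertex lq r k 1 b').add (vertexF lq r k))
      ((paraVertex lq r k (-1) b).add (vertexE lq r k)) = 0 := by
  have hk : (k : ℂ) ≠ 0 := by exact_mod_cast hk0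
  have hr' : (r : ℂ) ≠ 0 := by exact_mod_cast hr.ne'
  have hrk : (r : ℂ) - k ≠ 0 := by rw [← Complex.ofReal_sub]; exact_mod_cast (sub_pos.2 hkr).ne'
  have h : chargeE r k * (chargeE r k * ((r - k) / r)) = 2 / k := by
    rw [← mul_assoc, chargeE_mul_self hk0]; field_simp
  rw [vertexE_eq, vertexF_eq lq hr hkr hk0, zeroPow_add_add lq r hk0, zeroPow_add_add lq r hk0]
  constructor <;> push_cast <;> linear_combination -h

omit hq in
theorem charge_E_add_charge_F (b b' : Bool) (j : State) :
    ((paraVertex lq r k (-1) b).add (vertexE lq r k)).charge j +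
      ((paraVertex lq r k 1 b').add (vertexF lq r k)).charge j =
    2 * (vertexK lq r k).charge j := by
  have hk : (k : ℂ) ≠ 0 := by exact_mod_cast hk0
  have hr' : (r : ℂ) ≠ 0 := by exact_mod_cast hr.ne'
  rw [vertexE_eq, vertexF_eq lq hr hkr hk0, vertexK_eq lq hr hk0]
  cases b <;> cases b' <;>
    simp [Vertex.charge, Vertex.add, paraVertex, zeroVertex, Fin.sum_univ_three] <;>
    field_simp <;> ring

omit hq hr hkr in
-- Like terms have a simple pole and leave a delta function with coefficient `∓(q - q⁻¹)`; unlike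
-- terms commute.
theorem ratioCoeff_E_F (b b' : Bool) (m : ℤ) :
    ratioCoeff (Complex.exp (Vertex.zeroConst k
        ((paraVertex lq r k (-1) b).add (vertexE lq r k))
        ((paraVertex lq r k 1 b').add (vertexF lq r k))))
      (edgeRoots lq k b b').1 (edgeRoots lq k b b').2 m -
    ratioCoeff (Complex.exp (Vertex.zeroConst k
        ((paraVertex lq r k 1 b').add (vertexF lq r k))
        ((paraVertex lq r k (-1) b).add (vertexE lq r k))))
      (edgeRoots lq k (!b) (!b')).1 (edgeRoots lq k (!b) (!b')).2 (-m) =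
    (if b = b' then (if b then -1 else 1) * (qpow lq 1 - qpow lq (-1)) else 0) *
      (if b then qpow lq k else (qpow lq k)⁻¹) ^ m := by
  have hg := qpow_ne_zero lq 1
  have hk := qpow_ne_zero lq k
  have e2 : qpow lq (k + 2) = qpow lq k * qpow lq 1 ^ 2 := by
    rw [qpow_add, ← qpow_mul_nat]; norm_num
  have hc : Complex.exp lq = qpow lq 1 := by rw [qpow, one_mul]
  rw [vertexE, vertexF, zeroConst_add_add lq r hk0, zeroConst_add_add lq r hk0]
  cases b <;> cases b' <;>
    simp only [edgeRoots, Bool.not_true, Bool.not_false, if_true, Bool.false_eq_true, if_false,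
      Complex.ofReal_one, Complex.ofReal_neg, one_mul, neg_mul, Complex.exp_neg, neg_neg, hc,
      reduceCtorEq, zero_mul, ratioCoeff_zero_sub, e2, qpow_neg]
  · refine ratioCoeff_sub_of_inv (inv_inv _).symm ?_ ?_ rfl m <;> field_simp <;> ring
  · rw [← neg_mul]
    refine ratioCoeff_sub_of_inv rfl ?_ ?_ (by ring) m <;> field_simp <;> ring

theorem commutatorRelation_currents : CommutatorRelation lq k (currentE lq r k) (currentF lq r k)
    (currentH lq r k 1) (currentH lq r k (-1)) := by
  have hE := currentE_eq_sum hq r k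
  have hF := currentF_eq_sum hq r k
  set chE : State → ℂ := ((paraVertex lq r k (-1) true).add (vertexE lq r k)).charge with hchE
  set chF : State → ℂ := ((paraVertex lq r k 1 true).add (vertexF lq r k)).charge with hchF
  have hE' : ∀ b j, ((paraVertex lq r k (-1) b).add (vertexE lq r k)).charge j = chE j :=
    fun b j => by cases b <;> rfl
  have hF' : ∀ b j, ((paraVertex lq r k 1 b).add (vertexF lq r k)).charge j = chF j :=
    fun b j => by cases b <;> rfl
  have hgE := graded_of_vertices hE hE'
  have hgF := graded_of_vertices hF hF'
  have hgH := graded_currentH lq r k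
  have hd := qpow_one_sub_ne_zero hq
  refine ⟨mode _ chE, mode _ chF, mode _ _, mode _ _, hgE.isModeExpansion, hgF.isModeExpansion,
    (hgH 1).isModeExpansion, (hgH (-1)).isModeExpansion, fun i j a b ha hb => ?_⟩
  have hck : ∀ m, (brk lq (qpow lq k ^ ((m : ℕ+) : ℕ)))⁻¹ ≠ 0 := fun m =>
    inv_ne_zero (brk_pow_ne_zero hq hk0 m)
  -- Neither current annihilates a basis vector, so the admissible exponents are exactly one coset
  -- of the integers each.
  obtain ⟨n, rfl⟩ := hgE.exists_int (by
    obtain ⟨i, hi⟩ := exists_sum_para_ne_zero hq hr hkr hk0 (ε := -1) (by norm_num) _ hck j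
    exact ⟨i, by rw [hE]; exact hi⟩) ha
  obtain ⟨n', rfl⟩ := hgF.exists_int (by
    have hrk := fun m => brk_pow_ne_zero hq (sub_pos.2 hkr).ne' m
    simp only [Complex.ofReal_sub] at hrk
    obtain ⟨i, hi⟩ := exists_sum_para_ne_zero hq hr hkr hk0 (ε := 1) (by norm_num) _
      (fun m => neg_ne_zero.2 (mul_ne_zero (hck m)
        (div_ne_zero (hrk m) (brk_pow_ne_zero hq hr.ne' m)))) j
    exact ⟨i, by rw [hF]; exact hi⟩) hb
  obtain ⟨s, t, hs, ht, hst⟩ := hasSum_mode_commutator k hE hF (addVertexE_bounded hq hkr hk0)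
    (addVertexF_bounded hq hr hkr hk0) (fun b b' => (zeroPow_E_F hr hkr hk0 b b').1)
    (fun b' b => (zeroPow_E_F hr hkr hk0 b b').2) hE' hF' (expSeriesEq_E_F hq hr hkr hk0)
    (expSeriesEq_F_E hq hr hkr hk0) (ratioCoeff_E_F hk0)
    -- Points on the supports of the delta functions: `(z, w) = (1, q ^ (-k))` for the terms `true`
    -- and `(q ^ (-k), 1)` for the terms `false`. For unlike terms the coefficient is zero and the
    -- point plays no role.
    (ζ := fun b _ => if b then 0 else 0 + (-k) * lq) (ω := fun b _ => if b then 0 + (-k) * lq else 0)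
    (fun b _ => by
      cases b
      · simp [qpow]
      · simp [qpow, Complex.exp_neg]) i j n n'
  refine ⟨s, t, hs, ht, ?_⟩
  rw [hst]
  have hch : ∀ j, 2 * (vertexK lq r k).charge j = chE j + chF j := fun j =>
    (charge_E_add_charge_F hr hkr hk0 true true j).symm
  by_cases hn : n + n' = level i.2 - level j.2
  · have hn' : (n : ℂ) + n' = level i.2 - level j.2 := by exact_mod_cast hn
    have hab : chE j + n + (chF j + n') =
        2 * (vertexK lq r k).charge j + ((level i.2 : ℂ) - level j.2) := by
      rw [hch]; linear_combination hn'
    rw [if_pos hn, hab, mode, mode, if_pos rfl, if_pos rfl]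
    have hH : ∀ ε, qpow lq (-(k / 2) * (2 * (vertexK lq r k).charge j +
        ((level i.2 : ℂ) - level j.2))) * currentH lq r k ε 0 i j =
        currentH lq r k ε (0 + -(k / 2) * lq) i j := fun ε => by
      rw [hgH ε (0 + _), qpow]
      congr 2; ring
    rw [hH, hH, ← op₂_true_eq_currentH hq hr hkr hk0, ← op₂_false_eq_currentH hq hr hkr hk0]
    simp only [Fintype.sum_bool, paraCoeff, if_true, Bool.false_eq_true, if_false,
      reduceCtorEq, zero_mul, mul_zero, add_zero, zero_add]
    -- The power of `q ^ k` from the delta function and the monomial evaluated on its support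
    -- combine to `q ^ (k b)`; this uses that the total degree matches.
    have e1 : qpow lq k ^ ((level i.2 : ℤ) - n) *
        Complex.exp (-((chF j - level j.2) * (-k * lq))) = qpow lq (k * (chF j + n')) := by
      rw [qpow, qpow, ← Complex.exp_int_mul, ← Complex.exp_add]
      congr 1
      push_cast
      linear_combination -(k * lq) * hn'
    have e2 : (qpow lq k)⁻¹ ^ ((level i.2 : ℤ) - n) *
        Complex.exp (-((chE j + level i.2) * (-k * lq))) = qpow lq (k * (chE j + n)) := by
      rw [← qpow_neg, qpow, qpow, ← Complex.exp_int_mul, ← Complex.exp_add]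
      congr 1
      push_cast
      ring
    rw [← e1, ← e2]
    push_cast
    field_simp
    ring
  · have hab : chE j + n + (chF j + n') ≠
        2 * (vertexK lq r k).charge j + ((level i.2 : ℂ) - level j.2) := by
      intro h
      rw [hch] at h
      have : (n : ℂ) + n' = level i.2 - level j.2 := by linear_combination h
      exact hn (by exact_mod_cast this)
    rw [if_neg hn, mode, mode, if_neg hab, if_neg hab]
    ring

end commutator

end EllipticSl2

end

theorem theorem4p1 (lq : ℂ) (hq : ‖Complex.exp lq‖ < 1) (r k : ℝ) (hr : 0 < r) (hkr : k < r)
    (hk0 : k ≠ 0) (hk2 : k ≠ -2) :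
    EllipticSl2.SatisfiesRelations lq r k (EllipticSl2.currentK lq r k)
      (EllipticSl2.currentE lq r k) (EllipticSl2.currentF lq r k) := by
  exact ⟨EllipticSl2.exchange_K_K hq hr hkr hk0, EllipticSl2.exchange_K_E hq hr hkr hk0,
    EllipticSl2.exchange_K_F hq hr hkr hk0, EllipticSl2.exchange_E_E hq hr hkr hk0,
    EllipticSl2.exchange_F_F hq hr hkr hk0, EllipticSl2.currentH lq r k 1,
    EllipticSl2.currentH lq r k (-1), EllipticSl2.isH_currentH hq hr hkr hk0 1,
    EllipticSl2.isH_currentH hq hr hkr hk0 (-1),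
    EllipticSl2.commutatorRelation_currents hq hr hkr hk0⟩
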